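/- For $W\in M_{2,c}(\mathbb R)$ with columns $W_1,\dots,W_c$ and $b\in\mathbb R^c$, the TMS potential is $$H(W,b)=\sum_{i:\,b_i\le 0}H_i^-(W,b)+\sum_{i:\,b_i>0}H_i^+(W,b),$$ where, with $u_{ij}=W_i\cdot W_j$ and $N_i=(1-\|W_i\|^2)^2-3(1-\|W_i\|^2)b_i+3b_i^2$, $$H_i^-=\sum_{j\ne i,\ u_{ij}>0,\ -u_{ij}\le b_i}\frac{(u_{ij}+b_i)^3}{u_{ij}}+\begin{cases}\dfrac{b_i^3}{\|W_i\|^4}+\dfrac{b_i^3}{\|W_i\|^2}+N_i&\text{if } \|W_i\|^2>0,\ -\|W_i\|^2\le b_i,\\ 1&\text{otherwise,}\end{cases}$$ $$H_i^+=\sum_{j\ne i,\ -u_{ij}>b_i}\Big(-\frac{b_i^3}{u_{ij}}\Big)+\sum_{j\neq i,\ -u_{ij}\le b_i}\big(u_{ij}^2+3u_{ij}b_i+3b_i^2\big)+N_i .$$ Let $(l_1,\dots,l_c,\theta_1,\dots,\theta_c,b_1,\dots,b_c)$ with $\theta_1+\dots+\theta_c=2\pi$ be polar coordinates modulo rotation: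 $l_i=\|W_i\|$ and $\theta_i$ is the angle from $W_i$ to $W_{i+1}$. The regular $c$-gon with parameters $(l,b)$ is any $(W,b)$ with $l_i=l$, $\theta_i=2\pi/c$, $b_i=b$ for all $i$ (it is determined up to rotation). Let $(c,l_0,b_0)$ be one of $(5,\,1.17046,\,-0.28230)$, $(6,\,1.32053,\,-0.61814)$, $(7,\,1.44839,\,-0.96691)$, $(8,\,1.55045,\,-1.29119)$. Then there are $l^*>0$ and $b^*<0$ with $|l^*-l_0|<5\cdot10^{-6}$, $|b^*-b_0|<5\cdot 10^{-6}$ and $-(l^*)^2\cos(2\pi/c)<b^*$ such that: 1. Every regular $c$-gon with parameters $(l^*,b^*)$ is a critical point of $H$ on $M_{2,c}(\mathbb R)\times\mathbb R^c$, i.e. $H$ is differentiable there with zero derivative. Moreover $(l^*,b^*)$ is the only pair $(l,b)$ with $l>0$, $b\le 0$, $-l^2\cos(2\pi/c)\le b$ for which a regular $c$-gon with parameters $(l,b)$ is a critical point of $H$. 2. This critical point is non-degenerate modulo the $O(2)$-symmetry: as a function of the $3c-1$ coordinates $(l_1,\dots,l_c,\theta_1,\dots,\theta_{c-1},b_1,\dots,b_c)$,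 $H$ is $C^2$ near the $c$-gon, has a critical point with non-degenerate Hessian there, and in suitable smooth local coordinates $z_1,\dots,z_{3c-1}$ centred at it, $H=H^*+\sum_{i=1}^{3c-1}a_iz_i^2$ with all $a_i\ne0$, where $H^*$ is the value at the $c$-gon. 3. Every such $c$-gon $w^*$ is a local minimum of $H$ on $M_{2,c}(\mathbb R)\times\mathbb R^c$, and its local learning coefficient is $\lambda=(3c-1)/2$ (that is, $7$, $8.5$, $10$, $11.5$ for $c=5,6,7,8$). Here $\lambda$ is the local learning coefficient of $H$ at $w^*$ if there is an integer $m\ge1$ such that for every sufficiently small closed ball $B$ centred at $w^*$ there is $C>0$ with $$\operatorname{vol}\{w\in B: H(w)-H(w^*)<\varepsilon\}\sim C\,\varepsilon^{\lambda}(-\log\varepsilon)^{m-1}\qquad(\varepsilon\to0^+).$$ -/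

import Mathlib

open scoped Topology ContDiff

noncomputable section

namespace TMS

/-- The parameter space `M_{r,c}(ℝ) × ℝ^c`, with its Euclidean norm and Lebesgue measure:
the coordinate `Sum.inl (a, i)` is the entry `W_{a,i}`, the coordinate `Sum.inr i` is `b_i`. -/
abbrev Param (r c : ℕ) : Type := EuclideanSpace ℝ ((Fin r × Fin c) ⊕ Fin c)

/-- The weight matrix `W` of the parameter `w = (W, b)`. -/
def weight {r c : ℕ} (w : Param r c) : Matrix (Fin r) (Fin c) ℝ :=
  fun a i => w (Sum.inl (a, i))

/-- The bias vector `b` of the parameter `w = (W, b)`. -/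
def bias {r c : ℕ} (w : Param r c) : Fin c → ℝ :=
  fun i => w (Sum.inr i)

/-- The dot product `W_i ⬝ W_j` of two columns; `colDot W i i` is `‖W_i‖²`. -/
def colDot {r c : ℕ} (W : Matrix (Fin r) (Fin c) ℝ) (i j : Fin c) : ℝ :=
  ∑ a, W a i * W a j

/-- `N_i = (1 - ‖W_i‖²)² - 3 (1 - ‖W_i‖²) b_i + 3 b_i²`. -/
def termN {r c : ℕ} (W : Matrix (Fin r) (Fin c) ℝ) (b : Fin c → ℝ) (i : Fin c) : ℝ :=
  (1 - colDot W i i) ^ 2 - 3 * (1 - colDot W i i) * b i + 3 * b i ^ 2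

open Classical in
/-- `H_i⁻`, the contribution of index `i` when `b_i ≤ 0`. -/
def potentialNeg {r c : ℕ} (W : Matrix (Fin r) (Fin c) ℝ) (b : Fin c → ℝ) (i : Fin c) : ℝ :=
  (∑ j ∈ Finset.univ.erase i,
    if 0 < colDot W i j ∧ -colDot W i j ≤ b i ∧ b i ≤ 0 then
      1 / colDot W i j * (colDot W i j + b i) ^ 3
    else 0) +
  (if 0 < colDot W i i ∧ -colDot W i i ≤ b i ∧ b i ≤ 0 then
      b i ^ 3 / colDot W i i ^ 2 + b i ^ 3 / colDot W i i + termN W b i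
    else 1)

open Classical in
/-- `H_i⁺`, the contribution of index `i` when `b_i > 0`. -/
def potentialPos {r c : ℕ} (W : Matrix (Fin r) (Fin c) ℝ) (b : Fin c → ℝ) (i : Fin c) : ℝ :=
  (∑ j ∈ Finset.univ.erase i,
    if b i < -colDot W i j ∧ 0 < b i then
      -(1 / colDot W i j * b i ^ 3)
    else
      colDot W i j ^ 2 + 3 * colDot W i j * b i + 3 * b i ^ 2) +
  termN W b i

open Classical in
/-- The TMS potential `H(W, b)`. -/
def potential {r c : ℕ} (w : Param r c) : ℝ :=
  ∑ i, if bias w i ≤ 0 then potentialNeg (weight w) (bias w) i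
    else potentialPos (weight w) (bias w) i

/-- The space of coordinates `(l_1, …, l_c, θ_1, …, θ_{c-1}, b_1, …, b_c)`; the last angle is
determined by the constraint `θ_1 + ⋯ + θ_c = 2π`. -/
abbrev PolarCoord (c : ℕ) : Type := EuclideanSpace ℝ (Fin c ⊕ (Fin (c - 1) ⊕ Fin c))

/-- The parameter with coordinates `(l, θ, b)` whose first column has direction angle `φ`:
the column `W_i` has length `l_i` and direction angle `φ + θ_1 + ⋯ + θ_{i-1}`. -/
def ofPolar {c : ℕ} (φ : ℝ) (u : PolarCoord c) : Param 2 c :=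
  let angle : Fin c → ℝ := fun i =>
    φ + ∑ j : Fin (c - 1), if j.val < i.val then u (Sum.inr (Sum.inl j)) else 0
  WithLp.toLp 2 (Sum.elim
    (fun p => u (Sum.inl p.2) * if p.1 = 0 then Real.cos (angle p.2) else Real.sin (angle p.2))
    (fun i => u (Sum.inr (Sum.inr i))))

/-- The TMS potential for two hidden dimensions in the `(l, θ, b)`-parametrization. -/
def polarPotential {c : ℕ} (u : PolarCoord c) : ℝ := potential (ofPolar 0 u)

/-- The coordinates of the regular `c`-gon: `l_i = x`, `θ_i = 2π/c`, `b_i = y` for all `i`. -/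
def gonCoord (c : ℕ) (x y : ℝ) : PolarCoord c :=
  WithLp.toLp 2 (Sum.elim (fun _ => x) (Sum.elim (fun _ => 2 * Real.pi / c) (fun _ => y)))

/-- The regular `c`-gon with columns of length `x` and biases `y`, first column in direction `φ`. -/
def regularGon (c : ℕ) (x y φ : ℝ) : Param 2 c := ofPolar φ (gonCoord c x y)

/-- `p` is a critical point of `f`: `f` is differentiable at `p` with derivative zero. -/
def IsCriticalPoint {ι : Type} [Fintype ι] (f : EuclideanSpace ℝ ι → ℝ)
    (p : EuclideanSpace ℝ ι) : Prop :=
  HasFDerivAt f (0 : EuclideanSpace ℝ ι →L[ℝ] ℝ) p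

/-- In smooth local coordinates centred at `p`, the function `f - f p` is a full sum of squares
with nonzero coefficients. -/
def IsFullSumOfSquaresAt {ι : Type} [Fintype ι] (f : EuclideanSpace ℝ ι → ℝ)
    (p : EuclideanSpace ℝ ι) : Prop :=
  ∃ (Φ : OpenPartialHomeomorph (EuclideanSpace ℝ ι) (EuclideanSpace ℝ ι)) (a : ι → ℝ),
    p ∈ Φ.source ∧ Φ p = 0 ∧
    ContDiffOn ℝ ∞ Φ Φ.source ∧ ContDiffOn ℝ ∞ Φ.symm Φ.target ∧
    (∀ i, a i ≠ 0) ∧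
    ∀ q ∈ Φ.source, f q = f p + ∑ i, a i * (Φ q i) ^ 2

/-- `f` is twice continuously differentiable near `p` and its Hessian at `p` is a
non-degenerate bilinear form. -/
def HasNondegenerateHessianAt {ι : Type} [Fintype ι] (f : EuclideanSpace ℝ ι → ℝ)
    (p : EuclideanSpace ℝ ι) : Prop :=
  ContDiffAt ℝ 2 f p ∧
    ∀ v : EuclideanSpace ℝ ι, (∀ v', fderiv ℝ (fderiv ℝ f) p v v' = 0) → v = 0

/-- A non-degenerate critical point: critical, with non-degenerate Hessian, and `f` is a full sum
of squares with nonzero coefficients in suitable local coordinates. -/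
def IsNondegenerateCriticalPoint {ι : Type} [Fintype ι] (f : EuclideanSpace ℝ ι → ℝ)
    (p : EuclideanSpace ℝ ι) : Prop :=
  IsCriticalPoint f p ∧ HasNondegenerateHessianAt f p ∧ IsFullSumOfSquaresAt f p

/-- `lam` is the local learning coefficient of `f` at the local minimum `p`: there is a
multiplicity `m ≥ 1` such that, for every sufficiently small closed ball `B` around `p`,
`vol {q ∈ B | f q - f p < ε} ∼ C ε ^ lam (-log ε) ^ (m - 1)` as `ε → 0⁺`, with `C > 0`. -/
def IsLocalLearningCoefficient {ι : Type} [Fintype ι] (f : EuclideanSpace ℝ ι → ℝ)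
    (p : EuclideanSpace ℝ ι) (lam : ℝ) : Prop :=
  IsLocalMin f p ∧
  ∃ m : ℕ, 1 ≤ m ∧ ∀ᶠ ρ : ℝ in 𝓝[>] 0, ∃ C : ℝ, 0 < C ∧
    Filter.Tendsto
      (fun ε : ℝ =>
        MeasureTheory.volume.real {q | q ∈ Metric.closedBall p ρ ∧ f q - f p < ε} /
          (ε ^ lam * (-Real.log ε) ^ (m - 1)))
      (𝓝[>] 0) (𝓝 C)

end TMS

end

/-!
Near a regular `c`-gon with `5 ≤ c ≤ 8`, `b < 0` and `-l² cos (2π / c) < b`, two columns interact in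
the potential only if they are equal or cyclic neighbours, so that `H` coincides there with the
analytic function `TMS.localPotential` (`TMS.eventually_potential_eq_localPotential`). If the
inequalities are weak, this still holds for the polygons themselves, which is enough to derive two
equations for a critical polygon (`TMS.IsCriticalPoint.equations`). With `k = cos (2π / c)`, `S =
l²` and `b = -k T S`, they amount to an equation that determines `S` from `T` and a quartic equation
for `T`. The quartic is convex in `T` and negative at `T = 1`, hence has at most one root in `[0,
1]`, and one is located by the intermediate value theorem (`TMS.gonQuartic_root_le`,
`TMS.exists_gon_minimum`).

The second variation at the polygon, in the coordinates `(l, θ, b)`, is a sum over the edges of one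
and the same quadratic form in the variations of two neighbouring lengths, two neighbouring biases
and the angle in between (`TMS.secondVariation_eq`). The sum is positive definite because already
each summand is: completing the square in the angle leaves two binary forms, one even and one odd
under exchange of the two columns (`TMS.EdgeFormPosDef.pos`), whose determinants are bounded below
by interval arithmetic (`TMS.GonPosDef.of_bounds`).

A smooth function with positive definite Hessian at a critical point is a sum of squares in smooth
coordinates (`exists_smooth_chart_norm_sq`). Together with the rotation angle, these coordinates
form a chart of the parameter space in which `H - H*` is the squared norm of `3c - 1` of the `3c`
coordinates. The volume of a sublevel set in a small ball is then computed by rescaling these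
coordinates by `√ε`, and is asymptotic to a constant times `ε ^ ((3c - 1) / 2)`
(`isLocalMin_and_tendsto_volume_sublevel`).
-/

section
open MeasureTheory Set
open scoped InnerProductSpace

/-! ### Smoothness of parametric integrals -/

theorem continuousOn_intervalIntegral_param {E F : Type} [NormedAddCommGroup E] [ProperSpace E]
    [NormedAddCommGroup F] [NormedSpace ℝ F] {V : Set E} (hV : IsOpen V)
    {g : E × ℝ → F} (hg : ContinuousOn g (V ×ˢ Icc 0 1)) :
    ContinuousOn (fun x => ∫ t in (0 : ℝ)..1, g (x, t)) V := by
  intro x₀ hx₀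
  obtain ⟨r, hr, hrV⟩ := Metric.nhds_basis_closedBall.mem_iff.1 (hV.mem_nhds hx₀)
  have hK : IsCompact (Metric.closedBall x₀ r ×ˢ Icc (0 : ℝ) 1) :=
    (isCompact_closedBall x₀ r).prod isCompact_Icc
  have hKW : Metric.closedBall x₀ r ×ˢ Icc (0 : ℝ) 1 ⊆ V ×ˢ Icc 0 1 :=
    prod_mono hrV Subset.rfl
  obtain ⟨M, hM⟩ := hK.exists_bound_of_continuousOn (hg.mono hKW)
  have hslice : ∀ x ∈ V, ContinuousOn (fun t => g (x, t)) (Icc 0 1) := fun x hx =>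
    hg.comp (by fun_prop) fun t ht => ⟨hx, ht⟩
  have hsub : uIoc (0 : ℝ) 1 ⊆ Icc 0 1 := by
    rw [uIoc_of_le zero_le_one]; exact Ioc_subset_Icc_self
  refine ContinuousAt.continuousWithinAt ?_
  refine intervalIntegral.continuousAt_of_dominated_interval (bound := fun _ => M)
    ?_ ?_ (by simp) ?_
  · filter_upwards [hV.mem_nhds hx₀] with x hx
    exact ((hslice x hx).mono hsub).aestronglyMeasurable measurableSet_uIoc
  · filter_upwards [Metric.closedBall_mem_nhds x₀ hr] with x hx
    exact Filter.Eventually.of_forall fun t ht => hM _ ⟨hx, hsub ht⟩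
  · refine Filter.Eventually.of_forall fun t ht => ?_
    have h1 : ContinuousOn (fun x => g (x, t)) V :=
      hg.comp (by fun_prop) fun x hx => ⟨hx, hsub ht⟩
    exact h1.continuousAt (hV.mem_nhds hx₀)

theorem hasFDerivAt_intervalIntegral_param {E F : Type} [NormedAddCommGroup E] [NormedSpace ℝ E]
    [ProperSpace E] [NormedAddCommGroup F] [NormedSpace ℝ F]
    {V : Set E} (hV : IsOpen V) {W : Set (E × ℝ)} (hW : IsOpen W) (hVW : V ×ˢ Icc 0 1 ⊆ W)
    {g : E × ℝ → F} (hg : ContDiffOn ℝ 1 g W) {x₀ : E} (hx₀ : x₀ ∈ V) :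
    HasFDerivAt (fun x => ∫ t in (0 : ℝ)..1, g (x, t))
      (∫ t in (0 : ℝ)..1, (fderiv ℝ g (x₀, t)).comp (ContinuousLinearMap.inl ℝ E ℝ)) x₀ := by
  obtain ⟨r, hr, hrV⟩ := Metric.nhds_basis_closedBall.mem_iff.1 (hV.mem_nhds hx₀)
  have hK : IsCompact (Metric.closedBall x₀ r ×ˢ Icc (0 : ℝ) 1) :=
    (isCompact_closedBall x₀ r).prod isCompact_Icc
  have hKW : Metric.closedBall x₀ r ×ˢ Icc (0 : ℝ) 1 ⊆ W :=
    (prod_mono hrV Subset.rfl).trans hVW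
  have hg' : ContinuousOn (fun q => (fderiv ℝ g q).comp (ContinuousLinearMap.inl ℝ E ℝ)) W :=
    (hg.continuousOn_fderiv_of_isOpen hW le_rfl).clm_comp continuousOn_const
  obtain ⟨M, hM⟩ := hK.exists_bound_of_continuousOn (hg'.mono hKW)
  have hsub : uIoc (0 : ℝ) 1 ⊆ Icc 0 1 := by
    rw [uIoc_of_le zero_le_one]; exact Ioc_subset_Icc_self
  have hslice : ∀ x ∈ V, ContinuousOn (fun t => g (x, t)) (Icc 0 1) := fun x hx =>
    hg.continuousOn.comp (by fun_prop) fun t ht => hVW ⟨hx, ht⟩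
  refine (intervalIntegral.hasFDerivAt_integral_of_dominated_of_fderiv_le
    (F' := fun x t => (fderiv ℝ g (x, t)).comp (ContinuousLinearMap.inl ℝ E ℝ))
    (bound := fun _ => M) (Metric.ball_mem_nhds x₀ hr) ?_ ?_ ?_ ?_ (by simp) ?_)
  · filter_upwards [hV.mem_nhds hx₀] with x hx
    exact ((hslice x hx).mono hsub).aestronglyMeasurable measurableSet_uIoc
  · exact ContinuousOn.intervalIntegrable (by rw [uIcc_of_le zero_le_one]; exact hslice x₀ hx₀)
  · have : ContinuousOn (fun t => (fderiv ℝ g (x₀, t)).comp (ContinuousLinearMap.inl ℝ E ℝ))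
        (Icc 0 1) := hg'.comp (f := fun t : ℝ => (x₀, t)) (by fun_prop) fun t ht => hVW ⟨hx₀, ht⟩
    exact (this.mono hsub).aestronglyMeasurable measurableSet_uIoc
  · exact Filter.Eventually.of_forall fun t ht x hx =>
      hM (x, t) ⟨Metric.ball_subset_closedBall hx, hsub ht⟩
  · refine Filter.Eventually.of_forall fun t ht x hx => ?_
    have hmem : (x, t) ∈ W := hKW ⟨Metric.ball_subset_closedBall hx, hsub ht⟩
    have h1 := ((hg.differentiableOn one_ne_zero).differentiableAt (hW.mem_nhds hmem)).hasFDerivAt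
    exact h1.comp x (hasFDerivAt_prodMk_left x t)

/-- Repeated differentiation under the integral sign. The neighbourhood `W` of `V × [0, 1]` makes
the hypothesis on `g` a statement on an open set, so that it passes to derivatives. -/
theorem contDiffOn_intervalIntegral_param {E : Type} [NormedAddCommGroup E] [NormedSpace ℝ E]
    [ProperSpace E] {V : Set E} (hV : IsOpen V) {W : Set (E × ℝ)} (hW : IsOpen W)
    (hVW : V ×ˢ Icc 0 1 ⊆ W) (n : ℕ) :
    ∀ {F : Type} [NormedAddCommGroup F] [NormedSpace ℝ F] {g : E × ℝ → F},
      ContDiffOn ℝ n g W → ContDiffOn ℝ n (fun x => ∫ t in (0 : ℝ)..1, g (x, t)) V := by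
  induction n with
  | zero =>
    intro F _ _ g hg
    simp only [Nat.cast_zero, contDiffOn_zero] at hg ⊢
    exact continuousOn_intervalIntegral_param hV (hg.mono hVW)
  | succ n ih =>
    intro F _ _ g hg
    push_cast at hg ⊢
    have h1 : ContDiffOn ℝ 1 g W := hg.of_le (by simp)
    have hder := fun x (hx : x ∈ V) => hasFDerivAt_intervalIntegral_param hV hW hVW h1 hx
    rw [contDiffOn_succ_iff_fderiv_of_isOpen hV]
    refine ⟨fun x hx => (hder x hx).differentiableAt.differentiableWithinAt, by simp, ?_⟩
    refine ContDiffOn.congr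
      (ih (g := fun q => (fderiv ℝ g q).comp (ContinuousLinearMap.inl ℝ E ℝ)) ?_)
      fun x hx => (hder x hx).fderiv
    exact (((contDiffOn_succ_iff_fderiv_of_isOpen hW).1 hg).2.2).clm_comp contDiffOn_const

/-! ### The Morse lemma at a nondegenerate minimum -/

theorem two_le_infty : (2 : WithTop ℕ∞) ≤ ∞ := by
  norm_cast

/-- Second-order Hadamard lemma: near a critical point `p`, a smooth function is `f p` plus a
quadratic form in `x - p` whose symmetric matrix `T x` depends smoothly on `x`, with value half
the Hessian at `p`. The matrix is the remainder integral of Taylor's formula. -/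
theorem exists_quadratic_remainder {E : Type} [NormedAddCommGroup E] [InnerProductSpace ℝ E]
    [CompleteSpace E] [ProperSpace E] {f : E → ℝ} {U : Set E} (hU : IsOpen U)
    (hf : ContDiffOn ℝ ∞ f U) {p : E} (hp : p ∈ U) (hcrit : fderiv ℝ f p = 0) :
    ∃ (V : Set E) (T : E → E →L[ℝ] E), IsOpen V ∧ p ∈ V ∧ V ⊆ U ∧ ContDiffOn ℝ ∞ T V ∧
      (∀ u v, ⟪T p u, v⟫_ℝ = 1 / 2 * fderiv ℝ (fderiv ℝ f) p u v) ∧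
      (∀ x ∈ V, ∀ u v, ⟪T x u, v⟫_ℝ = ⟪u, T x v⟫_ℝ) ∧
      ∀ x ∈ V, f x = f p + ⟪T x (x - p), x - p⟫_ℝ := by
  obtain ⟨r, hr, hrU⟩ := Metric.isOpen_iff.1 hU p hp
  -- The Riesz isomorphism, which turns the Hessian into a symmetric operator.
  let J : (E →L[ℝ] ℝ) →L[ℝ] E :=
    { toFun := (InnerProductSpace.toDual ℝ E).symm
      map_add' := fun φ ψ => map_add _ φ ψ
      map_smul' := fun a φ => by simp
      cont := (InnerProductSpace.toDual ℝ E).symm.continuous }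
  have hJ : ∀ (φ : E →L[ℝ] ℝ) (v : E), ⟪J φ, v⟫_ℝ = φ v := fun φ v =>
    InnerProductSpace.toDual_symm_apply
  have hfd : ContDiffOn ℝ ∞ (fderiv ℝ f) U := hf.fderiv_of_isOpen hU (by simp)
  let H : E → E →L[ℝ] E := fun x => J.comp (fderiv ℝ (fderiv ℝ f) x)
  have hH : ContDiffOn ℝ ∞ H U :=
    contDiffOn_const.clm_comp (hfd.fderiv_of_isOpen hU (by simp))
  have hHinner : ∀ x u v, ⟪H x u, v⟫_ℝ = fderiv ℝ (fderiv ℝ f) x u v := fun x u v => hJ _ v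
  have hseg : ∀ x ∈ Metric.ball p r, ∀ t ∈ Icc (0 : ℝ) 1, p + t • (x - p) ∈ U := by
    intro x hx t ht
    refine hrU ?_
    rw [Metric.mem_ball, dist_eq_norm] at hx ⊢
    calc ‖p + t • (x - p) - p‖ = t * ‖x - p‖ := by
          rw [add_sub_cancel_left, norm_smul, Real.norm_of_nonneg ht.1]
      _ ≤ 1 * ‖x - p‖ := by gcongr; exact ht.2
      _ < r := by simpa using hx
  let g : E × ℝ → E →L[ℝ] E := fun q => (1 - q.2) • H (p + q.2 • (q.1 - p))
  let T : E → E →L[ℝ] E := fun x => ∫ t in (0 : ℝ)..1, g (x, t)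
  let W : Set (E × ℝ) := (fun q : E × ℝ => p + q.2 • (q.1 - p)) ⁻¹' U
  have hW : IsOpen W := hU.preimage (by fun_prop)
  have hVW : Metric.ball p r ×ˢ Icc (0 : ℝ) 1 ⊆ W := fun q hq => hseg q.1 hq.1 q.2 hq.2
  have hline : ContDiffOn ℝ ∞ (fun q : E × ℝ => p + q.2 • (q.1 - p)) W := by fun_prop
  have hg : ContDiffOn ℝ ∞ g W :=
    (contDiff_const.sub contDiff_snd).contDiffOn.smul (hH.comp hline fun q hq => hq)
  have hgcont : ∀ x ∈ Metric.ball p r, IntervalIntegrable (fun t => g (x, t)) volume 0 1 := by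
    intro x hx
    refine ContinuousOn.intervalIntegrable ?_
    rw [uIcc_of_le zero_le_one]
    exact hg.continuousOn.comp (f := fun t : ℝ => (x, t)) (by fun_prop) fun t ht => hVW ⟨hx, ht⟩
  have hT : ∀ x ∈ Metric.ball p r, ∀ u v,
      ⟪T x u, v⟫_ℝ = ∫ t in (0 : ℝ)..1, (1 - t) * fderiv ℝ (fderiv ℝ f) (p + t • (x - p)) u v := by
    intro x hx u v
    have h1 := ContinuousLinearMap.intervalIntegral_comp_comm
      ((innerSL ℝ v).comp (ContinuousLinearMap.apply ℝ E u)) (hgcont x hx)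
    have h2 : ⟪T x u, v⟫_ℝ = ∫ t in (0 : ℝ)..1, ⟪v, g (x, t) u⟫_ℝ := by
      rw [real_inner_comm]; simpa using h1.symm
    rw [h2]
    refine intervalIntegral.integral_congr fun t _ => ?_
    simp only [g, smul_apply, inner_smul_right]
    rw [real_inner_comm, hHinner]
  refine ⟨Metric.ball p r, T, Metric.isOpen_ball, Metric.mem_ball_self hr, hrU, ?_, ?_, ?_, ?_⟩
  · rw [contDiffOn_infty]
    intro n
    exact contDiffOn_intervalIntegral_param Metric.isOpen_ball hW hVW n
      (hg.of_le (mod_cast le_top))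
  · intro u v
    have h2 : ∫ t in (0 : ℝ)..1, (1 - t) = 1 / 2 := by
      rw [intervalIntegral.integral_sub (by simp) (by simp)]; norm_num
    rw [hT p (Metric.mem_ball_self hr)]
    simp only [sub_self, smul_zero, add_zero, intervalIntegral.integral_mul_const, h2]
  · intro x hx u v
    rw [real_inner_comm (T x v) u, hT x hx, hT x hx]
    refine intervalIntegral.integral_congr fun t ht => ?_
    rw [uIcc_of_le zero_le_one] at ht
    have hsymm : IsSymmSndFDerivAt ℝ f (p + t • (x - p)) :=
      (hf.contDiffAt (hU.mem_nhds (hseg x hx t ht))).isSymmSndFDerivAt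
        (by simpa using two_le_infty)
    simp only [hsymm u v]
  · intro x hx
    have h1 := map_add_eq_sum_add_integral_iteratedFDeriv (f := f) (x := p) (y := x - p) (n := 1)
      fun t ht => (hf.contDiffAt (hU.mem_nhds (hseg x hx t ht))).of_le
        (by norm_num; exact two_le_infty)
    rw [add_sub_cancel] at h1
    rw [h1, hT x hx]
    simp [Finset.sum_range_succ, iteratedFDeriv_two_apply, hcrit]

/-- In a Banach algebra, squaring has a smooth local inverse at `1`, because its derivative there is
multiplication by `2`. -/
theorem exists_smooth_sqrt (𝓐 : Type) [NormedRing 𝓐] [NormedAlgebra ℝ 𝓐] [CompleteSpace 𝓐] :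
    ∃ e : OpenPartialHomeomorph 𝓐 𝓐, (1 : 𝓐) ∈ e.source ∧ (∀ x, e x = x * x) ∧
      ContDiffOn ℝ ∞ e.symm e.target := by
  have hsq : ContDiff ℝ ω (fun x : 𝓐 => x * x) := contDiff_id.mul contDiff_id
  let two : 𝓐 ≃L[ℝ] 𝓐 := ContinuousLinearEquiv.smulLeft (Units.mk0 (2 : ℝ) two_ne_zero)
  have hder : HasFDerivAt (fun x : 𝓐 => x * x) (two : 𝓐 →L[ℝ] 𝓐) 1 := by
    have h1 := (hasFDerivAt_id (𝕜 := ℝ) (1 : 𝓐)).mul' (hasFDerivAt_id (1 : 𝓐))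
    refine h1.congr_fderiv ?_
    ext x
    simp [two, two_smul, Units.smul_def]
  have hs := hsq.contDiffAt (x := 1)
  -- The inverse function is smooth only near `1`, so the target is shrunk afterwards.
  set e₀ := hs.toOpenPartialHomeomorph (fun x : 𝓐 => x * x) hder (by simp) with he₀
  have hmem : (1 : 𝓐) ∈ e₀.source := hs.mem_toOpenPartialHomeomorph_source hder (by simp)
  have he₀1 : e₀ 1 = 1 := by simp [he₀]
  have h1t : (1 : 𝓐) ∈ e₀.target := by rw [← he₀1]; exact e₀.map_source hmem
  have hinv : ContDiffAt ℝ ω e₀.symm 1 := by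
    have := hs.to_localInverse hder (by simp)
    rwa [mul_one] at this
  obtain ⟨O, hO, hOopen, h1O⟩ := eventually_nhds_iff.1 (hinv.eventually (by simp))
  refine ⟨(e₀.symm.restrOpen O hOopen).symm, ?_, fun x => ?_, ?_⟩
  · simp [hmem, he₀1, h1O]
  · simp [he₀]
  · intro y hy
    simp only [OpenPartialHomeomorph.symm_symm] at hy ⊢
    have hy' : y ∈ O := by
      simp at hy; exact hy.2
    exact ((hO y hy').of_le (by simp)).contDiffWithinAt

/-- A positive definite symmetric form is the pullback of the inner product under a linear
isomorphism: diagonalize it and rescale the coordinates by the roots of the diagonal entries. -/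
theorem LinearMap.exists_equiv_inner_eq_of_pos {ι : Type} [Fintype ι]
    (T : EuclideanSpace ℝ ι →L[ℝ] EuclideanSpace ℝ ι)
    (hsymm : ∀ u v, ⟪T u, v⟫_ℝ = ⟪u, T v⟫_ℝ) (hpos : ∀ v, v ≠ 0 → 0 < ⟪T v, v⟫_ℝ) :
    ∃ L : EuclideanSpace ℝ ι ≃L[ℝ] EuclideanSpace ℝ ι, ∀ u v, ⟪T u, v⟫_ℝ = ⟪L u, L v⟫_ℝ := by
  let B : LinearMap.BilinForm ℝ (EuclideanSpace ℝ ι) :=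
    LinearMap.mk₂ ℝ (fun u v => ⟪T u, v⟫_ℝ) (by simp [inner_add_left])
      (by simp [inner_smul_left]) (by simp [inner_add_right]) (by simp [inner_smul_right])
  have hB : ∀ v, B.toQuadraticMap v = ⟪T v, v⟫_ℝ := fun v => rfl
  obtain ⟨w, ⟨e⟩⟩ := QuadraticForm.equivalent_weightedSumSquares B.toQuadraticMap
  have he : ∀ v, ⟪T v, v⟫_ℝ = ∑ i, w i * (e v i * e v i) := by
    intro v
    rw [← hB, ← e.map_app v, QuadraticMap.weightedSumSquares_apply]
    simp
  have hw : ∀ i, 0 < w i := by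
    intro i
    have h1 := hpos (e.symm (Pi.single i 1)) (by
      intro h
      have := congrFun ((LinearEquiv.map_eq_zero_iff e.toLinearEquiv.symm).1 h) i
      simp at this)
    rw [he] at h1
    have h2 : e (e.symm (Pi.single i 1)) = Pi.single i 1 := e.toLinearEquiv.apply_symm_apply _
    rw [h2, Finset.sum_eq_single i] at h1
    · simpa using h1
    · intro j _ hj; simp [hj]
    · simp
  let σ : ι ≃ Fin (Module.finrank ℝ (EuclideanSpace ℝ ι)) :=
    Fintype.equivFinOfCardEq (by simp)
  let L₀ : EuclideanSpace ℝ ι →ₗ[ℝ] EuclideanSpace ℝ ι :=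
    { toFun := fun v => WithLp.toLp 2 fun i => √(w (σ i)) * e.toLinearEquiv v (σ i)
      map_add' := fun u v => by ext i; simp [mul_add]
      map_smul' := fun a v => by ext i; simp; ring }
  have hL₀ : ∀ v, ⟪L₀ v, L₀ v⟫_ℝ = ⟪T v, v⟫_ℝ := by
    intro v
    rw [he, ← σ.sum_comp, PiLp.inner_apply]
    refine Finset.sum_congr rfl fun i _ => ?_
    have h1 : L₀ v i = √(w (σ i)) * e v (σ i) := rfl
    rw [h1]
    simp only [RCLike.inner_apply, conj_trivial]
    nlinarith [Real.mul_self_sqrt (hw (σ i)).le]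
  have hinj : Function.Injective L₀ := by
    rw [← LinearMap.ker_eq_bot, LinearMap.ker_eq_bot']
    intro v hv
    by_contra h
    have := hpos v h
    rw [← hL₀, hv] at this
    simp at this
  let L := (LinearEquiv.ofInjectiveEndo L₀ hinj).toContinuousLinearEquiv
  have hL : ∀ v, L v = L₀ v := fun v => rfl
  refine ⟨L, fun u v => ?_⟩
  have h1 := hL₀ (u + v)
  have h2 := hL₀ u
  have h3 := hL₀ v
  have h4 := hsymm v u
  rw [real_inner_comm (T u) v] at h4
  simp only [map_add, inner_add_left, inner_add_right] at h1
  rw [h2, h3, real_inner_comm (L₀ u) (L₀ v), real_inner_comm u (T v)] at h1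
  rw [hL, hL]
  have h5 : ⟪T v, u⟫_ℝ = ⟪T u, v⟫_ℝ := by rw [hsymm, real_inner_comm]
  have h6 : ⟪u, T v⟫_ℝ = ⟪T u, v⟫_ℝ := (hsymm u v).symm
  linarith

/-- The Morse lemma at a minimum with positive definite Hessian. If `T x` is the matrix of
`exists_quadratic_remainder`, the chart is `x ↦ √(T x) (x - p)`, after a linear change of
coordinates that makes `T p` the identity, so that the root is the smooth one near `1`. -/
theorem exists_smooth_chart_norm_sq {ι : Type} [Fintype ι] {f : EuclideanSpace ℝ ι → ℝ}
    {U : Set (EuclideanSpace ℝ ι)} (hU : IsOpen U) (hf : ContDiffOn ℝ ∞ f U)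
    {p : EuclideanSpace ℝ ι} (hp : p ∈ U) (hcrit : fderiv ℝ f p = 0)
    (hpos : ∀ v, v ≠ 0 → 0 < fderiv ℝ (fderiv ℝ f) p v v) :
    ∃ Φ : OpenPartialHomeomorph (EuclideanSpace ℝ ι) (EuclideanSpace ℝ ι),
      p ∈ Φ.source ∧ Φ p = 0 ∧ ContDiffOn ℝ ∞ Φ Φ.source ∧ ContDiffOn ℝ ∞ Φ.symm Φ.target ∧
      ∀ q ∈ Φ.source, f q = f p + ‖Φ q‖ ^ 2 := by
  classical
  obtain ⟨V, T, hV, hpV, hVU, hT, hTp, hTsymm, hfT⟩ := exists_quadratic_remainder hU hf hp hcrit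
  obtain ⟨L, hL⟩ := LinearMap.exists_equiv_inner_eq_of_pos (T p) (hTsymm p hpV) fun v hv => by
    rw [hTp]; have := hpos v hv; positivity
  obtain ⟨e, he1, he, hesymm⟩ := exists_smooth_sqrt (EuclideanSpace ℝ ι →L[ℝ] EuclideanSpace ℝ ι)
  -- In the coordinates `L (x - p)` the matrix `T p` becomes the identity.
  let Ladj : EuclideanSpace ℝ ι →L[ℝ] EuclideanSpace ℝ ι :=
    ContinuousLinearMap.adjoint (L.symm : EuclideanSpace ℝ ι →L[ℝ] EuclideanSpace ℝ ι)
  let C : EuclideanSpace ℝ ι → EuclideanSpace ℝ ι →L[ℝ] EuclideanSpace ℝ ι := fun x =>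
    (Ladj.comp (T x)).comp (L.symm : EuclideanSpace ℝ ι →L[ℝ] EuclideanSpace ℝ ι)
  have hCinner : ∀ x u v, ⟪C x u, v⟫_ℝ = ⟪T x (L.symm u), L.symm v⟫_ℝ := by
    intro x u v
    simp only [C, Ladj, ContinuousLinearMap.comp_apply]
    exact ContinuousLinearMap.adjoint_inner_left _ _ _
  have hC : ContDiffOn ℝ ∞ C V :=
    (contDiffOn_const.clm_comp hT).clm_comp contDiffOn_const
  have hCp : C p = 1 := by
    ext1 u
    refine ext_inner_right ℝ fun v => ?_
    rw [hCinner, hL]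
    simp
  have hCstar : ∀ x ∈ V, star (C x) = C x := by
    intro x hx
    rw [ContinuousLinearMap.star_eq_adjoint, Eq.comm, ContinuousLinearMap.eq_adjoint_iff]
    intro u v
    rw [hCinner, hTsymm x hx, real_inner_comm, ← hCinner, real_inner_comm]
  let S : EuclideanSpace ℝ ι → EuclideanSpace ℝ ι →L[ℝ] EuclideanSpace ℝ ι := fun x => e.symm (C x)
  have he1' : e 1 = 1 := by rw [he, mul_one]
  have h1t : (1 : EuclideanSpace ℝ ι →L[ℝ] EuclideanSpace ℝ ι) ∈ e.target := by
    rw [← he1']; exact e.map_source he1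
  have hσ1 : e.symm 1 = 1 := by
    have h := e.left_inv he1
    rwa [he1'] at h
  -- Near `1` the square root of a symmetric matrix is symmetric, being the only square root.
  have hstar : ∀ᶠ D in 𝓝 (1 : EuclideanSpace ℝ ι →L[ℝ] EuclideanSpace ℝ ι),
      star D = D → star (e.symm D) = e.symm D := by
    have hc : ContinuousAt (fun D => star (e.symm D))
        (1 : EuclideanSpace ℝ ι →L[ℝ] EuclideanSpace ℝ ι) :=
      (ContinuousLinearMap.adjoint (𝕜 := ℝ) (E := EuclideanSpace ℝ ι)
        (F := EuclideanSpace ℝ ι)).continuous.continuousAt.comp (e.symm.continuousAt h1t)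
    have hmem : ∀ᶠ D in 𝓝 (1 : EuclideanSpace ℝ ι →L[ℝ] EuclideanSpace ℝ ι),
        star (e.symm D) ∈ e.source :=
      hc.eventually_mem (e.open_source.mem_nhds (by simpa [hσ1, star_one] using he1))
    filter_upwards [hmem, e.open_target.mem_nhds h1t] with D hD hDt hself
    refine e.injOn hD (e.map_target hDt) ?_
    rw [he, ← star_mul, ← he, e.right_inv hDt, hself]
  obtain ⟨O, hO, hOopen, h1O⟩ := eventually_nhds_iff.1
    (hstar.and (e.open_target.mem_nhds h1t))
  let V' : Set (EuclideanSpace ℝ ι) := V ∩ C ⁻¹' O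
  have hV' : IsOpen V' := hC.continuousOn.isOpen_inter_preimage hV hOopen
  have hpV' : p ∈ V' := ⟨hpV, by simpa [hCp] using h1O⟩
  have hS : ContDiffOn ℝ ∞ S V' :=
    hesymm.comp (hC.mono inter_subset_left) fun x hx => (hO _ hx.2).2
  let Φ₀ : EuclideanSpace ℝ ι → EuclideanSpace ℝ ι := fun x => S x (L (x - p))
  have hΦ₀ : ContDiffOn ℝ ∞ Φ₀ V' := hS.clm_apply (by fun_prop)
  have hΦ₀f : ∀ x ∈ V', f x = f p + ‖Φ₀ x‖ ^ 2 := by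
    intro x hx
    have h1 : star (S x) = S x := (hO _ hx.2).1 (hCstar x hx.1)
    have h2 : S x * S x = C x := by
      rw [← he]; exact e.right_inv (hO _ hx.2).2
    have h3 : ‖Φ₀ x‖ ^ 2 = ⟪C x (L (x - p)), L (x - p)⟫_ℝ := by
      have h4 := ContinuousLinearMap.adjoint_inner_left (S x) (L (x - p)) (S x (L (x - p)))
      rw [← ContinuousLinearMap.star_eq_adjoint, h1] at h4
      rw [← real_inner_self_eq_norm_sq, ← h2]
      exact h4.symm
    rw [h3, hCinner, hfT x hx.1]
    simp
  have hSp : S p = 1 := by simp only [S, hCp, hσ1]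
  have hder : HasFDerivAt Φ₀ (L : EuclideanSpace ℝ ι →L[ℝ] EuclideanSpace ℝ ι) p := by
    have h1 : HasFDerivAt S (fderiv ℝ S p) p :=
      ((hS.differentiableOn (by simp)).differentiableAt (hV'.mem_nhds hpV')).hasFDerivAt
    have h2 : HasFDerivAt (fun x => L (x - p))
        (L : EuclideanSpace ℝ ι →L[ℝ] EuclideanSpace ℝ ι) p :=
      (L : EuclideanSpace ℝ ι →L[ℝ] EuclideanSpace ℝ ι).hasFDerivAt.comp p
        ((hasFDerivAt_id p).sub_const p)
    refine (h1.clm_apply h2).congr_fderiv ?_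
    ext1 v
    simp [hSp]
  have hΦ₀p : ContDiffAt ℝ ∞ Φ₀ p := hΦ₀.contDiffAt (hV'.mem_nhds hpV')
  -- Where the derivative is invertible, the inverse of the chart is smooth.
  let V'' : Set (EuclideanSpace ℝ ι) := V' ∩ fderiv ℝ Φ₀ ⁻¹' {A | IsUnit A}
  have hV'' : IsOpen V'' :=
    (hΦ₀.continuousOn_fderiv_of_isOpen hV' (by simp)).isOpen_inter_preimage hV' Units.isOpen
  have hpV'' : p ∈ V'' := by
    refine ⟨hpV', ?_⟩
    simp only [mem_preimage, hder.fderiv, mem_ofPred_eq]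
    exact ((ContinuousLinearEquiv.unitsEquiv ℝ (EuclideanSpace ℝ ι)).symm L).isUnit
  let Φ := (hΦ₀p.toOpenPartialHomeomorph Φ₀ hder (by simp)).restrOpen V'' hV''
  have hΦsource : Φ.source ⊆ V'' := by
    intro x hx
    simp only [Φ, OpenPartialHomeomorph.restrOpen_source] at hx
    exact hx.2
  have hΦcoe : ∀ x, Φ x = Φ₀ x := fun x => rfl
  refine ⟨Φ, ?_, ?_, ?_, ?_, ?_⟩
  · simp only [Φ, OpenPartialHomeomorph.restrOpen_source]
    exact ⟨hΦ₀p.mem_toOpenPartialHomeomorph_source hder (by simp), hpV''⟩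
  · simp [hΦcoe, Φ₀]
  · exact hΦ₀.mono fun x hx => (hΦsource hx).1
  · intro y hy
    have hx := hΦsource (Φ.map_target hy)
    obtain ⟨A, hA⟩ := hx.2
    have hd : HasFDerivAt Φ ((ContinuousLinearEquiv.unitsEquiv ℝ (EuclideanSpace ℝ ι) A :
        EuclideanSpace ℝ ι ≃L[ℝ] EuclideanSpace ℝ ι) : EuclideanSpace ℝ ι →L[ℝ] EuclideanSpace ℝ ι)
        (Φ.symm y) := by
      have h1 := ((hΦ₀.differentiableOn (by simp)).differentiableAt
        (hV'.mem_nhds hx.1)).hasFDerivAt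
      rw [← hA] at h1
      exact h1
    exact (Φ.contDiffAt_symm hy hd (hΦ₀.contDiffAt (hV'.mem_nhds hx.1))).contDiffWithinAt
  · intro q hq
    exact hΦ₀f q (hΦsource hq).1

end

section
open MeasureTheory Set Filter
open scoped ENNReal

/-! ### Volume of sublevel sets near a curve of nondegenerate minima -/

/-- The linear map scaling the second factor of `ℝ × F` by `s`, seen on `E`. -/
noncomputable def scaleSnd {E F : Type} [NormedAddCommGroup E] [NormedSpace ℝ E]
    [NormedAddCommGroup F] [NormedSpace ℝ F] (A : E ≃L[ℝ] ℝ × F) (s : ℝ) : E →L[ℝ] E :=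
  (A.symm : ℝ × F →L[ℝ] E).comp
    (((ContinuousLinearMap.id ℝ ℝ).prodMap (s • ContinuousLinearMap.id ℝ F)).comp
      (A : E →L[ℝ] ℝ × F))

section scale
variable {E F : Type} [NormedAddCommGroup E] [NormedSpace ℝ E]
    [NormedAddCommGroup F] [NormedSpace ℝ F] (A : E ≃L[ℝ] ℝ × F)

theorem apply_scaleSnd (s : ℝ) (x : E) : A (scaleSnd A s x) = ((A x).1, s • (A x).2) := by
  simp only [scaleSnd, ContinuousLinearMap.comp_apply, ContinuousLinearEquiv.coe_coe,
    ContinuousLinearEquiv.apply_symm_apply]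
  rfl

theorem scaleSnd_scaleSnd_inv {s : ℝ} (hs : s ≠ 0) (x : E) :
    scaleSnd A s (scaleSnd A s⁻¹ x) = x := by
  apply A.injective
  simp only [apply_scaleSnd, smul_smul, mul_inv_cancel₀ hs, one_smul]

theorem scaleSnd_injective {s : ℝ} (hs : s ≠ 0) : Function.Injective (scaleSnd A s) := by
  intro x y h
  have h1 := congrArg A h
  rw [apply_scaleSnd, apply_scaleSnd, Prod.mk.injEq] at h1
  exact A.injective (Prod.ext h1.1 (smul_right_injective _ hs h1.2))

theorem det_scaleSnd [FiniteDimensional ℝ F] (s : ℝ) :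
    (scaleSnd A s).det = s ^ Module.finrank ℝ F := by
  have h := LinearMap.det_conj (LinearMap.prodMap (LinearMap.id : ℝ →ₗ[ℝ] ℝ)
    (s • (LinearMap.id : F →ₗ[ℝ] F))) A.symm.toLinearEquiv
  rw [LinearMap.det_prodMap, LinearMap.det_id, LinearMap.det_smul, LinearMap.det_id] at h
  exact Eq.trans (congrArg LinearMap.det rfl) (h.trans (by simp))

theorem continuous_scaleSnd_apply (x : E) : Continuous fun s => scaleSnd A s x := by
  have h : ∀ s, scaleSnd A s x = A.symm ((A x).1, s • (A x).2) := fun s => by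
    rw [← apply_scaleSnd, A.symm_apply_apply]
  simp only [h]
  fun_prop

theorem measurableSet_rescaled [MeasurableSpace E] [BorelSpace E] {N : Set E} (hN : IsOpen N)
    {r : E → ℝ} (hr : ContinuousOn r N) {ρ : ℝ} (s : ℝ) :
    MeasurableSet {x | scaleSnd A s x ∈ N ∧ r (scaleSnd A s x) ≤ ρ ∧ ‖(A x).2‖ < 1} := by
  have hO : IsOpen ((scaleSnd A s) ⁻¹' N ∩ {x | ‖(A x).2‖ < 1}) :=
    (hN.preimage (scaleSnd A s).continuous).inter (isOpen_lt (by fun_prop) (by fun_prop))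
  have hc : ContinuousOn (fun x => r (scaleSnd A s x))
      ((scaleSnd A s) ⁻¹' N ∩ {x | ‖(A x).2‖ < 1}) :=
    hr.comp (scaleSnd A s).continuous.continuousOn fun x hx => hx.1
  obtain ⟨u, hu, hu'⟩ := continuousOn_iff_isClosed.1 hc (Iic ρ) isClosed_Iic
  convert hu.measurableSet.inter hO.measurableSet using 1
  rw [← hu']
  ext x
  simp only [mem_ofPred_eq, mem_inter_iff, mem_preimage, mem_Iic]
  tauto

end scale

/-- For `x = A⁻¹ (φ, y)`, the integrals of a density `d (φ, s y)` over the part of the tube `‖y‖ <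
1` on which `(φ, s y)` lies in `N` and `r (φ, s y) ≤ ρ` converge, as `s → 0⁺`, to a positive finite
number, namely the integral for `s = 0`. This is dominated convergence; the indicator functions
converge almost everywhere because `r (φ, 0) = ρ` for countably many `φ` only. -/
theorem tendsto_lintegral_rescaled {E F : Type} [NormedAddCommGroup E] [NormedSpace ℝ E]
    [MeasurableSpace E] [BorelSpace E] (μ : Measure E) [μ.IsAddHaarMeasure]
    [NormedAddCommGroup F] [NormedSpace ℝ F] [FiniteDimensional ℝ F]
    (A : E ≃L[ℝ] ℝ × F) {φ₀ δ ρ M : ℝ} (hδ : 0 < δ) (hρ : 0 < ρ) {N : Set E}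
    (hN : N = A ⁻¹' (Metric.ball φ₀ δ ×ˢ Metric.ball 0 δ))
    {d : E → ℝ} (hd : ContinuousOn d N) (hdM : ∀ x ∈ N, d x ≤ M) (hdpos : ∀ x ∈ N, 0 < d x)
    {r : E → ℝ} (hr : ContinuousOn r N) (hr0 : r (A.symm (φ₀, 0)) = 0)
    (hcount : {φ | φ ∈ Metric.ball φ₀ δ ∧ r (A.symm (φ, 0)) = ρ}.Countable)
    {S : ℝ → Set E}
    (hS : ∀ s, S s = {x | scaleSnd A s x ∈ N ∧ r (scaleSnd A s x) ≤ ρ ∧ ‖(A x).2‖ < 1}) :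
    ∃ C : ℝ≥0∞, C ≠ 0 ∧ C ≠ ⊤ ∧
      Tendsto (fun s => ∫⁻ x in S s, ENNReal.ofReal (d (scaleSnd A s x)) ∂μ) (𝓝[>] 0) (𝓝 C) := by
  have : FiniteDimensional ℝ E := A.symm.toLinearEquiv.finiteDimensional
  have : ProperSpace E := FiniteDimensional.proper_real E
  have hNopen : IsOpen N := by
    rw [hN]; exact (Metric.isOpen_ball.prod Metric.isOpen_ball).preimage A.continuous
  have hmemN : ∀ s x, scaleSnd A s x ∈ N ↔ (A x).1 ∈ Metric.ball φ₀ δ ∧ ‖s • (A x).2‖ < δ := by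
    intro s x
    rw [hN, mem_preimage, apply_scaleSnd]
    simp
  have hSmeas : ∀ s, MeasurableSet (S s) := fun s => hS s ▸ measurableSet_rescaled A hNopen hr s
  let K : Set E := A ⁻¹' (Metric.closedBall φ₀ δ ×ˢ Metric.closedBall 0 1)
  have hK : IsCompact K :=
    A.toHomeomorph.isCompact_preimage.2 ((isCompact_closedBall _ _).prod (isCompact_closedBall _ _))
  have hSK : ∀ s, S s ⊆ K := by
    intro s x hx
    rw [hS] at hx
    have h1 := ((hmemN s x).1 hx.1).1
    refine ⟨Metric.ball_subset_closedBall h1, ?_⟩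
    simpa using hx.2.2.le
  let I : ℝ → E → ℝ≥0∞ := fun s => (S s).indicator fun x => ENNReal.ofReal (d (scaleSnd A s x))
  have hI : ∀ s, ∫⁻ x in S s, ENNReal.ofReal (d (scaleSnd A s x)) ∂μ = ∫⁻ x, I s x ∂μ := fun s =>
    (lintegral_indicator (hSmeas s) _).symm
  have hbound : ∀ s x, I s x ≤ K.indicator (fun _ => ENNReal.ofReal M) x := by
    intro s x
    by_cases hx : x ∈ S s
    · simp only [I, indicator_of_mem hx, indicator_of_mem (hSK s hx)]
      rw [hS] at hx
      exact ENNReal.ofReal_le_ofReal (hdM _ hx.1)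
    · simp [I, indicator_of_notMem hx]
  have hfin : ∫⁻ x, K.indicator (fun _ => ENNReal.ofReal M) x ∂μ ≠ ⊤ := by
    rw [lintegral_indicator hK.measurableSet, lintegral_const, Measure.restrict_apply_univ]
    exact ENNReal.mul_ne_top ENNReal.ofReal_ne_top hK.measure_lt_top.ne
  have hImeas : ∀ s, AEMeasurable (I s) μ := by
    intro s
    refine (aemeasurable_indicator_iff (hSmeas s)).2 ?_
    have hc : ContinuousOn (fun x => ENNReal.ofReal (d (scaleSnd A s x))) (S s) := by
      refine ENNReal.continuous_ofReal.comp_continuousOn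
        (hd.comp (scaleSnd A s).continuous.continuousOn fun x hx => ?_)
      rw [hS] at hx
      exact hx.1
    exact hc.aemeasurable (hSmeas s)
  have hnull : ∀ᵐ x ∂μ, (A x).1 ∈ Metric.ball φ₀ δ → r (A.symm ((A x).1, 0)) ≠ ρ := by
    have h1 : ∀ φ : ℝ, μ {x | (A x).1 = φ} = 0 := by
      intro φ
      let ℓ : E →ᵃ[ℝ] ℝ :=
        ((ContinuousLinearMap.fst ℝ ℝ F).comp (A : E →L[ℝ] ℝ × F)).toLinearMap.toAffineMap
      have h2 := Measure.addHaar_affineSubspace μ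
        ((AffineSubspace.mk' φ (⊥ : Submodule ℝ ℝ)).comap ℓ)
        (by
          intro h
          have h3 : A.symm (φ + 1, 0) ∈ (AffineSubspace.mk' φ (⊥ : Submodule ℝ ℝ)).comap ℓ := by
            rw [h]; trivial
          simp [ℓ, AffineSubspace.mem_comap, AffineSubspace.mem_mk'] at h3)
      convert h2 using 2
      ext x
      simp [ℓ, AffineSubspace.mem_mk', sub_eq_zero]
    have h2 := (measure_biUnion_null_iff hcount).2 fun φ _ => h1 φ
    rw [ae_iff]
    refine measure_mono_null (fun x hx => ?_) h2
    simp only [mem_ofPred_eq, Classical.not_imp, not_not] at hx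
    simp only [mem_iUnion, mem_ofPred_eq]
    exact ⟨(A x).1, hx, rfl⟩
  have hscale0 : ∀ x, scaleSnd A 0 x = A.symm ((A x).1, 0) := by
    intro x
    apply A.injective
    rw [apply_scaleSnd]; simp
  have hlim : ∀ᵐ x ∂μ, Tendsto (fun s => I s x) (𝓝[>] 0) (𝓝 (I 0 x)) := by
    filter_upwards [hnull] with x hx
    by_cases hφ : (A x).1 ∈ Metric.ball φ₀ δ
    swap
    · have h0 : ∀ s, I s x = 0 := by
        intro s
        refine indicator_of_notMem (fun h => hφ ?_) _
        rw [hS] at h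
        exact ((hmemN s x).1 h.1).1
      simp [h0]
    by_cases hz : ‖(A x).2‖ < 1
    swap
    · have h0 : ∀ s, I s x = 0 := by
        intro s
        refine indicator_of_notMem (fun h => hz ?_) _
        rw [hS] at h
        exact h.2.2
      simp [h0]
    have hmem0 : scaleSnd A 0 x ∈ N := (hmemN 0 x).2 ⟨hφ, by simpa using hδ⟩
    have hcs : Tendsto (fun s => scaleSnd A s x) (𝓝 0) (𝓝 (scaleSnd A 0 x)) :=
      (continuous_scaleSnd_apply A x).tendsto 0
    have hev : ∀ᶠ s in 𝓝 (0 : ℝ), scaleSnd A s x ∈ N := hcs.eventually (hNopen.mem_nhds hmem0)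
    have hrt : Tendsto (fun s => r (scaleSnd A s x)) (𝓝 0) (𝓝 (r (scaleSnd A 0 x))) :=
      (hr.continuousAt (hNopen.mem_nhds hmem0)).tendsto.comp hcs
    have hdt : Tendsto (fun s => ENNReal.ofReal (d (scaleSnd A s x))) (𝓝 0)
        (𝓝 (ENNReal.ofReal (d (scaleSnd A 0 x)))) :=
      ENNReal.tendsto_ofReal ((hd.continuousAt (hNopen.mem_nhds hmem0)).tendsto.comp hcs)
    refine Tendsto.mono_left ?_ nhdsWithin_le_nhds
    have hne := hx hφ
    rw [← hscale0] at hne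
    rcases lt_or_gt_of_ne hne with h | h
    · have h1 : ∀ᶠ s in 𝓝 (0 : ℝ), I s x = ENNReal.ofReal (d (scaleSnd A s x)) := by
        filter_upwards [hev, hrt.eventually (gt_mem_nhds h)] with s hs1 hs2
        refine indicator_of_mem ?_ _
        rw [hS]; exact ⟨hs1, le_of_lt hs2, hz⟩
      rw [h1.self_of_nhds]
      exact hdt.congr' (h1.mono fun s hs => hs.symm)
    · have h1 : ∀ᶠ s in 𝓝 (0 : ℝ), I s x = 0 := by
        filter_upwards [hrt.eventually (lt_mem_nhds h)] with s hs2
        refine indicator_of_notMem (fun hmem => ?_) _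
        rw [hS] at hmem; exact absurd hmem.2.1 (not_le.2 hs2)
      rw [h1.self_of_nhds]
      exact tendsto_const_nhds.congr' (h1.mono fun s hs => hs.symm)
  refine ⟨∫⁻ x, I 0 x ∂μ, ?_, ?_, ?_⟩
  · intro h0
    rw [lintegral_eq_zero_iff' (hImeas 0)] at h0
    have hO : IsOpen ((scaleSnd A 0) ⁻¹' (N ∩ r ⁻¹' Iio ρ) ∩ {x | ‖(A x).2‖ < 1}) :=
      ((hr.isOpen_inter_preimage hNopen isOpen_Iio).preimage (scaleSnd A 0).continuous).inter
        (isOpen_lt (by fun_prop) (by fun_prop))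
    have hx0 : A.symm (φ₀, 0) ∈ (scaleSnd A 0) ⁻¹' (N ∩ r ⁻¹' Iio ρ) ∩ {x | ‖(A x).2‖ < 1} := by
      refine ⟨⟨(hmemN _ _).2 (by simp [hδ]), ?_⟩, by simp⟩
      rw [mem_preimage, hscale0]
      simpa [hr0] using hρ
    refine (hO.measure_pos μ ⟨_, hx0⟩).ne' ?_
    refine measure_mono_null (fun x hx => ?_) (ae_iff.1 h0)
    rw [mem_ofPred_eq]
    intro hI0
    have hxS : x ∈ S 0 := by
      rw [hS]; exact ⟨hx.1.1, le_of_lt hx.1.2, hx.2⟩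
    have hpos := hdpos _ hx.1.1
    simp only [I, indicator_of_mem hxS, Pi.zero_apply, ENNReal.ofReal_eq_zero] at hI0
    linarith
  · exact ne_top_of_le_ne_top hfin (lintegral_mono (hbound 0))
  · simp only [hI]
    exact tendsto_lintegral_filter_of_dominated_convergence' _
      (Eventually.of_forall hImeas) (Eventually.of_forall fun s => ae_of_all _ (hbound s)) hfin hlim

/-- Suppose that in local coordinates `Θ (φ, y)` the function is `f = f p + ‖y‖²`, so that it is
constant along the curve `φ ↦ Θ (φ, 0)` and grows quadratically in the `n` transverse directions.
Then `p` is a local minimum, and the part of a small ball on which `f < f p + ε` has volume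
asymptotic to a constant times `ε ^ (n / 2)`: the substitution `y = √ε z` turns this set into a
tube that does not shrink, with Jacobian `ε ^ (n / 2)`. The curve may meet the boundary sphere of
the ball in countably many points only, which keeps that sphere from carrying volume in the
limit. -/
theorem isLocalMin_and_tendsto_volume_sublevel {ι κ : Type} [Fintype ι] [Fintype κ]
    (hcard : Fintype.card ι = Fintype.card κ + 1)
    {Θ : ℝ × EuclideanSpace ℝ κ → EuclideanSpace ℝ ι} {φ₀ : ℝ}
    {W : Set (ℝ × EuclideanSpace ℝ κ)} (hW : IsOpen W) (hφ₀ : (φ₀, 0) ∈ W)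
    (hΘ : ContDiffOn ℝ 1 Θ W) (hinj : ∀ v, fderiv ℝ Θ (φ₀, 0) v = 0 → v = 0)
    {f : EuclideanSpace ℝ ι → ℝ} (hf : ∀ q ∈ W, f (Θ q) = f (Θ (φ₀, 0)) + ‖q.2‖ ^ 2)
    (hcount : ∀ ρ > 0, {φ | (φ, 0) ∈ W ∧ dist (Θ (φ, 0)) (Θ (φ₀, 0)) = ρ}.Countable) :
    IsLocalMin f (Θ (φ₀, 0)) ∧ ∀ᶠ ρ : ℝ in 𝓝[>] 0, ∃ C : ℝ, 0 < C ∧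
      Tendsto (fun ε : ℝ =>
        volume.real {q | q ∈ Metric.closedBall (Θ (φ₀, 0)) ρ ∧ f q - f (Θ (φ₀, 0)) < ε} /
          ε ^ ((Fintype.card κ : ℝ) / 2)) (𝓝[>] 0) (𝓝 C) := by
  classical
  set p := Θ (φ₀, 0) with hp
  have hrank : Module.finrank ℝ (EuclideanSpace ℝ ι) =
      Module.finrank ℝ (ℝ × EuclideanSpace ℝ κ) := by
    simp [hcard, add_comm]
  -- Identifying the two sides of `Θ` makes its Jacobian determinant meaningful.
  let A : EuclideanSpace ℝ ι ≃L[ℝ] ℝ × EuclideanSpace ℝ κ :=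
    ContinuousLinearEquiv.ofFinrankEq hrank
  let Λ : EuclideanSpace ℝ ι → EuclideanSpace ℝ ι := fun x => Θ (A x)
  have hAW : IsOpen (A ⁻¹' W) := hW.preimage A.continuous
  have hΛ : ContDiffOn ℝ 1 Λ (A ⁻¹' W) := hΘ.comp A.contDiff.contDiffOn fun x hx => hx
  set x₀ := A.symm (φ₀, 0) with hx₀
  have hAx₀ : A x₀ = (φ₀, 0) := A.apply_symm_apply _
  have hx₀W : x₀ ∈ A ⁻¹' W := by rw [mem_preimage, hAx₀]; exact hφ₀
  have hΛx₀ : Λ x₀ = p := by simp only [Λ, hAx₀, hp]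
  have hΛd : ∀ x ∈ A ⁻¹' W, HasFDerivAt Λ (fderiv ℝ Λ x) x := fun x hx =>
    ((hΛ.differentiableOn one_ne_zero).differentiableAt (hAW.mem_nhds hx)).hasFDerivAt
  have hder₀ : fderiv ℝ Λ x₀ = (fderiv ℝ Θ (φ₀, 0)).comp (A : _ →L[ℝ] _) := by
    have h1 : HasFDerivAt Θ (fderiv ℝ Θ (φ₀, 0)) (A x₀) := by
      rw [hAx₀]
      exact ((hΘ.differentiableOn one_ne_zero).differentiableAt (hW.mem_nhds hφ₀)).hasFDerivAt
    exact (h1.comp x₀ A.hasFDerivAt).fderiv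
  have hinj' : Function.Injective (fderiv ℝ Λ x₀).toLinearMap := by
    rw [← LinearMap.ker_eq_bot, LinearMap.ker_eq_bot']
    intro v hv
    have h1 : fderiv ℝ Θ (φ₀, 0) (A v) = 0 := by
      rw [hder₀] at hv
      exact hv
    exact (map_eq_zero_iff A A.injective).1 (hinj _ h1)
  let D : EuclideanSpace ℝ ι ≃L[ℝ] EuclideanSpace ℝ ι :=
    (LinearEquiv.ofInjectiveEndo _ hinj').toContinuousLinearEquiv
  have hD : (D : EuclideanSpace ℝ ι →L[ℝ] EuclideanSpace ℝ ι) = fderiv ℝ Λ x₀ := by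
    ext1 v; rfl
  have hdet₀ : (fderiv ℝ Λ x₀).det ≠ 0 := by
    rw [← hD]
    exact (LinearEquiv.isUnit_det' D.toLinearEquiv).ne_zero
  have hstrict : HasStrictFDerivAt Λ (D : EuclideanSpace ℝ ι →L[ℝ] EuclideanSpace ℝ ι) x₀ := by
    rw [hD]
    exact (hΛ.contDiffAt (hAW.mem_nhds hx₀W)).hasStrictFDerivAt one_ne_zero
  let e := hstrict.toOpenPartialHomeomorph Λ
  have hecoe : ∀ x, e x = Λ x := fun x => rfl
  have hx₀e : x₀ ∈ e.source := hstrict.mem_toOpenPartialHomeomorph_source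
  let d : EuclideanSpace ℝ ι → ℝ := fun x => |(fderiv ℝ Λ x).det|
  have hd : ContinuousOn d (A ⁻¹' W) :=
    (ContinuousLinearMap.continuous_det.comp_continuousOn
      (hΛ.continuousOn_fderiv_of_isOpen hAW le_rfl)).abs
  have hd₀ : 0 < d x₀ := abs_pos.2 hdet₀
  -- A box around `x₀` on which `Λ` is injective with positive, bounded Jacobian.
  let M := d x₀ + 1
  let V := e.source ∩ (A ⁻¹' W ∩ d ⁻¹' Ioo 0 M)
  have hV : IsOpen V := e.open_source.inter (hd.isOpen_inter_preimage hAW isOpen_Ioo)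
  have hx₀V : x₀ ∈ V := ⟨hx₀e, hx₀W, hd₀, by simp [M]⟩
  obtain ⟨δ, hδ, hδV⟩ : ∃ δ > 0, A ⁻¹' (Metric.ball φ₀ δ ×ˢ Metric.ball 0 δ) ⊆ V := by
    have h1 : A.symm ⁻¹' V ∈ 𝓝 ((φ₀, 0) : ℝ × EuclideanSpace ℝ κ) :=
      A.symm.continuous.continuousAt.preimage_mem_nhds (hV.mem_nhds hx₀V)
    obtain ⟨δ, hδ, h2⟩ := Metric.mem_nhds_iff.1 h1
    refine ⟨δ, hδ, fun x hx => ?_⟩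
    have h3 : A x ∈ Metric.ball ((φ₀, 0) : ℝ × EuclideanSpace ℝ κ) δ := by
      rw [← ball_prod_same]; exact hx
    simpa using h2 h3
  set N := A ⁻¹' (Metric.ball φ₀ δ ×ˢ Metric.ball 0 δ) with hN
  have hNopen : IsOpen N := (Metric.isOpen_ball.prod Metric.isOpen_ball).preimage A.continuous
  have hx₀N : x₀ ∈ N := by
    rw [hN, mem_preimage, hAx₀]; simp [hδ]
  have himage : Λ '' N ∈ 𝓝 p := by
    have h1 : IsOpen (e '' N) := e.isOpen_image_of_subset_source hNopen fun x hx => (hδV hx).1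
    exact h1.mem_nhds ⟨x₀, hx₀N, hΛx₀⟩
  have hfΛ : ∀ x ∈ N, f (Λ x) = f p + ‖(A x).2‖ ^ 2 := fun x hx => hf _ (hδV hx).2.1
  refine ⟨?_, ?_⟩
  · filter_upwards [himage] with q hq
    obtain ⟨x, hx, rfl⟩ := hq
    rw [hfΛ x hx]
    nlinarith [sq_nonneg ‖(A x).2‖]
  obtain ⟨ρ₀, hρ₀, hball⟩ := Metric.nhds_basis_closedBall.mem_iff.1 himage
  filter_upwards [Ioc_mem_nhdsGT hρ₀] with ρ hρ
  have hballρ : Metric.closedBall p ρ ⊆ Λ '' N :=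
    (Metric.closedBall_subset_closedBall hρ.2).trans hball
  let r : EuclideanSpace ℝ ι → ℝ := fun x => dist (Λ x) p
  have hΛc : ContinuousOn Λ N := hΛ.continuousOn.mono fun x hx => (hδV hx).2.1
  let S : ℝ → Set (EuclideanSpace ℝ ι) := fun s =>
    {x | scaleSnd A s x ∈ N ∧ r (scaleSnd A s x) ≤ ρ ∧ ‖(A x).2‖ < 1}
  have hrc : ContinuousOn r N := (continuous_id.dist continuous_const).comp_continuousOn hΛc
  obtain ⟨C, hC0, hCtop, hC⟩ := tendsto_lintegral_rescaled volume A (φ₀ := φ₀) (M := M) hδ hρ.1 hN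
    (hd.mono fun x hx => (hδV hx).2.1) (fun x hx => (hδV hx).2.2.2.le)
    (fun x hx => (hδV hx).2.2.1) hrc
    (by simp only [r, ← hx₀, hΛx₀, dist_self])
    (by
      refine (hcount ρ hρ.1).mono fun φ hφ => ?_
      have h1 : A.symm (φ, 0) ∈ N := by
        rw [hN, mem_preimage, A.apply_symm_apply]
        exact ⟨hφ.1, by simp [hδ]⟩
      have h2 := (hδV h1).2.1
      have h3 := hφ.2
      simp only [mem_preimage, A.apply_symm_apply] at h2
      simp only [r, Λ, A.apply_symm_apply] at h3
      exact ⟨h2, h3⟩)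
    (S := S) (fun s => rfl)
  -- For `s > 0` the sublevel set of height `s ^ 2` is the image of `S s` under `Λ ∘ scaleSnd A s`.
  have hset : ∀ s > 0, {q | q ∈ Metric.closedBall p ρ ∧ f q - f p < s ^ 2} =
      (fun x => Λ (scaleSnd A s x)) '' S s := by
    intro s hs
    ext q
    constructor
    · rintro ⟨hq, hfq⟩
      obtain ⟨y, hy, rfl⟩ := hballρ hq
      refine ⟨scaleSnd A s⁻¹ y, ⟨?_, ?_, ?_⟩, ?_⟩
      · rwa [scaleSnd_scaleSnd_inv A hs.ne']
      · rw [scaleSnd_scaleSnd_inv A hs.ne']; exact hq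
      · rw [hfΛ y hy, add_sub_cancel_left] at hfq
        have h1 := lt_of_pow_lt_pow_left₀ 2 hs.le hfq
        rw [apply_scaleSnd, norm_smul, norm_inv, Real.norm_of_nonneg hs.le, inv_mul_lt_iff₀ hs,
          mul_one]
        exact h1
      · simp only [scaleSnd_scaleSnd_inv A hs.ne']
    · rintro ⟨x, ⟨hx1, hx2, hx3⟩, rfl⟩
      refine ⟨hx2, ?_⟩
      simp only
      rw [hfΛ _ hx1, add_sub_cancel_left, apply_scaleSnd, norm_smul, Real.norm_of_nonneg hs.le,
        mul_pow]
      have h1 : ‖(A x).2‖ ^ 2 < 1 := pow_lt_one₀ (norm_nonneg _) hx3 two_ne_zero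
      nlinarith [sq_pos_of_pos hs]
  have hvol : ∀ s > 0, volume {q | q ∈ Metric.closedBall p ρ ∧ f q - f p < s ^ 2} =
      ENNReal.ofReal (s ^ Fintype.card κ) *
        ∫⁻ x in S s, ENNReal.ofReal (d (scaleSnd A s x)) := by
    intro s hs
    have hSN : ∀ x ∈ S s, scaleSnd A s x ∈ N := fun x hx => hx.1
    have hmeas := (measurableSet_rescaled A hNopen hrc s (ρ := ρ)).nullMeasurableSet (μ := volume)
    rw [hset s hs, ← lintegral_abs_det_fderiv_eq_addHaar_image₀ volume hmeas
      (f' := fun x => (fderiv ℝ Λ (scaleSnd A s x)).comp (scaleSnd A s)) ?_ ?_,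
      ← lintegral_const_mul' _ _ ENNReal.ofReal_ne_top]
    · refine lintegral_congr fun x => ?_
      have h1 : ((fderiv ℝ Λ (scaleSnd A s x)).comp (scaleSnd A s)).det =
          (fderiv ℝ Λ (scaleSnd A s x)).det * s ^ Fintype.card κ := by
        have h2 := det_scaleSnd A s
        rw [finrank_euclideanSpace] at h2
        rw [← h2]
        exact LinearMap.det_comp _ _
      rw [h1, abs_mul, abs_of_nonneg (pow_nonneg hs.le (Fintype.card κ)), mul_comm,
        ENNReal.ofReal_mul (pow_nonneg hs.le _)]
    · intro x hx
      exact ((hΛd _ (hδV (hSN x hx)).2.1).comp x (scaleSnd A s).hasFDerivAt).hasFDerivWithinAt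
    · intro x hx y hy hxy
      refine scaleSnd_injective A hs.ne' (e.injOn (hδV (hSN x hx)).1 (hδV (hSN y hy)).1 ?_)
      exact hxy
  refine ⟨C.toReal, ENNReal.toReal_pos hC0 hCtop, ?_⟩
  have hsqrt : Tendsto Real.sqrt (𝓝[>] 0) (𝓝[>] 0) := by
    refine tendsto_nhdsWithin_iff.2 ⟨?_, ?_⟩
    · have := Real.continuous_sqrt.tendsto 0
      rw [Real.sqrt_zero] at this
      exact this.mono_left nhdsWithin_le_nhds
    · filter_upwards [self_mem_nhdsWithin] with ε hε
      exact Real.sqrt_pos.2 hε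
  refine ((ENNReal.tendsto_toReal hCtop).comp (hC.comp hsqrt)).congr' ?_
  filter_upwards [self_mem_nhdsWithin] with ε hε
  have hε' : 0 < ε := hε
  have hs := Real.sqrt_pos.2 hε'
  have h1 := hvol _ hs
  rw [Real.sq_sqrt hε'.le] at h1
  have h2 : ε ^ ((Fintype.card κ : ℝ) / 2) = √ε ^ Fintype.card κ := by
    rw [Real.sqrt_eq_rpow, ← Real.rpow_natCast, ← Real.rpow_mul hε'.le]
    congr 1; ring
  rw [Measure.real, h1, h2, ENNReal.toReal_mul, ENNReal.toReal_ofReal (by positivity)]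
  simp only [Function.comp]
  field_simp

end

noncomputable section

namespace TMS

open Filter

/-! ### The potential when only neighbouring columns interact -/

theorem val_add_one {c : ℕ} [NeZero c] (hc : 1 < c) (i : Fin c) :
    (i + 1).val = if i.val + 1 = c then 0 else i.val + 1 := by
  have h1 : ((1 : Fin c)).val = 1 := Nat.mod_eq_of_lt hc
  rw [Fin.val_add, h1]
  split_ifs with h
  · rw [h, Nat.mod_self]
  · exact Nat.mod_eq_of_lt (by omega)

theorem add_one_ne_self {c : ℕ} [NeZero c] (hc : 1 < c) (i : Fin c) : i + 1 ≠ i := by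
  intro h
  have h1 := congrArg Fin.val h
  rw [val_add_one hc] at h1
  split_ifs at h1 <;> omega

theorem add_one_ne_sub_one {c : ℕ} [NeZero c] (hc : 2 < c) (i : Fin c) : i + 1 ≠ i - 1 := by
  intro h
  have h0 : i + 1 + 1 = i := by rw [h, sub_add_cancel]
  have h1 := congrArg Fin.val h0
  rw [val_add_one (by omega), val_add_one (by omega)] at h1
  split_ifs at h1 <;> omega

/-- `(u + b)³ / u`, the interaction of a column pair with dot product `u` and bias `b`. -/
def edgeTerm (u b : ℝ) : ℝ := (u + b) ^ 3 / u

/-- The self-interaction of a column of squared length `s` with bias `b`. -/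
def vertexTerm (s b : ℝ) : ℝ :=
  b ^ 3 / s ^ 2 + b ^ 3 / s + ((1 - s) ^ 2 - 3 * (1 - s) * b + 3 * b ^ 2)

/-- The analytic function that the potential agrees with as long as exactly the cyclically
neighbouring pairs of columns interact. -/
def localPotential {c : ℕ} [NeZero c] (w : Param 2 c) : ℝ :=
  ∑ i, (edgeTerm (colDot (weight w) i (i + 1)) (bias w i) +
    edgeTerm (colDot (weight w) i (i + 1)) (bias w (i + 1)) +
    vertexTerm (colDot (weight w) i i) (bias w i))

theorem colDot_comm {r c : ℕ} (W : Matrix (Fin r) (Fin c) ℝ) (i j : Fin c) :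
    colDot W i j = colDot W j i := by
  simp only [colDot, mul_comm]

/-- If only cyclic neighbours interact, each pair of neighbours `i`, `i + 1` contributes twice, once
with the bias of either column. -/
theorem potential_eq_localPotential {c : ℕ} [NeZero c] (hc : 2 < c) {w : Param 2 c}
    (hb : ∀ i, bias w i ≤ 0)
    (hself : ∀ i, 0 < colDot (weight w) i i ∧ -colDot (weight w) i i ≤ bias w i)
    (hadj : ∀ i j, j = i + 1 ∨ i = j + 1 →
      0 < colDot (weight w) i j ∧ -colDot (weight w) i j ≤ bias w i)
    (hfar : ∀ i j, j ≠ i → j ≠ i + 1 → i ≠ j + 1 →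
      colDot (weight w) i j ≤ 0 ∨ colDot (weight w) i j < -bias w i) :
    potential w = localPotential w := by
  classical
  have hterm : ∀ i, (if bias w i ≤ 0 then potentialNeg (weight w) (bias w) i
      else potentialPos (weight w) (bias w) i) =
      edgeTerm (colDot (weight w) i (i + 1)) (bias w i) +
      edgeTerm (colDot (weight w) i (i - 1)) (bias w i) +
      vertexTerm (colDot (weight w) i i) (bias w i) := by
    intro i
    have h1 : i + 1 ≠ i := add_one_ne_self (by omega) i
    have h2 : i - 1 ≠ i := fun h => add_one_ne_self (by omega) (i - 1) (by
      rw [sub_add_cancel]; exact h.symm)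
    have hpair : ({i + 1, i - 1} : Finset (Fin c)) ⊆ Finset.univ.erase i := by
      intro j hj
      simp only [Finset.mem_insert, Finset.mem_singleton] at hj
      rcases hj with rfl | rfl <;> simp [h1, h2]
    have hval : ∀ j, j = i + 1 ∨ i = j + 1 →
        (if 0 < colDot (weight w) i j ∧ -colDot (weight w) i j ≤ bias w i ∧ bias w i ≤ 0 then
          1 / colDot (weight w) i j * (colDot (weight w) i j + bias w i) ^ 3 else 0) =
        edgeTerm (colDot (weight w) i j) (bias w i) := by
      intro j hj
      rw [if_pos ⟨(hadj i j hj).1, (hadj i j hj).2, hb i⟩, edgeTerm]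
      ring
    rw [if_pos (hb i), potentialNeg, if_pos ⟨(hself i).1, (hself i).2, hb i⟩,
      ← Finset.sum_subset hpair, Finset.sum_pair (add_one_ne_sub_one hc i),
      hval _ (Or.inl rfl), hval _ (Or.inr (sub_add_cancel i 1).symm), vertexTerm, termN]
    intro j hj hj'
    rw [Finset.mem_erase] at hj
    simp only [Finset.mem_insert, Finset.mem_singleton, not_or] at hj'
    rw [if_neg]
    rintro ⟨h3, h4, -⟩
    rcases hfar i j hj.1 hj'.1 (fun h => hj'.2 (by rw [h, add_sub_cancel_right])) with h | h <;>
      linarith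
  rw [potential, localPotential, Finset.sum_congr rfl fun i _ => hterm i]
  simp only [Finset.sum_add_distrib]
  congr 2
  rw [← Equiv.sum_comp (Equiv.addRight (1 : Fin c))]
  refine Finset.sum_congr rfl fun i _ => ?_
  simp only [Equiv.coe_addRight, add_sub_cancel_right]
  rw [colDot_comm]

/-- The direction angle of the column `i`, relative to the first column. -/
def angle {c : ℕ} (u : PolarCoord c) (i : Fin c) : ℝ :=
  ∑ j : Fin (c - 1), if j.val < i.val then u (Sum.inr (Sum.inl j)) else 0

theorem angle_add {c : ℕ} (u v : PolarCoord c) (i : Fin c) :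
    angle (u + v) i = angle u i + angle v i := by
  simp only [angle, ← Finset.sum_add_distrib]
  refine Finset.sum_congr rfl fun j _ => ?_
  split_ifs <;> simp

theorem angle_smul {c : ℕ} (ε : ℝ) (u : PolarCoord c) (i : Fin c) :
    angle (ε • u) i = ε * angle u i := by
  simp only [angle, Finset.mul_sum]
  refine Finset.sum_congr rfl fun j _ => ?_
  split_ifs <;> simp

theorem angle_zero {c : ℕ} [NeZero c] (u : PolarCoord c) : angle u 0 = 0 := by
  simp [angle]

theorem angle_add_one_of_lt {c : ℕ} [NeZero c] (u : PolarCoord c) (j : Fin (c - 1)) :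
    angle u (⟨j.val, by omega⟩ + 1) = angle u ⟨j.val, by omega⟩ + u (Sum.inr (Sum.inl j)) := by
  have hj := j.isLt
  have h1 : ((⟨j.val, by omega⟩ : Fin c) + 1).val = j.val + 1 := by
    rw [val_add_one (by omega), if_neg (by simp only; omega)]
  simp only [angle, h1]
  have h2 : u (Sum.inr (Sum.inl j)) =
      ∑ i : Fin (c - 1), if i = j then u (Sum.inr (Sum.inl i)) else 0 := by
    simp
  rw [h2, ← Finset.sum_add_distrib]
  refine Finset.sum_congr rfl fun i _ => ?_
  rcases lt_trichotomy i.val j.val with h | h | h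
  · have h3 : i ≠ j := fun h' => by simp [h'] at h
    simp [h, h3, Nat.lt_succ_of_lt h]
  · have h3 : i = j := Fin.ext h
    subst h3
    simp
  · have h3 : i ≠ j := fun h' => by simp [h'] at h
    have h4 : ¬ i.val < j.val + 1 := by omega
    simp [h3, not_lt.2 h.le, h4]

theorem ofPolar_inl {c : ℕ} (φ : ℝ) (u : PolarCoord c) (a : Fin 2) (i : Fin c) :
    ofPolar φ u (Sum.inl (a, i)) =
      u (Sum.inl i) * if a = 0 then Real.cos (φ + angle u i) else Real.sin (φ + angle u i) := rfl

theorem colDot_ofPolar {c : ℕ} (φ : ℝ) (u : PolarCoord c) (i j : Fin c) :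
    colDot (weight (ofPolar φ u)) i j =
      u (Sum.inl i) * u (Sum.inl j) * Real.cos (angle u j - angle u i) := by
  have h : angle u j - angle u i = (φ + angle u j) - (φ + angle u i) := by ring
  simp only [colDot, weight, ofPolar_inl, Fin.sum_univ_two, h, Real.cos_sub]
  simp
  ring

/-- Rotating all columns does not change the potential. -/
theorem potential_ofPolar {c : ℕ} (φ : ℝ) (u : PolarCoord c) :
    potential (ofPolar φ u) = polarPotential u := by
  have h1 : colDot (weight (ofPolar φ u)) = colDot (weight (ofPolar 0 u)) := by
    ext i j; rw [colDot_ofPolar, colDot_ofPolar]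
  have h2 : bias (ofPolar φ u) = bias (ofPolar 0 u) := rfl
  simp only [polarPotential, potential, potentialNeg, potentialPos, termN, h1, h2]

theorem angle_gonCoord {c : ℕ} (x y : ℝ) (i : Fin c) :
    angle (gonCoord c x y) i = i.val * (2 * Real.pi / c) := by
  have hi := i.isLt
  have h1 : ∀ j : Fin (c - 1), gonCoord c x y (Sum.inr (Sum.inl j)) = 2 * Real.pi / c :=
    fun j => rfl
  simp only [angle, h1]
  rw [← Finset.sum_filter, Finset.sum_const, nsmul_eq_mul]
  congr 2
  have h2 := Fin.card_filter_val_lt (m := i.val) (n := c - 1)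
  rw [h2]
  omega

theorem gonCoord_inl {c : ℕ} (x y : ℝ) (i : Fin c) : gonCoord c x y (Sum.inl i) = x := rfl

/-- The difference of consecutive directions is `2π / c` up to a full turn, which is needed for the
step from the last column back to the first. -/
theorem angle_gonCoord_add_one {c : ℕ} [NeZero c] (hc : 1 < c) (x y : ℝ) (i : Fin c) :
    ∃ n : ℤ, angle (gonCoord c x y) (i + 1) - angle (gonCoord c x y) i =
      2 * Real.pi / c - n * (2 * Real.pi) := by
  have hc0 : (c : ℝ) ≠ 0 := by exact_mod_cast NeZero.ne c
  rw [angle_gonCoord, angle_gonCoord, val_add_one hc]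
  split_ifs with h
  · refine ⟨1, ?_⟩
    have h1 : (i.val : ℝ) = c - 1 := by
      rw [eq_sub_iff_add_eq]; exact_mod_cast h
    rw [h1]
    push_cast
    field_simp
    ring
  · refine ⟨0, ?_⟩
    push_cast
    ring

theorem cos_angle_gonCoord {c : ℕ} [NeZero c] (hc : 1 < c) (x y : ℝ) (i : Fin c) :
    Real.cos (angle (gonCoord c x y) (i + 1) - angle (gonCoord c x y) i) =
      Real.cos (2 * Real.pi / c) := by
  obtain ⟨n, hn⟩ := angle_gonCoord_add_one hc x y i
  rw [hn, Real.cos_sub_int_mul_two_pi]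

theorem sin_angle_gonCoord {c : ℕ} [NeZero c] (hc : 1 < c) (x y : ℝ) (i : Fin c) :
    Real.sin (angle (gonCoord c x y) (i + 1) - angle (gonCoord c x y) i) =
      Real.sin (2 * Real.pi / c) := by
  obtain ⟨n, hn⟩ := angle_gonCoord_add_one hc x y i
  rw [hn, Real.sin_sub_int_mul_two_pi]

/-- For at most eight columns, non-neighbouring columns of the regular polygon form an angle of at
least `π / 2`. -/
theorem cos_angle_gonCoord_nonpos {c : ℕ} [NeZero c] (hc : 1 < c) (hc8 : c ≤ 8) (x y : ℝ)
    {i j : Fin c} (hij : j ≠ i) (h1 : j ≠ i + 1) (h2 : i ≠ j + 1) :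
    Real.cos (angle (gonCoord c x y) j - angle (gonCoord c x y) i) ≤ 0 := by
  have hc0 : (0 : ℝ) < c := by exact_mod_cast (by omega : 0 < c)
  have key : ∀ i j : Fin c, i < j → j ≠ i + 1 → i ≠ j + 1 →
      Real.cos ((j.val : ℝ) * (2 * Real.pi / c) - i.val * (2 * Real.pi / c)) ≤ 0 := by
    intro i j hlt h1 h2
    have hi := i.isLt
    have hj := j.isLt
    rw [Ne, Fin.ext_iff, val_add_one hc] at h1 h2
    have hd : i.val + 2 ≤ j.val ∧ j.val + 2 ≤ c + i.val := by
      have : i.val < j.val := hlt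
      constructor
      · split_ifs at h1 <;> omega
      · split_ifs at h2 <;> omega
    have hd1 : (i.val : ℝ) + 2 ≤ j.val := by exact_mod_cast hd.1
    have hd2 : (j.val : ℝ) + 2 ≤ c + i.val := by exact_mod_cast hd.2
    have hc8' : (c : ℝ) ≤ 8 := by exact_mod_cast hc8
    have hpi := Real.pi_pos
    have h3 : (j.val : ℝ) * (2 * Real.pi / c) - i.val * (2 * Real.pi / c) =
        (j.val - i.val : ℝ) * (2 * Real.pi) / c := by ring
    rw [h3]
    apply Real.cos_nonpos_of_pi_div_two_le_of_le
    · rw [le_div_iff₀ hc0]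
      nlinarith
    · rw [div_le_iff₀ hc0]
      nlinarith
  rw [angle_gonCoord, angle_gonCoord]
  rcases lt_or_gt_of_ne hij with h | h
  · have := key j i h h2 h1
    rwa [← Real.cos_neg, neg_sub] at this
  · exact key i j h h1 h2

/-! ### Smoothness, and the critical equations of a regular polygon -/

theorem contDiff_ofPolar {c : ℕ} :
    ContDiff ℝ ∞ (fun q : ℝ × PolarCoord c => ofPolar q.1 q.2) := by
  have hangle : ∀ i, ContDiff ℝ ∞ (fun q : ℝ × PolarCoord c => q.1 + angle q.2 i) := by
    intro i
    refine contDiff_fst.add (ContDiff.sum fun j _ => ?_)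
    split_ifs
    · fun_prop
    · exact contDiff_const
  rw [contDiff_euclidean]
  rintro (⟨a, i⟩ | i)
  · simp only [ofPolar_inl]
    refine ContDiff.mul (by fun_prop) ?_
    split_ifs
    · exact Real.contDiff_cos.comp (hangle i)
    · exact Real.contDiff_sin.comp (hangle i)
  · change ContDiff ℝ ∞ (fun q : ℝ × PolarCoord c => q.2 (Sum.inr (Sum.inr i)))
    fun_prop

theorem contDiff_gonCoord {c : ℕ} :
    ContDiff ℝ ∞ (fun q : ℝ × ℝ => gonCoord c q.1 q.2) := by
  rw [contDiff_euclidean]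
  rintro (i | i | i)
  · exact contDiff_fst
  · exact contDiff_const
  · exact contDiff_snd

theorem contDiff_bias {r c : ℕ} (i : Fin c) :
    ContDiff ℝ ∞ (fun w : Param r c => bias w i) := by
  unfold bias; fun_prop

theorem contDiff_colDot {r c : ℕ} (i j : Fin c) :
    ContDiff ℝ ∞ (fun w : Param r c => colDot (weight w) i j) := by
  unfold colDot weight; fun_prop

/-- The domain on which `localPotential` is a smooth function. -/
def localDomain (c : ℕ) [NeZero c] : Set (Param 2 c) :=
  {w | ∀ i, colDot (weight w) i (i + 1) ≠ 0 ∧ colDot (weight w) i i ≠ 0}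

theorem isOpen_localDomain {c : ℕ} [NeZero c] : IsOpen (localDomain c) := by
  have : localDomain c = ⋂ i : Fin c, ({w | colDot (weight w) i (i + 1) ≠ 0} ∩
      {w | colDot (weight w) i i ≠ 0}) := by
    ext w
    simp [localDomain]
  rw [this]
  refine isOpen_iInter_of_finite fun i => ?_
  exact (isOpen_ne_fun (contDiff_colDot i (i + 1)).continuous continuous_const).inter
    (isOpen_ne_fun (contDiff_colDot i i).continuous continuous_const)

theorem contDiffOn_localPotential {c : ℕ} [NeZero c] :
    ContDiffOn ℝ ∞ (localPotential (c := c)) (localDomain c) := by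
  refine ContDiffOn.sum fun i _ => ?_
  have h1 := (contDiff_colDot (r := 2) i (i + 1)).contDiffOn (s := localDomain c)
  have h2 := (contDiff_colDot (r := 2) i i).contDiffOn (s := localDomain c)
  have h3 := (contDiff_bias (r := 2) i).contDiffOn (s := localDomain c)
  have h4 := (contDiff_bias (r := 2) (i + 1)).contDiffOn (s := localDomain c)
  have hc : ∀ a : ℝ, ContDiffOn ℝ ∞ (fun _ : Param 2 c => a) (localDomain c) :=
    fun a => contDiffOn_const
  unfold edgeTerm vertexTerm
  refine ((((h1.add h3).pow 3).div h1 fun w hw => (hw i).1).add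
    (((h1.add h4).pow 3).div h1 fun w hw => (hw i).1)).add ?_
  exact (((h3.pow 3).div (h2.pow 2) fun w hw => pow_ne_zero 2 (hw i).2).add
    ((h3.pow 3).div h2 fun w hw => (hw i).2)).add
    (((((hc 1).sub h2).pow 2).sub (((hc 3).mul ((hc 1).sub h2)).mul h3)).add
      ((hc 3).mul (h3.pow 2)))

section gon

theorem colDot_regularGon_self {c : ℕ} {x y : ℝ} (φ : ℝ) (i : Fin c) :
    colDot (weight (regularGon c x y φ)) i i = x ^ 2 := by
  rw [regularGon, colDot_ofPolar, gonCoord_inl, sub_self, Real.cos_zero]; ring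

theorem bias_regularGon {c : ℕ} {x y : ℝ} (φ : ℝ) (i : Fin c) :
    bias (regularGon c x y φ) i = y := rfl

variable {c : ℕ} [NeZero c] {x y : ℝ}

theorem colDot_regularGon_adj (hc : 1 < c) (φ : ℝ) {i j : Fin c} (h : j = i + 1 ∨ i = j + 1) :
    colDot (weight (regularGon c x y φ)) i j = x ^ 2 * Real.cos (2 * Real.pi / c) := by
  rcases h with rfl | rfl
  · rw [regularGon, colDot_ofPolar, cos_angle_gonCoord hc, gonCoord_inl, gonCoord_inl]; ring
  · rw [colDot_comm, regularGon, colDot_ofPolar, cos_angle_gonCoord hc, gonCoord_inl,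
      gonCoord_inl]
    ring

theorem colDot_regularGon_far (hc : 1 < c) (hc8 : c ≤ 8) (φ : ℝ) {i j : Fin c}
    (hij : j ≠ i) (h1 : j ≠ i + 1) (h2 : i ≠ j + 1) :
    colDot (weight (regularGon c x y φ)) i j ≤ 0 := by
  rw [regularGon, colDot_ofPolar, gonCoord_inl, gonCoord_inl]
  exact mul_nonpos_of_nonneg_of_nonpos (mul_self_nonneg x)
    (cos_angle_gonCoord_nonpos hc hc8 x y hij h1 h2)

/-- Near a regular polygon in the interior of the region the potential agrees with `localPotential`.
A pair of columns that are not neighbours may have a small positive dot product nearby (for `c = 8`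
there are orthogonal pairs), but `b < 0` is then below the threshold for an interaction. -/
theorem eventually_potential_eq_localPotential (hc : 2 < c) (hc8 : c ≤ 8) (hx : 0 < x) (hy : y < 0)
    (hk : 0 < Real.cos (2 * Real.pi / c)) (hxy : -x ^ 2 * Real.cos (2 * Real.pi / c) < y) (φ : ℝ) :
    ∀ᶠ w in 𝓝 (regularGon c x y φ), potential w = localPotential w := by
  set p := regularGon c x y φ with hp
  have hb : ∀ i, Tendsto (fun w => bias w i) (𝓝 p) (𝓝 y) := fun i =>
    (contDiff_bias i).continuous.tendsto p
  have hu : ∀ i j, Tendsto (fun w => colDot (weight w) i j) (𝓝 p) (𝓝 (colDot (weight p) i j)) :=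
    fun i j => (contDiff_colDot i j).continuous.tendsto p
  have hk1 := Real.cos_le_one (2 * Real.pi / c)
  have hx2 : 0 < x ^ 2 := by positivity
  have e1 : ∀ᶠ w in 𝓝 p, ∀ i, bias w i < 0 :=
    eventually_all.2 fun i => (hb i).eventually (gt_mem_nhds hy)
  have e2 : ∀ᶠ w in 𝓝 p, ∀ i, 0 < colDot (weight w) i i ∧ -colDot (weight w) i i < bias w i := by
    refine eventually_all.2 fun i => ?_
    have h1 := hu i i
    rw [hp, colDot_regularGon_self] at h1
    refine (h1.eventually (lt_mem_nhds hx2)).and (h1.neg.eventually_lt (hb i) ?_)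
    nlinarith
  have e3 : ∀ᶠ w in 𝓝 p, ∀ i j, j = i + 1 ∨ i = j + 1 →
      0 < colDot (weight w) i j ∧ -colDot (weight w) i j < bias w i := by
    refine eventually_all.2 fun i => eventually_all.2 fun j => ?_
    by_cases hij : j = i + 1 ∨ i = j + 1
    · have h1 := hu i j
      rw [hp, colDot_regularGon_adj (by omega) φ hij] at h1
      filter_upwards [h1.eventually (lt_mem_nhds (by positivity)),
        h1.neg.eventually_lt (hb i) (by linarith)] with w hw1 hw2 _
      exact ⟨hw1, hw2⟩
    · exact Eventually.of_forall fun w h => absurd h hij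
  have e4 : ∀ᶠ w in 𝓝 p, ∀ i j, j ≠ i → j ≠ i + 1 → i ≠ j + 1 →
      colDot (weight w) i j < -bias w i := by
    refine eventually_all.2 fun i => eventually_all.2 fun j => ?_
    by_cases hij : j ≠ i ∧ j ≠ i + 1 ∧ i ≠ j + 1
    · have h0 := colDot_regularGon_far (x := x) (y := y) (by omega) hc8 φ hij.1 hij.2.1 hij.2.2
      filter_upwards [(hu i j).eventually_lt (hb i).neg (by linarith)] with w hw _ _ _
      exact hw
    · exact Eventually.of_forall fun w h1 h2 h3 => absurd ⟨h1, h2, h3⟩ hij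
  filter_upwards [e1, e2, e3, e4] with w h1 h2 h3 h4
  exact potential_eq_localPotential hc (fun i => (h1 i).le) (fun i => ⟨(h2 i).1, (h2 i).2.le⟩)
    (fun i j h => ⟨(h3 i j h).1, (h3 i j h).2.le⟩) fun i j a b d => Or.inr (h4 i j a b d)

theorem regularGon_mem_localDomain (hc : 1 < c) (hx : 0 < x)
    (hk : 0 < Real.cos (2 * Real.pi / c)) (φ : ℝ) : regularGon c x y φ ∈ localDomain c := by
  intro i
  rw [colDot_regularGon_self, colDot_regularGon_adj hc φ (Or.inl rfl)]
  exact ⟨by positivity, by positivity⟩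

theorem potential_regularGon (hc : 2 < c) (hc8 : c ≤ 8) (hx : 0 < x) (hy : y ≤ 0)
    (hk : 0 < Real.cos (2 * Real.pi / c)) (hxy : -x ^ 2 * Real.cos (2 * Real.pi / c) ≤ y) (φ : ℝ) :
    potential (regularGon c x y φ) =
      c * (2 * edgeTerm (x ^ 2 * Real.cos (2 * Real.pi / c)) y + vertexTerm (x ^ 2) y) := by
  have hk1 := Real.cos_le_one (2 * Real.pi / c)
  have hx2 : 0 < x ^ 2 := by positivity
  rw [potential_eq_localPotential (w := regularGon c x y φ) hc (fun i => hy)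
    (fun i => by rw [colDot_regularGon_self, bias_regularGon]; exact ⟨hx2, by nlinarith⟩)
    (fun i j h => by
      rw [colDot_regularGon_adj (by omega) φ h, bias_regularGon]
      exact ⟨by positivity, by linarith⟩)
    (fun i j a b d => Or.inl (colDot_regularGon_far (by omega) hc8 φ a b d)), localPotential]
  simp only [colDot_regularGon_self, colDot_regularGon_adj (show 1 < c by omega) φ (Or.inl rfl),
    bias_regularGon, Finset.sum_const, Finset.card_univ, Fintype.card_fin, nsmul_eq_mul]
  ring

/-- Two necessary conditions for a critical regular polygon: the derivative along the scaling
`(x, y) ↦ (σ x, σ² y)` and the derivative in the common bias `y` vanish. Scaling preserves the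
region `-x² cos (2π / c) ≤ y ≤ 0`, and in the direction of `y` the derivative within this interval
is used, so that both conditions also hold on the boundary of the region. -/
theorem IsCriticalPoint.equations (hc : 2 < c) (hc8 : c ≤ 8) (hx : 0 < x) (hy : y ≤ 0)
    (hk : 0 < Real.cos (2 * Real.pi / c)) (hxy : -x ^ 2 * Real.cos (2 * Real.pi / c) ≤ y) {φ : ℝ}
    (hcrit : IsCriticalPoint potential (regularGon c x y φ)) :
    (y ^ 3 / (x ^ 2) ^ 2 - 2 * x ^ 2 - 3 * y) +
      2 * (2 * edgeTerm (x ^ 2 * Real.cos (2 * Real.pi / c)) y +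
        (y ^ 3 / x ^ 2 + (x ^ 2) ^ 2 + 3 * x ^ 2 * y + 3 * y ^ 2)) = 0 ∧
    6 * (x ^ 2 * Real.cos (2 * Real.pi / c) + y) ^ 2 / (x ^ 2 * Real.cos (2 * Real.pi / c)) +
      3 * y ^ 2 / (x ^ 2) ^ 2 + 3 * y ^ 2 / x ^ 2 - 3 * (1 - x ^ 2) + 6 * y = 0 := by
  set k := Real.cos (2 * Real.pi / c) with hkdef
  have hx2 : 0 < x ^ 2 := by positivity
  have hc0 : (c : ℝ) ≠ 0 := by exact_mod_cast NeZero.ne c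
  have hgon : Differentiable ℝ (fun q : ℝ × ℝ => regularGon c q.1 q.2 φ) := by
    have h1 : ContDiff ℝ ∞ (fun q : ℝ × ℝ => regularGon c q.1 q.2 φ) :=
      contDiff_ofPolar.comp (contDiff_const.prodMk contDiff_gonCoord)
    exact h1.differentiable (by simp)
  constructor
  · have hγ : DifferentiableAt ℝ (fun σ : ℝ => regularGon c (x * σ) (y * σ ^ 2) φ) 1 :=
      (hgon (x * 1, y * 1 ^ 2)).comp (1 : ℝ)
        (f := fun σ : ℝ => (x * σ, y * σ ^ 2)) (by fun_prop)
    have hcrit' : HasFDerivAt potential (0 : Param 2 c →L[ℝ] ℝ)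
        (regularGon c (x * 1) (y * 1 ^ 2) φ) := by simpa [IsCriticalPoint] using hcrit
    have h1 := hcrit'.comp_hasDerivAt (1 : ℝ) hγ.hasDerivAt
    have h2 : HasDerivAt (fun σ : ℝ => c * (1 + σ ^ 2 * (y ^ 3 / (x ^ 2) ^ 2 - 2 * x ^ 2 - 3 * y) +
        σ ^ 4 * (2 * edgeTerm (x ^ 2 * k) y +
        (y ^ 3 / x ^ 2 + (x ^ 2) ^ 2 + 3 * x ^ 2 * y + 3 * y ^ 2))))
        (c * ((2 : ℕ) * (1 : ℝ) ^ 1 * (y ^ 3 / (x ^ 2) ^ 2 - 2 * x ^ 2 - 3 * y) +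
        (4 : ℕ) * (1 : ℝ) ^ 3 * (2 * edgeTerm (x ^ 2 * k) y +
        (y ^ 3 / x ^ 2 + (x ^ 2) ^ 2 + 3 * x ^ 2 * y + 3 * y ^ 2)))) 1 :=
      ((((hasDerivAt_pow 2 (1 : ℝ)).mul_const _).const_add 1).add
        ((hasDerivAt_pow 4 (1 : ℝ)).mul_const _)).const_mul _
    have h3 : (fun σ : ℝ => c * (1 + σ ^ 2 * (y ^ 3 / (x ^ 2) ^ 2 - 2 * x ^ 2 - 3 * y) +
        σ ^ 4 * (2 * edgeTerm (x ^ 2 * k) y +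
        (y ^ 3 / x ^ 2 + (x ^ 2) ^ 2 + 3 * x ^ 2 * y + 3 * y ^ 2)))) =ᶠ[𝓝 1]
        potential ∘ fun σ : ℝ => regularGon c (x * σ) (y * σ ^ 2) φ := by
      filter_upwards [lt_mem_nhds (show (0 : ℝ) < 1 by norm_num)] with σ hσ
      have hσ2 : 0 < σ ^ 2 := by positivity
      rw [Function.comp, potential_regularGon hc hc8 (by positivity)
        (mul_nonpos_of_nonpos_of_nonneg hy hσ2.le) hk
        (by rw [mul_pow]; nlinarith), ← hkdef, edgeTerm, edgeTerm, vertexTerm]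
      field_simp
      ring
    have h4 := (h2.congr_of_eventuallyEq h3.symm).unique h1
    rw [zero_apply] at h4
    have h5 := (mul_eq_zero.1 h4).resolve_left hc0
    push_cast at h5
    linarith
  · have hγ : DifferentiableAt ℝ (fun σ : ℝ => regularGon c x σ φ) y :=
      (hgon (x, y)).comp y (f := fun σ : ℝ => (x, σ)) (by fun_prop)
    have h1 := HasFDerivAt.comp_hasDerivAt (f := fun σ : ℝ => regularGon c x σ φ) y hcrit
      hγ.hasDerivAt
    have hxk : x ^ 2 * k ≠ 0 := by positivity
    have h2 : HasDerivAt (fun σ : ℝ => c * (2 * ((x ^ 2 * k + σ) ^ 3 / (x ^ 2 * k)) +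
        (σ ^ 3 / (x ^ 2) ^ 2 + σ ^ 3 / x ^ 2 +
          ((1 - x ^ 2) ^ 2 - 3 * (1 - x ^ 2) * σ + 3 * σ ^ 2))))
        (c * (2 * (((3 : ℕ) * (x ^ 2 * k + y) ^ 2 * 1) / (x ^ 2 * k)) +
        ((3 : ℕ) * y ^ 2 * 1 / (x ^ 2) ^ 2 + (3 : ℕ) * y ^ 2 * 1 / x ^ 2 +
          ((0 - 3 * (1 - x ^ 2) * 1) + 3 * ((2 : ℕ) * y ^ 1 * 1))))) y := by
      have hid := hasDerivAt_id y
      exact ((((((hid.const_add (x ^ 2 * k)).pow 3).div_const _).const_mul 2).add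
        ((((hid.pow 3).div_const _).add ((hid.pow 3).div_const _)).add
        (((hasDerivAt_const y _).sub (hid.const_mul _)).add
          ((hid.pow 2).const_mul 3)))).const_mul _)
    have hI : UniqueDiffWithinAt ℝ (Set.Icc (-x ^ 2 * k) 0) y :=
      uniqueDiffOn_Icc (by nlinarith) y ⟨hxy, hy⟩
    have h3 : Set.EqOn (potential ∘ fun σ : ℝ => regularGon c x σ φ)
        (fun σ : ℝ => c * (2 * ((x ^ 2 * k + σ) ^ 3 / (x ^ 2 * k)) +
        (σ ^ 3 / (x ^ 2) ^ 2 + σ ^ 3 / x ^ 2 +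
          ((1 - x ^ 2) ^ 2 - 3 * (1 - x ^ 2) * σ + 3 * σ ^ 2))))
        (Set.Icc (-x ^ 2 * k) 0) := by
      intro σ hσ
      rw [Function.comp, potential_regularGon hc hc8 hx hσ.2 hk hσ.1]
      rfl
    have h4 := hI.eq_deriv _ (h2.hasDerivWithinAt.congr h3 (h3 ⟨hxy, hy⟩)) h1.hasDerivWithinAt
    rw [zero_apply] at h4
    have h5 := (mul_eq_zero.1 h4).resolve_left hc0
    push_cast at h5
    rw [← h5]
    ring

end gon

/-! ### Second-order jets along lines -/

/-- `∂ edgeTerm / ∂u`. -/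
def edgeU (u b : ℝ) : ℝ := 2 * u + 3 * b - b ^ 3 / u ^ 2

/-- `∂ edgeTerm / ∂b`. -/
def edgeB (u b : ℝ) : ℝ := 3 * (u + b) ^ 2 / u

/-- `∂² edgeTerm / ∂u²`. -/
def edgeUU (u b : ℝ) : ℝ := 2 + 2 * b ^ 3 / u ^ 3

/-- `∂² edgeTerm / ∂u ∂b`. -/
def edgeUB (u b : ℝ) : ℝ := 3 - 3 * b ^ 2 / u ^ 2

/-- `∂² edgeTerm / ∂b²`. -/
def edgeBB (u b : ℝ) : ℝ := 6 + 6 * b / u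

/-- `∂ vertexTerm / ∂s`. -/
def vertexS (s b : ℝ) : ℝ := -2 * b ^ 3 / s ^ 3 - b ^ 3 / s ^ 2 - 2 * (1 - s) + 3 * b

/-- `∂ vertexTerm / ∂b`. -/
def vertexB (s b : ℝ) : ℝ := 3 * b ^ 2 / s ^ 2 + 3 * b ^ 2 / s - 3 * (1 - s) + 6 * b

/-- `∂² vertexTerm / ∂s²`. -/
def vertexSS (s b : ℝ) : ℝ := 6 * b ^ 3 / s ^ 4 + 2 * b ^ 3 / s ^ 3 + 2

/-- `∂² vertexTerm / ∂s ∂b`. -/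
def vertexSB (s b : ℝ) : ℝ := -6 * b ^ 2 / s ^ 3 - 3 * b ^ 2 / s ^ 2 + 3

/-- `∂² vertexTerm / ∂b²`. -/
def vertexBB (s b : ℝ) : ℝ := 6 * b / s ^ 2 + 6 * b / s + 6

/-- `f` has the second-order Taylor data `f 0 = a₀`, `f' 0 = a₁`, `f'' 0 = a₂`. -/
def HasJet (f : ℝ → ℝ) (a₀ a₁ a₂ : ℝ) : Prop :=
  f 0 = a₀ ∧ ∃ f' : ℝ → ℝ, (∀ᶠ ε in 𝓝 0, HasDerivAt f (f' ε) ε) ∧ f' 0 = a₁ ∧ HasDerivAt f' a₂ 0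

namespace HasJet
variable {f g : ℝ → ℝ} {a₀ a₁ a₂ b₀ b₁ b₂ : ℝ}

theorem congr_jet {c₀ c₁ c₂ : ℝ} (h : HasJet f a₀ a₁ a₂) (h₀ : a₀ = c₀) (h₁ : a₁ = c₁)
    (h₂ : a₂ = c₂) : HasJet f c₀ c₁ c₂ := by
  subst h₀ h₁ h₂; exact h

theorem const (a : ℝ) : HasJet (fun _ => a) a 0 0 :=
  ⟨rfl, fun _ => 0, Eventually.of_forall fun ε => hasDerivAt_const ε a, rfl, hasDerivAt_const 0 0⟩

theorem linear (a b : ℝ) : HasJet (fun ε => a + ε * b) a b 0 :=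
  ⟨by simp, fun _ => b, Eventually.of_forall fun ε => by
    simpa using ((hasDerivAt_id ε).mul_const b).const_add a, rfl, hasDerivAt_const 0 b⟩

theorem add (hf : HasJet f a₀ a₁ a₂) (hg : HasJet g b₀ b₁ b₂) :
    HasJet (fun ε => f ε + g ε) (a₀ + b₀) (a₁ + b₁) (a₂ + b₂) := by
  obtain ⟨hf0, f', hf1, hf2, hf3⟩ := hf
  obtain ⟨hg0, g', hg1, hg2, hg3⟩ := hg
  exact ⟨by simp only [hf0, hg0], fun ε => f' ε + g' ε, (hf1.and hg1).mono fun ε h => h.1.add h.2,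
    by simp only [hf2, hg2], hf3.add hg3⟩

theorem mul (hf : HasJet f a₀ a₁ a₂) (hg : HasJet g b₀ b₁ b₂) :
    HasJet (fun ε => f ε * g ε) (a₀ * b₀) (a₁ * b₀ + a₀ * b₁)
      (a₂ * b₀ + 2 * a₁ * b₁ + a₀ * b₂) := by
  obtain ⟨hf0, f', hf1, hf2, hf3⟩ := hf
  obtain ⟨hg0, g', hg1, hg2, hg3⟩ := hg
  refine ⟨by simp only [hf0, hg0], fun ε => f' ε * g ε + f ε * g' ε,
    (hf1.and hg1).mono fun ε h => h.1.mul h.2, by simp only [hf0, hf2, hg0, hg2], ?_⟩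
  have h := (hf3.mul hg1.self_of_nhds).add (hf1.self_of_nhds.mul hg3)
  rw [hf0, hf2, hg0, hg2] at h
  exact h.congr_deriv (by ring)

theorem const_mul (c : ℝ) (hf : HasJet f a₀ a₁ a₂) :
    HasJet (fun ε => c * f ε) (c * a₀) (c * a₁) (c * a₂) :=
  ((const c).mul hf).congr_jet rfl (by ring) (by ring)

theorem sub (hf : HasJet f a₀ a₁ a₂) (hg : HasJet g b₀ b₁ b₂) :
    HasJet (fun ε => f ε - g ε) (a₀ - b₀) (a₁ - b₁) (a₂ - b₂) := by
  have h := hf.add (hg.const_mul (-1))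
  simp only [neg_one_mul, ← sub_eq_add_neg] at h
  exact h

theorem inv (hf : HasJet f a₀ a₁ a₂) (h0 : a₀ ≠ 0) :
    HasJet (fun ε => (f ε)⁻¹) a₀⁻¹ (-a₁ / a₀ ^ 2) (2 * a₁ ^ 2 / a₀ ^ 3 - a₂ / a₀ ^ 2) := by
  obtain ⟨hf0, f', hf1, hf2, hf3⟩ := hf
  have hne : ∀ᶠ ε in 𝓝 (0 : ℝ), f ε ≠ 0 :=
    hf1.self_of_nhds.continuousAt.eventually_ne (by rwa [hf0])
  refine ⟨by simp only [hf0], fun ε => -f' ε / f ε ^ 2,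
    (hf1.and hne).mono fun ε h => h.1.inv h.2, by simp only [hf0, hf2], ?_⟩
  have h := hf3.neg.div (hf1.self_of_nhds.pow 2) (pow_ne_zero 2 (by rwa [hf0]))
  simp only [Pi.pow_apply, Pi.neg_apply] at h
  rw [hf0, hf2] at h
  refine h.congr_deriv ?_
  push_cast
  field_simp
  ring

theorem cos_linear (a b : ℝ) :
    HasJet (fun ε => Real.cos (a + ε * b)) (Real.cos a) (-(Real.sin a * b))
      (-(Real.cos a * b ^ 2)) := by
  have h1 : ∀ ε, HasDerivAt (fun ε => a + ε * b) b ε := fun ε => by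
    simpa using ((hasDerivAt_id ε).mul_const b).const_add a
  refine ⟨by simp, fun ε => -(Real.sin (a + ε * b) * b), Eventually.of_forall fun ε =>
    ((h1 ε).cos).congr_deriv (by ring), by simp, ?_⟩
  refine (((h1 0).sin.mul_const b).neg).congr_deriv ?_
  simp; ring

theorem sum {ι : Type} (s : Finset ι) {f : ι → ℝ → ℝ} {a₀ a₁ a₂ : ι → ℝ}
    (h : ∀ i ∈ s, HasJet (f i) (a₀ i) (a₁ i) (a₂ i)) :
    HasJet (fun ε => ∑ i ∈ s, f i ε) (∑ i ∈ s, a₀ i) (∑ i ∈ s, a₁ i) (∑ i ∈ s, a₂ i) := by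
  classical
  induction s using Finset.induction_on with
  | empty => simpa using const 0
  | insert j s hj ih =>
    simp only [Finset.sum_insert hj]
    exact (h j (Finset.mem_insert_self j s)).add
      (ih fun i hi => h i (Finset.mem_insert_of_mem hi))

/-- The second-order chain rule for `edgeTerm`, with the bias varying linearly. -/
theorem edgeTerm {b b' : ℝ} (hf : HasJet f a₀ a₁ a₂) (hg : HasJet g b b' 0) (h0 : a₀ ≠ 0) :
    HasJet (fun ε => edgeTerm (f ε) (g ε)) (edgeTerm a₀ b)
      (edgeU a₀ b * a₁ + edgeB a₀ b * b')
      (edgeUU a₀ b * a₁ ^ 2 + edgeU a₀ b * a₂ + 2 * edgeUB a₀ b * a₁ * b' +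
        edgeBB a₀ b * b' ^ 2) := by
  have h1 := hf.add hg
  have h2 := ((h1.mul h1).mul h1).mul (hf.inv h0)
  have h3 : (fun ε => TMS.edgeTerm (f ε) (g ε)) =
      fun ε => (f ε + g ε) * (f ε + g ε) * (f ε + g ε) * (f ε)⁻¹ := by
    ext ε; simp only [TMS.edgeTerm]; ring
  rw [h3]
  refine h2.congr_jet ?_ ?_ ?_
  · simp only [TMS.edgeTerm]; ring
  · simp only [edgeU, edgeB]; field_simp; ring
  · simp only [edgeU, edgeUU, edgeUB, edgeBB]; field_simp; ring

/-- The second-order chain rule for `vertexTerm`, with the bias varying linearly. -/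
theorem vertexTerm {b b' : ℝ} (hf : HasJet f a₀ a₁ a₂) (hg : HasJet g b b' 0) (h0 : a₀ ≠ 0) :
    HasJet (fun ε => vertexTerm (f ε) (g ε)) (vertexTerm a₀ b)
      (vertexS a₀ b * a₁ + vertexB a₀ b * b')
      (vertexSS a₀ b * a₁ ^ 2 + vertexS a₀ b * a₂ + 2 * vertexSB a₀ b * a₁ * b' +
        vertexBB a₀ b * b' ^ 2) := by
  have hc := (hg.mul hg).mul hg
  have hi := hf.inv h0
  have h1 := (const 1).sub hf
  have h2 := ((hc.mul (hi.mul hi)).add (hc.mul hi)).add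
    (((h1.mul h1).sub ((h1.const_mul 3).mul hg)).add ((hg.mul hg).const_mul 3))
  have h3 : (fun ε => TMS.vertexTerm (f ε) (g ε)) =
      fun ε => g ε * g ε * g ε * ((f ε)⁻¹ * (f ε)⁻¹) + g ε * g ε * g ε * (f ε)⁻¹ +
        ((1 - f ε) * (1 - f ε) - 3 * (1 - f ε) * g ε + 3 * (g ε * g ε)) := by
    ext ε; simp only [TMS.vertexTerm]; field_simp
  rw [h3]
  refine h2.congr_jet ?_ ?_ ?_
  · simp only [TMS.vertexTerm]; field_simp
  · simp only [vertexS, vertexB]; field_simp; ring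
  · simp only [vertexS, vertexSS, vertexSB, vertexBB]; field_simp; ring

/-- The jet along a line computes the first and second derivative in its direction. -/
theorem fderiv_eq {E : Type} [NormedAddCommGroup E] [NormedSpace ℝ E] {K : E → ℝ} {p v : E}
    (hK : ContDiffAt ℝ 2 K p) (h : HasJet (fun ε => K (p + ε • v)) a₀ a₁ a₂) :
    fderiv ℝ K p v = a₁ ∧ fderiv ℝ (fderiv ℝ K) p v v = a₂ := by
  obtain ⟨-, f', hf1, hf2, hf3⟩ := h
  have hline : ∀ ε : ℝ, HasDerivAt (fun ε : ℝ => p + ε • v) v ε := fun ε => by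
    simpa using ((hasDerivAt_id ε).smul_const v).const_add p
  have hline0 : Tendsto (fun ε : ℝ => p + ε • v) (𝓝 0) (𝓝 p) := by
    have := (hline 0).continuousAt.tendsto
    simpa using this
  have hdiff : ∀ᶠ q in 𝓝 p, DifferentiableAt ℝ K q :=
    (hK.eventually (by simp)).mono fun q hq => hq.differentiableAt (by simp)
  have hf' : ∀ᶠ ε in 𝓝 (0 : ℝ), f' ε = fderiv ℝ K (p + ε • v) v := by
    filter_upwards [hf1, hline0.eventually hdiff] with ε h1 h2
    exact h1.unique (h2.hasFDerivAt.comp_hasDerivAt ε (hline ε))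
  refine ⟨?_, ?_⟩
  · have := hf'.self_of_nhds
    rw [hf2] at this
    simpa using this.symm
  · have h1 : HasFDerivAt (fderiv ℝ K) (fderiv ℝ (fderiv ℝ K) p) p :=
      ((hK.fderiv_right (m := 1) (by norm_num)).differentiableAt one_ne_zero).hasFDerivAt
    have h2 : HasFDerivAt (fun q => fderiv ℝ K q v) ((fderiv ℝ (fderiv ℝ K) p).flip v) p := by
      simpa using h1.clm_apply (hasFDerivAt_const v p)
    have h3 : HasDerivAt (fun ε : ℝ => fderiv ℝ K (p + ε • v) v)
        ((fderiv ℝ (fderiv ℝ K) p).flip v v) 0 := by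
      have h4 : HasFDerivAt (fun q => fderiv ℝ K q v) ((fderiv ℝ (fderiv ℝ K) p).flip v)
          (p + (0 : ℝ) • v) := by simpa using h2
      exact h4.comp_hasDerivAt (0 : ℝ) (hline 0)
    exact (h3.congr_of_eventuallyEq hf').unique hf3

end HasJet

/-! ### The second variation at a regular polygon -/

theorem binary_form_pos {A B C : ℝ} (hA : 0 < A) (h : B ^ 2 < 4 * A * C) (x y : ℝ) :
    0 ≤ A * x ^ 2 + B * x * y + C * y ^ 2 ∧
      (A * x ^ 2 + B * x * y + C * y ^ 2 = 0 → x = 0 ∧ y = 0) := by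
  have key : 4 * A * (A * x ^ 2 + B * x * y + C * y ^ 2) =
      (2 * A * x + B * y) ^ 2 + (4 * A * C - B ^ 2) * y ^ 2 := by ring
  have h1 : 0 ≤ (4 * A * C - B ^ 2) * y ^ 2 := mul_nonneg (by linarith) (sq_nonneg y)
  refine ⟨?_, fun h0 => ?_⟩
  · by_contra hneg
    push Not at hneg
    nlinarith [sq_nonneg (2 * A * x + B * y)]
  · rw [h0, mul_zero] at key
    have h2 : (4 * A * C - B ^ 2) * y ^ 2 = 0 := by nlinarith [sq_nonneg (2 * A * x + B * y)]
    have hy : y = 0 := by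
      rcases mul_eq_zero.1 h2 with h3 | h3
      · linarith
      · exact pow_eq_zero_iff two_ne_zero |>.1 h3
    subst hy
    have h3 : (2 * A * x) ^ 2 = 0 := by nlinarith
    have h4 := pow_eq_zero_iff two_ne_zero |>.1 h3
    exact ⟨by rcases mul_eq_zero.1 h4 with h5 | h5 <;> [linarith; exact h5], rfl⟩

/-- Conditions for `edgeForm` to be positive definite in `x`, `x'`, `y`, `y'`, `τ`: positivity of
the coefficient of `τ²`, and positive definiteness of the two binary forms, in `(x + x', y + y')`
and in `(x - x', y - y')`, which are left once the square in `τ` is completed. -/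
structure EdgeFormPosDef (k s α γ μ ρ P Q : ℝ) : Prop where
  angle : 0 < 2 * α * s ^ 2 - 2 * γ * k
  even : 0 < (2 * α * s ^ 2 - 2 * γ * k) * (2 * α * k ^ 2 + P) - 4 * s ^ 2 * (α * k + γ) ^ 2
  evenDet : ((2 * α * s ^ 2 - 2 * γ * k) * (2 * μ * k + Q) - 4 * s ^ 2 * (α * k + γ) * μ) ^ 2 <
    4 * ((2 * α * s ^ 2 - 2 * γ * k) * (2 * α * k ^ 2 + P) - 4 * s ^ 2 * (α * k + γ) ^ 2) *
      ((2 * α * s ^ 2 - 2 * γ * k) * ρ - s ^ 2 * μ ^ 2)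
  odd : 0 < P - 2 * k * γ
  oddDet : Q ^ 2 < 4 * (P - 2 * k * γ) * ρ

/-- The contribution to the second variation of a pair of neighbouring columns, in dimensionless
variables: `x`, `x'` are the relative variations of the lengths of the two columns, `y`, `y'` those
of their biases, and `τ` is the variation of the angle between them; `k` and `s` are the cosine and
sine of that angle. The letters `α`, `γ`, `μ` stand for the partial derivatives `edgeUU`,
`edgeU / l²`, `edgeUB` of the interaction, `P`, `Q` for `vertexSS`, `vertexSB`, and `ρ` for
`edgeBB / 2 + vertexBB / 4`; half of the self-interaction of each column is counted here. -/
def edgeForm (k s α γ μ ρ P Q x x' y y' τ : ℝ) : ℝ :=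
  2 * (α * (k * (x + x') - s * τ) ^ 2 +
    γ * (2 * k * x * x' - 2 * s * τ * (x + x') - k * τ ^ 2)) +
  2 * μ * (k * (x + x') - s * τ) * (y + y') +
  (2 * P - 2 * k * γ) * (x ^ 2 + x' ^ 2) + 2 * Q * (x * y + x' * y') + 2 * ρ * (y ^ 2 + y' ^ 2)

theorem EdgeFormPosDef.pos {k s α γ μ ρ P Q : ℝ} (h : EdgeFormPosDef k s α γ μ ρ P Q)
    (x x' y y' τ : ℝ) :
    0 ≤ edgeForm k s α γ μ ρ P Q x x' y y' τ ∧
      (edgeForm k s α γ μ ρ P Q x x' y y' τ = 0 → x = 0 ∧ y = 0 ∧ τ = 0) := by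
  obtain ⟨h1, h2, h3, h4, h5⟩ := h
  obtain ⟨a, ha⟩ : ∃ a, a = 2 * α * s ^ 2 - 2 * γ * k := ⟨_, rfl⟩
  rw [← ha] at h1 h2 h3
  obtain ⟨m₁₁, hm₁₁⟩ : ∃ m, m = a * (2 * α * k ^ 2 + P) - 4 * s ^ 2 * (α * k + γ) ^ 2 := ⟨_, rfl⟩
  obtain ⟨m₁₂, hm₁₂⟩ : ∃ m, m = a * (2 * μ * k + Q) - 4 * s ^ 2 * (α * k + γ) * μ := ⟨_, rfl⟩
  obtain ⟨m₂₂, hm₂₂⟩ : ∃ m, m = a * ρ - s ^ 2 * μ ^ 2 := ⟨_, rfl⟩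
  rw [← hm₁₁] at h2 h3
  rw [← hm₁₂, ← hm₂₂] at h3
  obtain ⟨e1, e2⟩ := binary_form_pos h2 h3 (x + x') (y + y')
  obtain ⟨o1, o2⟩ := binary_form_pos h4 h5 (x - x') (y - y')
  -- Completing the square in `τ`; the rest splits by the symmetry exchanging the two columns.
  have key : a * edgeForm k s α γ μ ρ P Q x x' y y' τ =
      (a * τ - s * (2 * (α * k + γ) * (x + x') + μ * (y + y'))) ^ 2 +
      (m₁₁ * (x + x') ^ 2 + m₁₂ * (x + x') * (y + y') + m₂₂ * (y + y') ^ 2) +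
      a * ((P - 2 * k * γ) * (x - x') ^ 2 + Q * (x - x') * (y - y') + ρ * (y - y') ^ 2) := by
    rw [hm₁₁, hm₁₂, hm₂₂, ha, edgeForm]
    ring
  have hτ : x + x' = 0 → y + y' = 0 →
      a * τ - s * (2 * (α * k + γ) * (x + x') + μ * (y + y')) = 0 → τ = 0 := by
    intro hX hY hz
    rw [hX, hY] at hz
    exact (mul_eq_zero.1 (show a * τ = 0 by linarith)).resolve_left h1.ne'
  generalize a * τ - s * (2 * (α * k + γ) * (x + x') + μ * (y + y')) = z at key hτ
  generalize m₁₁ * (x + x') ^ 2 + m₁₂ * (x + x') * (y + y') + m₂₂ * (y + y') ^ 2 = e at key e1 e2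
  generalize (P - 2 * k * γ) * (x - x') ^ 2 + Q * (x - x') * (y - y') + ρ * (y - y') ^ 2 = o
    at key o1 o2
  generalize edgeForm k s α γ μ ρ P Q x x' y y' τ = F at key ⊢
  clear hm₁₁ hm₁₂ hm₂₂ ha h2 h3 h4 h5
  have hz := sq_nonneg z
  have o1' := mul_nonneg h1.le o1
  refine ⟨nonneg_of_mul_nonneg_right (by linarith) h1, fun h0 => ?_⟩
  rw [h0, mul_zero] at key
  obtain ⟨hX, hY⟩ := e2 (by linarith)
  obtain ⟨hD, hE⟩ := o2 ((mul_eq_zero.1 (show a * o = 0 by linarith)).resolve_left h1.ne')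
  exact ⟨by linarith, by linarith,
    hτ hX hY ((pow_eq_zero_iff two_ne_zero).1 (by linarith : z ^ 2 = 0))⟩

theorem sum_add_one {c : ℕ} [NeZero c] (f : Fin c → ℝ) : ∑ i, f (i + 1) = ∑ i, f i :=
  Equiv.sum_comp (Equiv.addRight (1 : Fin c)) f

/-- The variation of the angle between the columns `i` and `i + 1`. -/
def turn {c : ℕ} [NeZero c] (v : PolarCoord c) (i : Fin c) : ℝ := angle v (i + 1) - angle v i

theorem sum_turn {c : ℕ} [NeZero c] (v : PolarCoord c) : ∑ i, turn v i = 0 := by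
  simp only [turn, Finset.sum_sub_distrib, sum_add_one (angle v), sub_self]

theorem eq_zero_of_turn {c : ℕ} [NeZero c] {v : PolarCoord c} (hx : ∀ i, v (Sum.inl i) = 0)
    (hτ : ∀ i, turn v i = 0) (hy : ∀ i, v (Sum.inr (Sum.inr i)) = 0) : v = 0 := by
  ext i
  rcases i with i | j | i
  · exact hx i
  · have h1 := angle_add_one_of_lt v j
    have h2 := hτ ⟨j.val, by omega⟩
    rw [turn] at h2
    rw [PiLp.zero_apply]
    linarith
  · exact hy i

section line
variable {c : ℕ} [NeZero c]

/-- First derivative of the dot product `l_i l_{i+1} cos θ_i` of neighbouring columns along a line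
through the regular polygon; `k` and `s` are the cosine and sine of `2π / c`. -/
def dotVar₁ (l k s x x' τ : ℝ) : ℝ := l * k * (x + x') - l ^ 2 * s * τ

/-- Second derivative of the dot product of neighbouring columns along a line. -/
def dotVar₂ (l k s x x' τ : ℝ) : ℝ :=
  2 * k * x * x' - 2 * l * s * τ * (x + x') - l ^ 2 * k * τ ^ 2

/-- The first and second variation of the potential at the regular polygon in the direction `v`. -/
theorem hasJet_localPotential_line (hc : 1 < c) {l b k s : ℝ} (hl : 0 < l)
    (hk : k = Real.cos (2 * Real.pi / c)) (hs : s = Real.sin (2 * Real.pi / c)) (hk0 : 0 < k)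
    (v : PolarCoord c) {x y : Fin c → ℝ} (hx : x = fun i => v (Sum.inl i))
    (hy : y = fun i => v (Sum.inr (Sum.inr i))) {u : ℝ} (hu : u = l ^ 2 * k) :
    ∃ a₀, HasJet (fun ε : ℝ => localPotential (ofPolar 0 (gonCoord c l b + ε • v))) a₀
      (∑ i, ((edgeU u b * dotVar₁ l k s (x i) (x (i + 1)) (turn v i) + edgeB u b * y i) +
        (edgeU u b * dotVar₁ l k s (x i) (x (i + 1)) (turn v i) + edgeB u b * y (i + 1)) +
        (vertexS (l ^ 2) b * (2 * l * x i) + vertexB (l ^ 2) b * y i)))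
      (∑ i, ((edgeUU u b * dotVar₁ l k s (x i) (x (i + 1)) (turn v i) ^ 2 +
          edgeU u b * dotVar₂ l k s (x i) (x (i + 1)) (turn v i) +
          2 * edgeUB u b * dotVar₁ l k s (x i) (x (i + 1)) (turn v i) * y i +
          edgeBB u b * y i ^ 2) +
        (edgeUU u b * dotVar₁ l k s (x i) (x (i + 1)) (turn v i) ^ 2 +
          edgeU u b * dotVar₂ l k s (x i) (x (i + 1)) (turn v i) +
          2 * edgeUB u b * dotVar₁ l k s (x i) (x (i + 1)) (turn v i) * y (i + 1) +
          edgeBB u b * y (i + 1) ^ 2) +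
        (vertexSS (l ^ 2) b * (2 * l * x i) ^ 2 + vertexS (l ^ 2) b * (2 * x i ^ 2) +
          2 * vertexSB (l ^ 2) b * (2 * l * x i) * y i + vertexBB (l ^ 2) b * y i ^ 2))) := by
  subst hx hy hu
  refine ⟨∑ _i : Fin c, (edgeTerm (l ^ 2 * k) b + edgeTerm (l ^ 2 * k) b + vertexTerm (l ^ 2) b),
    HasJet.sum Finset.univ fun i _ => ?_⟩
  have hlen : ∀ j : Fin c, HasJet (fun ε : ℝ => (gonCoord c l b + ε • v) (Sum.inl j)) l
      (v (Sum.inl j)) 0 := fun j => HasJet.linear l (v (Sum.inl j))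
  have hbias : ∀ j : Fin c, HasJet
      (fun ε : ℝ => bias (ofPolar 0 (gonCoord c l b + ε • v)) j) b (v (Sum.inr (Sum.inr j))) 0 :=
    fun j => HasJet.linear b (v (Sum.inr (Sum.inr j)))
  have hcos : HasJet (fun ε : ℝ => Real.cos (angle (gonCoord c l b + ε • v) (i + 1) -
      angle (gonCoord c l b + ε • v) i)) k (-(s * turn v i)) (-(k * turn v i ^ 2)) := by
    have h1 := HasJet.cos_linear
      (angle (gonCoord c l b) (i + 1) - angle (gonCoord c l b) i) (turn v i)
    rw [cos_angle_gonCoord hc, sin_angle_gonCoord hc, ← hk, ← hs] at h1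
    convert h1 using 3 with ε
    rw [angle_add, angle_add, angle_smul, angle_smul, turn]
    ring
  have hadj : HasJet (fun ε : ℝ => colDot (weight (ofPolar 0 (gonCoord c l b + ε • v))) i (i + 1))
      (l ^ 2 * k) (dotVar₁ l k s (v (Sum.inl i)) (v (Sum.inl (i + 1))) (turn v i))
      (dotVar₂ l k s (v (Sum.inl i)) (v (Sum.inl (i + 1))) (turn v i)) := by
    simp only [colDot_ofPolar, dotVar₁, dotVar₂]
    exact (((hlen i).mul (hlen (i + 1))).mul hcos).congr_jet (by ring) (by ring) (by ring)
  have hself : HasJet (fun ε : ℝ => colDot (weight (ofPolar 0 (gonCoord c l b + ε • v))) i i)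
      (l ^ 2) (2 * l * v (Sum.inl i)) (2 * v (Sum.inl i) ^ 2) := by
    simp only [colDot_ofPolar, sub_self, Real.cos_zero, mul_one]
    exact ((hlen i).mul (hlen i)).congr_jet (by ring) (by ring) (by ring)
  exact ((hadj.edgeTerm (hbias i) (by positivity)).add
    (hadj.edgeTerm (hbias (i + 1)) (by positivity))).add
      (hself.vertexTerm (hbias i) (by positivity))

/-- The first variation depends only on the sums of the variations of the lengths, the biases and
the angles, and the angles vary with sum zero; two equations are therefore sufficient. -/
theorem firstVariation_eq_zero {l k s gu gb vs vb : ℝ} (h1 : 2 * k * gu + vs = 0)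
    (h2 : 2 * gb + vb = 0) (x y τ : Fin c → ℝ) (hτ : ∑ i, τ i = 0) :
    ∑ i, ((gu * dotVar₁ l k s (x i) (x (i + 1)) (τ i) + gb * y i) +
      (gu * dotVar₁ l k s (x i) (x (i + 1)) (τ i) + gb * y (i + 1)) +
      (vs * (2 * l * x i) + vb * y i)) = 0 := by
  have e1 := sum_add_one x
  have e2 := sum_add_one y
  simp only [dotVar₁, Finset.sum_add_distrib, Finset.sum_sub_distrib, ← Finset.mul_sum, e1, e2, hτ]
  linear_combination (2 * l * ∑ i, x i) * h1 + (∑ i, y i) * h2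

/-- In the dimensionless variables `x / l`, `y / l²` the second variation is a sum of one quadratic
form per pair of neighbouring columns. -/
theorem secondVariation_eq {l k s gu α γ μ ν vs P Q R ρ : ℝ} (hl : 0 < l) (hgu : gu = l ^ 2 * γ)
    (h1 : 2 * k * gu + vs = 0) (hρ : ρ = ν / 2 + R / 4) (x y τ : Fin c → ℝ) :
    ∑ i, ((α * dotVar₁ l k s (x i) (x (i + 1)) (τ i) ^ 2 +
        gu * dotVar₂ l k s (x i) (x (i + 1)) (τ i) +
        2 * μ * dotVar₁ l k s (x i) (x (i + 1)) (τ i) * y i + ν * y i ^ 2) +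
      (α * dotVar₁ l k s (x i) (x (i + 1)) (τ i) ^ 2 +
        gu * dotVar₂ l k s (x i) (x (i + 1)) (τ i) +
        2 * μ * dotVar₁ l k s (x i) (x (i + 1)) (τ i) * y (i + 1) + ν * y (i + 1) ^ 2) +
      (P * (2 * l * x i) ^ 2 + vs * (2 * x i ^ 2) + 2 * Q * (2 * l * x i) * y i + R * y i ^ 2)) =
    ∑ i, l ^ 4 * edgeForm k s α γ μ ρ P Q (x i / l) (x (i + 1) / l) (y i / l ^ 2)
      (y (i + 1) / l ^ 2) (τ i) := by
  have hvs : vs = -2 * k * (l ^ 2 * γ) := by rw [← hgu]; linarith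
  -- Half of the self-interaction of each column is moved to the next edge.
  have e := sum_add_one fun i => (2 * P - 2 * k * γ) * l ^ 2 * x i ^ 2 + 2 * Q * l * (x i * y i) +
    R / 2 * y i ^ 2
  rw [← sub_eq_zero, ← Finset.sum_sub_distrib] at e
  rw [← sub_eq_zero, ← neg_eq_zero, ← e, ← Finset.sum_sub_distrib, ← Finset.sum_neg_distrib]
  refine Finset.sum_congr rfl fun i _ => ?_
  rw [hvs, hgu, hρ, edgeForm, dotVar₁, dotVar₂]
  field_simp
  ring

end line

/-! ### Regular polygons with positive definite second variation -/

/-- The conditions on `(l, b)` under which the regular polygon is a critical point whose second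
variation is positive definite edge by edge. The equations `crit_length` and `crit_bias` express
that the derivatives with respect to the common length and the common bias vanish. -/
structure StableGon (c : ℕ) (l b : ℝ) : Prop where
  two_lt : 2 < c
  le_eight : c ≤ 8
  cos_pos : 0 < Real.cos (2 * Real.pi / c)
  length_pos : 0 < l
  bias_neg : b < 0
  lt_bias : -l ^ 2 * Real.cos (2 * Real.pi / c) < b
  crit_length : 2 * Real.cos (2 * Real.pi / c) * edgeU (l ^ 2 * Real.cos (2 * Real.pi / c)) b +
    vertexS (l ^ 2) b = 0
  crit_bias : 2 * edgeB (l ^ 2 * Real.cos (2 * Real.pi / c)) b + vertexB (l ^ 2) b = 0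
  posDef : EdgeFormPosDef (Real.cos (2 * Real.pi / c)) (Real.sin (2 * Real.pi / c))
    (edgeUU (l ^ 2 * Real.cos (2 * Real.pi / c)) b)
    (edgeU (l ^ 2 * Real.cos (2 * Real.pi / c)) b / l ^ 2)
    (edgeUB (l ^ 2 * Real.cos (2 * Real.pi / c)) b)
    (edgeBB (l ^ 2 * Real.cos (2 * Real.pi / c)) b / 2 + vertexBB (l ^ 2) b / 4)
    (vertexSS (l ^ 2) b) (vertexSB (l ^ 2) b)

/-- Polar coordinates together with the rotation angle are local coordinates at a regular
polygon. -/
theorem fderiv_ofPolar_injective {c : ℕ} [NeZero c] {l b φ : ℝ} (hl : 0 < l)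
    (q : ℝ × PolarCoord c)
    (hq : fderiv ℝ (fun q : ℝ × PolarCoord c => ofPolar q.1 q.2) (φ, gonCoord c l b) q = 0) :
    q = 0 := by
  obtain ⟨r, v⟩ := q
  have hline : HasDerivAt (fun ε : ℝ => ((φ, gonCoord c l b) : ℝ × PolarCoord c) + ε • (r, v))
      (r, v) 0 := by
    simpa using ((hasDerivAt_id (0 : ℝ)).smul_const ((r, v) : ℝ × PolarCoord c)).const_add
      ((φ, gonCoord c l b) : ℝ × PolarCoord c)
  have hd : HasFDerivAt (fun q : ℝ × PolarCoord c => ofPolar q.1 q.2)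
      (fderiv ℝ (fun q : ℝ × PolarCoord c => ofPolar q.1 q.2) (φ, gonCoord c l b))
      (((φ, gonCoord c l b) : ℝ × PolarCoord c) + (0 : ℝ) • (r, v)) := by
    rw [zero_smul, add_zero]
    exact (contDiff_ofPolar.differentiable (by simp) _).hasFDerivAt
  have h0 := hd.comp_hasDerivAt (0 : ℝ) hline
  rw [hq] at h0
  have hcoord : ∀ m, HasDerivAt (fun ε : ℝ => ofPolar (φ + ε * r) (gonCoord c l b + ε • v) m) 0 0 :=
    fun m => (EuclideanSpace.proj (𝕜 := ℝ) m).hasFDerivAt.comp_hasDerivAt (0 : ℝ) h0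
  have hlin : ∀ i, HasDerivAt (fun ε : ℝ => φ + ε * r + angle (gonCoord c l b + ε • v) i)
      (r + angle v i) 0 := by
    intro i
    have h1 : (fun ε : ℝ => φ + ε * r + angle (gonCoord c l b + ε • v) i) =
        fun ε : ℝ => (φ + angle (gonCoord c l b) i) + ε * (r + angle v i) := by
      ext ε; rw [angle_add, angle_smul]; ring
    rw [h1]
    simpa using ((hasDerivAt_id (0 : ℝ)).mul_const (r + angle v i)).const_add
      (φ + angle (gonCoord c l b) i)
  have hlen : ∀ i, HasDerivAt (fun ε : ℝ => (gonCoord c l b + ε • v) (Sum.inl i))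
      (v (Sum.inl i)) 0 := by
    intro i
    simpa using ((hasDerivAt_id (0 : ℝ)).mul_const (v (Sum.inl i))).const_add l
  have hzero : ∀ i, v (Sum.inl i) = 0 ∧ r + angle v i = 0 := by
    intro i
    have e1 : v (Sum.inl i) * Real.cos (φ + angle (gonCoord c l b) i) +
        l * (-Real.sin (φ + angle (gonCoord c l b) i) * (r + angle v i)) = 0 := by
      have h1 := ((hlen i).mul (hlin i).cos).unique (hcoord (Sum.inl (0, i)))
      simpa [gonCoord_inl] using h1
    have e2 : v (Sum.inl i) * Real.sin (φ + angle (gonCoord c l b) i) +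
        l * (Real.cos (φ + angle (gonCoord c l b) i) * (r + angle v i)) = 0 := by
      have h1 := ((hlen i).mul (hlin i).sin).unique (hcoord (Sum.inl (1, i)))
      simpa [gonCoord_inl] using h1
    have e3 := Real.sin_sq_add_cos_sq (φ + angle (gonCoord c l b) i)
    generalize Real.sin (φ + angle (gonCoord c l b) i) = S at *
    generalize Real.cos (φ + angle (gonCoord c l b) i) = C at *
    constructor
    · linear_combination C * e1 + S * e2 - v (Sum.inl i) * e3
    · have h1 : l * (r + angle v i) = 0 := by
        linear_combination C * e2 - S * e1 - l * (r + angle v i) * e3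
      exact (mul_eq_zero.1 h1).resolve_left hl.ne'
  have hr : r = 0 := by simpa [angle_zero] using (hzero 0).2
  subst hr
  have hang : ∀ i, angle v i = 0 := fun i => by simpa using (hzero i).2
  have hv : v = 0 := by
    refine eq_zero_of_turn (fun i => (hzero i).1) (fun i => by rw [turn, hang, hang, sub_zero])
      fun i => ?_
    have h1 : HasDerivAt (fun ε : ℝ => b + ε * v (Sum.inr (Sum.inr i)))
        (v (Sum.inr (Sum.inr i))) 0 := by
      simpa using ((hasDerivAt_id (0 : ℝ)).mul_const (v (Sum.inr (Sum.inr i)))).const_add b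
    exact h1.unique (hcoord (Sum.inr i))
  rw [hv]; rfl

theorem card_param {c : ℕ} (hc : 0 < c) : Fintype.card ((Fin 2 × Fin c) ⊕ Fin c) =
    Fintype.card (Fin c ⊕ (Fin (c - 1) ⊕ Fin c)) + 1 := by
  simp; omega

theorem dist_regularGon {c : ℕ} {l b : ℝ} (φ φ' : ℝ) :
    dist (regularGon c l b φ') (regularGon c l b φ) ^ 2 =
      c * (2 * l ^ 2 * (1 - Real.cos (φ' - φ))) := by
  rw [dist_eq_norm, EuclideanSpace.real_norm_sq_eq, Fintype.sum_sum_type, Fintype.sum_prod_type]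
  simp only [PiLp.sub_apply, Fin.sum_univ_two]
  have h1 : ∀ i : Fin c, (regularGon c l b φ' (Sum.inr i) - regularGon c l b φ (Sum.inr i)) ^ 2 =
      0 := by
    intro i
    change (b - b) ^ 2 = 0
    ring
  simp only [h1, Finset.sum_const_zero, add_zero]
  rw [← Finset.sum_add_distrib]
  have h2 : ∀ i : Fin c,
      (regularGon c l b φ' (Sum.inl (0, i)) - regularGon c l b φ (Sum.inl (0, i))) ^ 2 +
      (regularGon c l b φ' (Sum.inl (1, i)) - regularGon c l b φ (Sum.inl (1, i))) ^ 2 =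
      2 * l ^ 2 * (1 - Real.cos (φ' - φ)) := by
    intro i
    have h3 : φ' - φ = (φ' + angle (gonCoord c l b) i) - (φ + angle (gonCoord c l b) i) := by ring
    simp only [regularGon, ofPolar_inl, gonCoord_inl, h3, Real.cos_sub]
    have h4 := Real.sin_sq_add_cos_sq (φ' + angle (gonCoord c l b) i)
    have h5 := Real.sin_sq_add_cos_sq (φ + angle (gonCoord c l b) i)
    simp
    linear_combination l ^ 2 * h4 + l ^ 2 * h5
  simp only [h2, Finset.sum_const, Finset.card_univ, Fintype.card_fin, nsmul_eq_mul]

namespace StableGon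
variable {c : ℕ} [NeZero c] {l b : ℝ}

theorem exists_contDiffOn (h : StableGon c l b) :
    ∃ U : Set (PolarCoord c), IsOpen U ∧ gonCoord c l b ∈ U ∧
      ContDiffOn ℝ ∞ (polarPotential (c := c)) U ∧
      ∀ u ∈ U, polarPotential u = localPotential (ofPolar 0 u) := by
  have hcont : ContDiff ℝ ∞ (fun u : PolarCoord c => ofPolar 0 u) :=
    contDiff_ofPolar.comp (contDiff_const.prodMk contDiff_id)
  have h1 : ∀ᶠ u in 𝓝 (gonCoord c l b), potential (ofPolar 0 u) = localPotential (ofPolar 0 u) :=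
    (hcont.continuous.tendsto (gonCoord c l b)).eventually
      (eventually_potential_eq_localPotential h.two_lt h.le_eight h.length_pos h.bias_neg
        h.cos_pos h.lt_bias 0)
  obtain ⟨O, hO, hOopen, hOmem⟩ := eventually_nhds_iff.1 h1
  refine ⟨O ∩ (fun u => ofPolar 0 u) ⁻¹' localDomain c,
    hOopen.inter (isOpen_localDomain.preimage hcont.continuous),
    ⟨hOmem, regularGon_mem_localDomain (by have := h.two_lt; omega) h.length_pos h.cos_pos 0⟩, ?_,
    fun u hu => hO u hu.1⟩
  refine ContDiffOn.congr (f := fun u => localPotential (ofPolar 0 u)) ?_ fun u hu => hO u hu.1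
  exact contDiffOn_localPotential.comp hcont.contDiffOn fun u hu => hu.2

theorem variations (h : StableGon c l b) :
    fderiv ℝ (polarPotential (c := c)) (gonCoord c l b) = 0 ∧
    ∀ v, v ≠ 0 → 0 < fderiv ℝ (fderiv ℝ (polarPotential (c := c))) (gonCoord c l b) v v := by
  obtain ⟨U, hU, hmem, hsmooth, heq⟩ := h.exists_contDiffOn
  have hc : 1 < c := by have := h.two_lt; omega
  have hK : ContDiffAt ℝ 2 (polarPotential (c := c)) (gonCoord c l b) :=
    (hsmooth.contDiffAt (hU.mem_nhds hmem)).of_le two_le_infty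
  -- The jet along each line through the polygon, with the first variation already set to `0`.
  have hjet : ∀ v : PolarCoord c, ∃ a₀, HasJet
      (fun ε : ℝ => polarPotential (gonCoord c l b + ε • v)) a₀ 0
      (∑ i, l ^ 4 * edgeForm (Real.cos (2 * Real.pi / c)) (Real.sin (2 * Real.pi / c))
        (edgeUU (l ^ 2 * Real.cos (2 * Real.pi / c)) b)
        (edgeU (l ^ 2 * Real.cos (2 * Real.pi / c)) b / l ^ 2)
        (edgeUB (l ^ 2 * Real.cos (2 * Real.pi / c)) b)
        (edgeBB (l ^ 2 * Real.cos (2 * Real.pi / c)) b / 2 + vertexBB (l ^ 2) b / 4)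
        (vertexSS (l ^ 2) b) (vertexSB (l ^ 2) b)
        (v (Sum.inl i) / l) (v (Sum.inl (i + 1)) / l)
        (v (Sum.inr (Sum.inr i)) / l ^ 2) (v (Sum.inr (Sum.inr (i + 1))) / l ^ 2) (turn v i)) := by
    intro v
    obtain ⟨a₀, h1⟩ := hasJet_localPotential_line (b := b) hc h.length_pos rfl rfl h.cos_pos v
      rfl rfl rfl
    rw [firstVariation_eq_zero h.crit_length h.crit_bias _ _ _ (sum_turn v),
      secondVariation_eq h.length_pos (γ := edgeU (l ^ 2 * Real.cos (2 * Real.pi / c)) b / l ^ 2)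
        (by have := h.length_pos; field_simp) h.crit_length rfl] at h1
    obtain ⟨h2, f', h3, h4, h5⟩ := h1
    have hev : ∀ᶠ ε : ℝ in 𝓝 0, gonCoord c l b + ε • v ∈ U := by
      have hcont : Continuous fun ε : ℝ => gonCoord c l b + ε • v := by fun_prop
      exact hcont.continuousAt.eventually_mem (hU.mem_nhds (by simpa using hmem))
    refine ⟨a₀, (heq _ hev.self_of_nhds).trans h2, f', ?_, h4, h5⟩
    filter_upwards [h3, eventually_eventually_nhds.2 hev] with ε h6 h7
    exact h6.congr_of_eventuallyEq (h7.mono fun ε' h8 => heq _ h8)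
  refine ⟨?_, fun v hv => ?_⟩
  · ext1 v
    obtain ⟨a₀, h1⟩ := hjet v
    exact (h1.fderiv_eq hK).1
  · obtain ⟨a₀, h1⟩ := hjet v
    rw [(h1.fderiv_eq hK).2]
    have hl := h.length_pos
    have hl4 : 0 < l ^ 4 := by positivity
    have hnn := fun i (_ : i ∈ Finset.univ) => mul_nonneg hl4.le (h.posDef.pos
      (v (Sum.inl i) / l) (v (Sum.inl (i + 1)) / l) (v (Sum.inr (Sum.inr i)) / l ^ 2)
      (v (Sum.inr (Sum.inr (i + 1))) / l ^ 2) (turn v i)).1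
    refine lt_of_le_of_ne (Finset.sum_nonneg hnn) fun hzero => hv ?_
    have hall := (Finset.sum_eq_zero_iff_of_nonneg hnn).1 hzero.symm
    have hz := fun i => (h.posDef.pos
      (v (Sum.inl i) / l) (v (Sum.inl (i + 1)) / l) (v (Sum.inr (Sum.inr i)) / l ^ 2)
      (v (Sum.inr (Sum.inr (i + 1))) / l ^ 2) (turn v i)).2
      ((mul_eq_zero.1 (hall i (Finset.mem_univ i))).resolve_left hl4.ne')
    refine eq_zero_of_turn (fun i => ?_) (fun i => (hz i).2.2) fun i => ?_
    · simpa [hl.ne'] using (hz i).1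
    · simpa [hl.ne'] using (hz i).2.1

theorem exists_chart (h : StableGon c l b) :
    ∃ Φ : OpenPartialHomeomorph (PolarCoord c) (PolarCoord c),
      gonCoord c l b ∈ Φ.source ∧ Φ (gonCoord c l b) = 0 ∧ ContDiffOn ℝ ∞ Φ Φ.source ∧
      ContDiffOn ℝ ∞ Φ.symm Φ.target ∧
      ∀ q ∈ Φ.source, polarPotential q = polarPotential (gonCoord c l b) + ‖Φ q‖ ^ 2 := by
  obtain ⟨U, hU, hmem, hsmooth, -⟩ := h.exists_contDiffOn
  exact exists_smooth_chart_norm_sq hU hsmooth hmem h.variations.1 h.variations.2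

theorem isNondegenerateCriticalPoint (h : StableGon c l b) :
    IsNondegenerateCriticalPoint (polarPotential (c := c)) (gonCoord c l b) := by
  obtain ⟨U, hU, hmem, hsmooth, -⟩ := h.exists_contDiffOn
  have hK := hsmooth.contDiffAt (hU.mem_nhds hmem)
  refine ⟨?_, ⟨hK.of_le two_le_infty, fun v hv => ?_⟩, ?_⟩
  · have h1 := (hK.differentiableAt (by simp)).hasFDerivAt
    rwa [h.variations.1] at h1
  · by_contra hne
    exact (h.variations.2 v hne).ne' (hv v)
  · obtain ⟨Φ, h1, h2, h3, h4, h5⟩ := h.exists_chart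
    refine ⟨Φ, fun _ => 1, h1, h2, h3, h4, fun _ => one_ne_zero, fun q hq => ?_⟩
    rw [h5 q hq, EuclideanSpace.real_norm_sq_eq]
    simp

/-- The derivative vanishes in the directions of the polar coordinates and, by invariance, in the
direction of the rotation; these span the parameter space. -/
theorem isCriticalPoint (h : StableGon c l b) (φ : ℝ) :
    IsCriticalPoint potential (regularGon c l b φ) := by
  have hc : 1 < c := by have := h.two_lt; omega
  have hdiff : DifferentiableAt ℝ potential (regularGon c l b φ) := by
    have h1 : DifferentiableAt ℝ localPotential (regularGon c l b φ) :=
      (contDiffOn_localPotential.contDiffAt (isOpen_localDomain.mem_nhds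
        (regularGon_mem_localDomain hc h.length_pos h.cos_pos φ))).differentiableAt (by simp)
    exact h1.congr_of_eventuallyEq (eventually_potential_eq_localPotential h.two_lt h.le_eight
      h.length_pos h.bias_neg h.cos_pos h.lt_bias φ)
  let M := fderiv ℝ (fun q : ℝ × PolarCoord c => ofPolar q.1 q.2) (φ, gonCoord c l b)
  have hM : HasFDerivAt (fun q : ℝ × PolarCoord c => ofPolar q.1 q.2) M (φ, gonCoord c l b) :=
    (contDiff_ofPolar.differentiable (by simp) _).hasFDerivAt
  have hsurj : Function.Surjective M.toLinearMap := by
    refine (LinearMap.injective_iff_surjective_of_finrank_eq_finrank ?_).1 ?_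
    · rw [Module.finrank_prod, Module.finrank_self, finrank_euclideanSpace, finrank_euclideanSpace,
        card_param (by omega), add_comm]
    · rw [← LinearMap.ker_eq_bot, LinearMap.ker_eq_bot']
      exact fun q hq => fderiv_ofPolar_injective h.length_pos q hq
  have hcomp : HasFDerivAt (fun q : ℝ × PolarCoord c => potential (ofPolar q.1 q.2))
      ((fderiv ℝ potential (regularGon c l b φ)).comp M) (φ, gonCoord c l b) :=
    HasFDerivAt.comp (g := potential) (φ, gonCoord c l b) hdiff.hasFDerivAt hM
  have hzero : HasFDerivAt (fun q : ℝ × PolarCoord c => potential (ofPolar q.1 q.2))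
      (0 : ℝ × PolarCoord c →L[ℝ] ℝ) (φ, gonCoord c l b) := by
    simp only [potential_ofPolar]
    have hp : HasFDerivAt (polarPotential (c := c)) (0 : PolarCoord c →L[ℝ] ℝ)
        (Prod.snd ((φ, gonCoord c l b) : ℝ × PolarCoord c)) := h.isNondegenerateCriticalPoint.1
    exact hp.comp (φ, gonCoord c l b) hasFDerivAt_snd
  have hfd : fderiv ℝ potential (regularGon c l b φ) = 0 := by
    ext1 w
    obtain ⟨q, rfl⟩ := hsurj w
    have h1 := DFunLike.congr_fun (hcomp.unique hzero) q
    exact h1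
  have h1 := hdiff.hasFDerivAt
  rwa [hfd] at h1

/-- A sphere around a regular polygon meets its rotation orbit in finitely many points. -/
theorem finite_dist_regularGon_eq (hl : 0 < l) (φ ρ : ℝ) :
    {φ' | |φ' - φ| < Real.pi ∧ dist (regularGon c l b φ') (regularGon c l b φ) = ρ}.Finite := by
  have hc : (0 : ℝ) < c := by exact_mod_cast Nat.pos_of_ne_zero (NeZero.ne c)
  let t := Real.arccos (1 - ρ ^ 2 / (c * (2 * l ^ 2)))
  refine (Set.toFinite ({φ + t, φ - t} : Set ℝ)).subset ?_
  rintro φ' ⟨h1, h2⟩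
  have h3 : Real.cos |φ' - φ| = 1 - ρ ^ 2 / (c * (2 * l ^ 2)) := by
    rw [Real.cos_abs, ← h2, dist_regularGon]
    field_simp
    ring
  have h4 : |φ' - φ| = t := by
    rw [← Real.arccos_cos (abs_nonneg _) h1.le, h3]
  rcases abs_choice (φ' - φ) with h5 | h5 <;> rw [h5] at h4
  · left; linarith
  · right; rw [Set.mem_singleton_iff]; linarith

theorem isLocalLearningCoefficient (h : StableGon c l b) (φ : ℝ) :
    IsLocalLearningCoefficient potential (regularGon c l b φ) ((3 * (c : ℝ) - 1) / 2) := by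
  have hc : 0 < c := by have := h.two_lt; omega
  obtain ⟨Φ, h1, h2, h3, h4, h5⟩ := h.exists_chart
  have h0t : (0 : PolarCoord c) ∈ Φ.target := by rw [← h2]; exact Φ.map_source h1
  have hsymm0 : Φ.symm 0 = gonCoord c l b := by rw [← h2, Φ.left_inv h1]
  -- The rotation angle together with Morse coordinates transverse to the rotation orbit.
  let Θ : ℝ × PolarCoord c → Param 2 c := fun q => ofPolar q.1 (Φ.symm q.2)
  let W : Set (ℝ × PolarCoord c) := Metric.ball φ Real.pi ×ˢ Φ.target
  have hΘ0 : ∀ φ', Θ (φ', 0) = regularGon c l b φ' := fun φ' => by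
    simp only [Θ, hsymm0, regularGon]
  have hinner : ContDiffOn ℝ ∞ (fun q : ℝ × PolarCoord c => (q.1, Φ.symm q.2)) W :=
    contDiff_fst.contDiffOn.prodMk (h4.comp contDiff_snd.contDiffOn fun q hq => hq.2)
  have hW : IsOpen W := Metric.isOpen_ball.prod Φ.open_target
  have hφW : ((φ, 0) : ℝ × PolarCoord c) ∈ W := ⟨Metric.mem_ball_self Real.pi_pos, h0t⟩
  have hΘ : ContDiffOn ℝ 1 Θ W :=
    (contDiff_ofPolar.comp_contDiffOn hinner).of_le (by exact_mod_cast le_top)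
  have hinj : ∀ v, fderiv ℝ Θ (φ, 0) v = 0 → v = 0 := by
    intro v hv
    have d1 : HasFDerivAt Φ.symm (fderiv ℝ Φ.symm 0) 0 :=
      ((h4.contDiffAt (Φ.open_target.mem_nhds h0t)).differentiableAt (by simp)).hasFDerivAt
    have d2 : HasFDerivAt Φ (fderiv ℝ Φ (gonCoord c l b)) (Φ.symm 0) := by
      rw [hsymm0]
      exact ((h3.contDiffAt (Φ.open_source.mem_nhds h1)).differentiableAt (by simp)).hasFDerivAt
    have d3 : (fderiv ℝ Φ (gonCoord c l b)).comp (fderiv ℝ Φ.symm 0) =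
        ContinuousLinearMap.id ℝ _ := by
      refine (d2.comp 0 d1).unique ((hasFDerivAt_id (0 : PolarCoord c)).congr_of_eventuallyEq ?_)
      filter_upwards [Φ.open_target.mem_nhds h0t] with z hz
      exact Φ.right_inv hz
    have d4 : HasFDerivAt (fun q : ℝ × PolarCoord c => (q.1, Φ.symm q.2))
        ((ContinuousLinearMap.fst ℝ ℝ (PolarCoord c)).prod
          ((fderiv ℝ Φ.symm 0).comp (ContinuousLinearMap.snd ℝ ℝ (PolarCoord c)))) (φ, 0) :=
      (hasFDerivAt_fst (𝕜 := ℝ)).prodMk (d1.comp ((φ, 0) : ℝ × PolarCoord c) hasFDerivAt_snd)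
    have d5 : HasFDerivAt (fun q : ℝ × PolarCoord c => ofPolar q.1 q.2)
        (fderiv ℝ (fun q : ℝ × PolarCoord c => ofPolar q.1 q.2) (φ, gonCoord c l b))
        (φ, Φ.symm 0) := by
      rw [hsymm0]
      exact (contDiff_ofPolar.differentiable (by simp) _).hasFDerivAt
    have d6 := HasFDerivAt.comp (g := fun q : ℝ × PolarCoord c => ofPolar q.1 q.2)
      ((φ, 0) : ℝ × PolarCoord c) d5 d4
    have d7 : fderiv ℝ Θ (φ, 0) = _ := d6.fderiv
    rw [d7] at hv
    have hz := fderiv_ofPolar_injective h.length_pos _ hv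
    have hz1 : v.1 = 0 := congrArg Prod.fst hz
    have hz2 : fderiv ℝ Φ.symm 0 v.2 = 0 := congrArg Prod.snd hz
    have hz3 : v.2 = 0 := by
      have := DFunLike.congr_fun d3 v.2
      simp only [ContinuousLinearMap.comp_apply, hz2, map_zero] at this
      exact this.symm
    exact Prod.ext hz1 hz3
  have hf : ∀ q ∈ W, potential (Θ q) = potential (Θ (φ, 0)) + ‖q.2‖ ^ 2 := by
    intro q hq
    simp only [Θ, potential_ofPolar, hsymm0]
    rw [h5 _ (Φ.map_target hq.2), Φ.right_inv hq.2]
  have hcount : ∀ ρ > 0, {φ' | (φ', 0) ∈ W ∧ dist (Θ (φ', 0)) (Θ (φ, 0)) = ρ}.Countable := by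
    intro ρ _
    refine ((finite_dist_regularGon_eq (c := c) (b := b) h.length_pos φ ρ).subset ?_).countable
    rintro φ' ⟨ha, hb⟩
    rw [hΘ0, hΘ0] at hb
    exact ⟨ha.1, hb⟩
  obtain ⟨hmin, hvol⟩ := isLocalMin_and_tendsto_volume_sublevel (card_param hc) hW hφW hΘ hinj hf
    hcount
  rw [hΘ0] at hmin hvol
  -- The multiplicity is `1`: there is no logarithmic factor.
  refine ⟨hmin, 1, le_rfl, hvol.mono fun ρ ⟨C, hC, hlim⟩ => ⟨C, hC, ?_⟩⟩
  have hexp : (Fintype.card (Fin c ⊕ (Fin (c - 1) ⊕ Fin c)) : ℝ) / 2 = (3 * (c : ℝ) - 1) / 2 := by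
    have h6 : Fintype.card (Fin c ⊕ (Fin (c - 1) ⊕ Fin c)) + 1 = 3 * c := by simp; omega
    have h7 : (Fintype.card (Fin c ⊕ (Fin (c - 1) ⊕ Fin c)) : ℝ) + 1 = 3 * c := by
      exact_mod_cast h6
    linarith
  rw [hexp] at hlim
  simpa using hlim

end StableGon

/-! ### The quartic equation for critical regular polygons -/

/-- After the substitution `b = -k T l²`, with `k = cos (2π / c)`, the polygon of length `l` and
bias `b` can only be critical if `T` is a root of this quartic polynomial. -/
def gonQuartic (k T : ℝ) : ℝ :=
  2 * (1 - T) ^ 2 * (2 + k * T + (k * T) ^ 2 - 2 * k - 2 * k * (k * T)) - T * (1 - k * T) ^ 3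

theorem gonQuartic_one_neg {k : ℝ} (hk : k < 1) : gonQuartic k 1 < 0 := by
  have h : 0 < (1 - k) ^ 3 := pow_pos (by linarith) 3
  simp only [gonQuartic, mul_one, sub_self]
  linarith

/-- The quartic is convex, with negative value at `1`, and so has at most one root in `[0, 1]`. -/
theorem gonQuartic_root_le {k T T' : ℝ} (hk : 0 < k) (hk' : k ≤ 3 / 4) (hT' : T' ≤ 1)
    (h : gonQuartic k T = 0) (h' : gonQuartic k T' = 0) : T' ≤ T := by
  by_contra! hlt
  have h1 := gonQuartic_one_neg (show k < 1 by linarith)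
  have hT'1 : T' < 1 := lt_of_le_of_ne hT' fun h2 => by rw [h2] at h'; linarith
  -- The second divided difference of the quartic at `T`, `T'` and `1`
  have key : (1 - T) * gonQuartic k T' - (1 - T') * gonQuartic k T -
      (T' - T) * gonQuartic k 1 = -((T' - T) * (1 - T) * (1 - T') *
        ((2 + k) * k ^ 2 * (T ^ 2 + T' ^ 2 + 1 + T * T' + T + T') +
          (2 - 11 * k) * k * (T + T' + 1) + (4 - 5 * k + 10 * k ^ 2))) := by
    simp only [gonQuartic]; ring
  have hdisc : 0 < 52 + 84 * k - 243 * k ^ 2 + 80 * k ^ 3 := by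
    nlinarith [mul_nonneg hk.le (sub_nonneg.2 hk'), mul_nonneg (mul_nonneg hk.le hk.le)
      (sub_nonneg.2 hk'), sq_nonneg (k - 3 / 4)]
  have hA : 0 < (2 + k) * k ^ 2 := by positivity
  have hpos : 0 < (2 + k) * k ^ 2 * (T ^ 2 + T' ^ 2 + 1 + T * T' + T + T') +
      (2 - 11 * k) * k * (T + T' + 1) + (4 - 5 * k + 10 * k ^ 2) := by
    -- The quadratic sum is minimal, for a given value of `T + T' + 1`, where all three are equal;
    -- there the expression is a quadratic polynomial whose discriminant is controlled by `hdisc`.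
    have h2 : 2 / 3 * (T + T' + 1) ^ 2 ≤ T ^ 2 + T' ^ 2 + 1 + T * T' + T + T' := by
      nlinarith [sq_nonneg (T - T'), sq_nonneg (T - 1), sq_nonneg (T' - 1)]
    have h3 := mul_le_mul_of_nonneg_left h2 hA.le
    generalize T + T' + 1 = p at *
    have h4 : 8 * (2 + k) * (2 / 3 * ((2 + k) * k ^ 2) * p ^ 2 + (2 - 11 * k) * k * p +
        (4 - 5 * k + 10 * k ^ 2)) = 1 / 3 * (4 * (2 + k) * k * p + 3 * (2 - 11 * k)) ^ 2 +
        (52 + 84 * k - 243 * k ^ 2 + 80 * k ^ 3) := by ring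
    have h5 : 0 < 2 / 3 * ((2 + k) * k ^ 2) * p ^ 2 + (2 - 11 * k) * k * p +
        (4 - 5 * k + 10 * k ^ 2) := by
      refine pos_of_mul_pos_right (a := 8 * (2 + k)) ?_ (by linarith)
      rw [h4]; positivity
    linarith
  rw [h, h', mul_zero, mul_zero] at key
  have h6 : 0 < (T' - T) * (1 - T) * (1 - T') :=
    mul_pos (mul_pos (by linarith) (by linarith)) (by linarith)
  nlinarith [mul_pos h6 hpos, mul_pos (sub_pos.2 hlt) (neg_pos.2 h1)]

/-- The criticality conditions of a regular polygon, in the variables `k = cos (2π / c)` and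
`T = -b / (k l²)`; the last equation determines `l²` from `T`. -/
theorem gonQuartic_eq_zero_of_isCriticalPoint {c : ℕ} [NeZero c] {l b k φ : ℝ} (hc : 2 < c)
    (hc8 : c ≤ 8) (hk : k = Real.cos (2 * Real.pi / c)) (hk0 : 0 < k) (hk1 : k < 1)
    (hl : 0 < l) (hb : b ≤ 0) (hlb : -l ^ 2 * k ≤ b)
    (hcrit : IsCriticalPoint potential (regularGon c l b φ)) :
    ∃ T, 0 ≤ T ∧ T ≤ 1 ∧ b = -(k * T * l ^ 2) ∧ gonQuartic k T = 0 ∧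
      l ^ 2 * (2 * k * (1 - T) ^ 2 + (1 - k * T) ^ 2) = 1 - (k * T) ^ 2 := by
  subst hk
  obtain ⟨h1, h2⟩ := IsCriticalPoint.equations hc hc8 hl hb hk0 hlb hcrit
  generalize Real.cos (2 * Real.pi / c) = k at *
  have hS : 0 < l ^ 2 := by positivity
  generalize l ^ 2 = S at *
  have hbT : b = -(k * (-b / (k * S)) * S) := by field_simp
  have hT0 : 0 ≤ -b / (k * S) := div_nonneg (by linarith) (by positivity)
  have hT1 : -b / (k * S) ≤ 1 := (div_le_one (by positivity)).2 (by linarith)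
  generalize -b / (k * S) = T at *
  subst hbT
  have e1 : 2 * S * (2 * k ^ 2 * (1 - T) ^ 3 + (1 - k * T) ^ 3) =
      (1 - k * T) ^ 2 * (2 + k * T) := by
    refine mul_left_cancel₀ hS.ne' ?_
    simp only [edgeTerm] at h1
    field_simp at h1
    linear_combination h1
  have e2 : S * (2 * k * (1 - T) ^ 2 + (1 - k * T) ^ 2) = 1 - (k * T) ^ 2 := by
    field_simp at h2
    linear_combination h2 / 3
  refine ⟨T, hT0, hT1, rfl, ?_, e2⟩
  -- Eliminating `S` from the two equations leaves a multiple of the quartic.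
  have e3 : (1 - k * T) * k * gonQuartic k T = 0 := by
    simp only [gonQuartic]
    linear_combination 2 * (2 * k ^ 2 * (1 - T) ^ 3 + (1 - k * T) ^ 3) * e2 -
      (2 * k * (1 - T) ^ 2 + (1 - k * T) ^ 2) * e1
  have h3 : 0 < (1 - k * T) * k := mul_pos (by nlinarith) hk0
  exact (mul_eq_zero.1 e3).resolve_left h3.ne'

/-- The second variation of the polygon at the parameters `k`, `S = l²` and `T = -b / (k S)`. -/
def GonPosDef (k s S T : ℝ) : Prop :=
  EdgeFormPosDef k s (2 - 2 * T ^ 3) (k * (1 - T) ^ 2 * (2 + T)) (3 - 3 * T ^ 2)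
    ((6 - 6 * T) / 2 + (6 - 6 * (k * T) - 6 * (k * T) * S⁻¹) / 4)
    (2 - 2 * (k * T) ^ 3 - 6 * (k * T) ^ 3 * S⁻¹) (3 - 3 * (k * T) ^ 2 - 6 * (k * T) ^ 2 * S⁻¹)

theorem StableGon.of_gonQuartic_eq_zero {c : ℕ} {k l b T : ℝ} (hc : 2 < c) (hc8 : c ≤ 8)
    (hk : k = Real.cos (2 * Real.pi / c)) (hk0 : 0 < k) (hk1 : k < 1) (hl : 0 < l) (hT0 : 0 < T)
    (hT1 : T < 1) (hb : b = -(k * T * l ^ 2)) (h : gonQuartic k T = 0)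
    (hS : l ^ 2 * (2 * k * (1 - T) ^ 2 + (1 - k * T) ^ 2) = 1 - (k * T) ^ 2)
    (hpd : GonPosDef k (Real.sin (2 * Real.pi / c)) (l ^ 2) T) : StableGon c l b := by
  have hS0 : 0 < l ^ 2 := by positivity
  have hb0 : b < 0 := by rw [hb]; exact neg_neg_of_pos (by positivity)
  have hb1 : -l ^ 2 * k < b := by rw [hb]; nlinarith [mul_pos hS0 hk0]
  have e1 : l ^ 2 * (2 * k ^ 2 * (1 - T) ^ 2 * (2 + T) + (1 - k * T) ^ 2 * (2 + k * T)) =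
      2 * (1 - (k * T) ^ 3) := by
    have h1 : 0 < 1 - k * T := by nlinarith
    have h2 : 0 < 2 * k * (1 - T) ^ 2 + (1 - k * T) ^ 2 := by positivity
    refine mul_left_cancel₀ h2.ne' ?_
    simp only [gonQuartic] at h
    linear_combination (2 * k ^ 2 * (1 - T) ^ 2 * (2 + T) + (1 - k * T) ^ 2 * (2 + k * T)) * hS -
      (1 - k * T) * k * h
  subst hk
  refine ⟨hc, hc8, hk0, hl, hb0, hb1, ?_, ?_, ?_⟩
  all_goals
    generalize Real.cos (2 * Real.pi / c) = k at *
    generalize Real.sin (2 * Real.pi / c) = s at *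
    generalize l ^ 2 = S at *
    subst hb
  · have h1 : 2 * k * edgeU (S * k) (-(k * T * S)) + vertexS S (-(k * T * S)) =
        S * (2 * k ^ 2 * (1 - T) ^ 2 * (2 + T) + (1 - k * T) ^ 2 * (2 + k * T)) -
          2 * (1 - (k * T) ^ 3) := by
      simp only [edgeU, vertexS]; field_simp; ring
    rw [h1, e1, sub_self]
  · have h1 : 2 * edgeB (S * k) (-(k * T * S)) + vertexB S (-(k * T * S)) =
        3 * (S * (2 * k * (1 - T) ^ 2 + (1 - k * T) ^ 2) - (1 - (k * T) ^ 2)) := by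
      simp only [edgeB, vertexB]; field_simp; ring
    rw [h1, hS, sub_self, mul_zero]
  · rw [GonPosDef] at hpd
    convert hpd using 1
    · simp only [edgeUU]; field_simp; ring
    · simp only [edgeU]; field_simp; ring
    · simp only [edgeUB]; field_simp
    · simp only [edgeBB, vertexBB]; field_simp; ring
    · simp only [vertexSS]; field_simp; ring
    · simp only [vertexSB]; field_simp; ring

theorem exists_gonQuartic_root {k T₀ T₁ : ℝ} (hT : T₀ ≤ T₁) (h₀ : 0 < gonQuartic k T₀)
    (h₁ : gonQuartic k T₁ < 0) : ∃ T, T₀ ≤ T ∧ T ≤ T₁ ∧ gonQuartic k T = 0 := by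
  have hcont : Continuous (gonQuartic k) := by unfold gonQuartic; fun_prop
  obtain ⟨T, hT, h⟩ := intermediate_value_Icc' hT hcont.continuousOn ⟨h₁.le, h₀.le⟩
  exact ⟨T, hT.1, hT.2, h⟩

/-- Existence and uniqueness of a critical regular polygon near `(l₀, b₀)`, from enclosures
`[k₀, k₁]` of `cos (2π / c)`, `[T₀, T₁]` of the root of the quartic and `[S₀, S₁]` of `l²`. -/
theorem exists_gon_minimum {c : ℕ} [NeZero c] {k₀ k₁ T₀ T₁ S₀ S₁ l₀ b₀ δ : ℝ}
    (hc : 2 < c) (hc8 : c ≤ 8)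
    (hk₀ : k₀ ≤ Real.cos (2 * Real.pi / c)) (hk₁ : Real.cos (2 * Real.pi / c) ≤ k₁)
    (hk₀pos : 0 < k₀) (hk₁le : k₁ ≤ 3 / 4) (hT₀ : 0 < T₀) (hT : T₀ ≤ T₁) (hT₁ : T₁ < 1)
    (h₀ : ∀ k, k₀ ≤ k → k ≤ k₁ → 0 < gonQuartic k T₀)
    (h₁ : ∀ k, k₀ ≤ k → k ≤ k₁ → gonQuartic k T₁ < 0)
    (hS₀ : 0 < S₀)
    (hS₀le : S₀ * (2 * k₁ * (1 - T₀) ^ 2 + (1 - k₀ * T₀) ^ 2) ≤ 1 - (k₁ * T₁) ^ 2)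
    (hS₁ge : 1 - (k₀ * T₀) ^ 2 ≤ S₁ * (2 * k₀ * (1 - T₁) ^ 2 + (1 - k₁ * T₁) ^ 2))
    (hδ : 0 < δ) (hl : 0 < l₀ - δ) (hlS₀ : (l₀ - δ) ^ 2 < S₀) (hlS₁ : S₁ < (l₀ + δ) ^ 2)
    (hb₀ : k₁ * T₁ * S₁ < -b₀ + δ) (hb₁ : -b₀ - δ < k₀ * T₀ * S₀)
    (hpd : ∀ k s T S, k₀ ≤ k → k ≤ k₁ → s ^ 2 = 1 - k ^ 2 → T₀ ≤ T → T ≤ T₁ → S₀ ≤ S → S ≤ S₁ →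
      GonPosDef k s S T) :
    ∃ l b : ℝ, |l - l₀| < δ ∧ |b - b₀| < δ ∧ StableGon c l b ∧
      ∀ l' b' φ : ℝ, 0 < l' → b' ≤ 0 → -l' ^ 2 * Real.cos (2 * Real.pi / c) ≤ b' →
        IsCriticalPoint potential (regularGon c l' b' φ) → l' = l ∧ b' = b := by
  obtain ⟨k, hk⟩ : ∃ k, k = Real.cos (2 * Real.pi / c) := ⟨_, rfl⟩
  rw [← hk] at hk₀ hk₁
  have hk0 : 0 < k := by linarith
  have hk1 : k < 1 := by linarith
  obtain ⟨T, hTge, hTle, hroot⟩ := exists_gonQuartic_root hT (h₀ k hk₀ hk₁) (h₁ k hk₀ hk₁)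
  have hT0 : 0 < T := by linarith
  have hT1 : T < 1 := by linarith
  have hkT : k * T < 1 := by nlinarith
  obtain ⟨D, hD⟩ : ∃ D, D = 2 * k * (1 - T) ^ 2 + (1 - k * T) ^ 2 := ⟨_, rfl⟩
  have hD0 : 0 < D := by
    have : 0 < 1 - k * T := by linarith
    rw [hD]; positivity
  have ht0 : k₀ * T₀ ≤ k * T := mul_le_mul hk₀ hTge hT₀.le hk0.le
  have ht1 : k * T ≤ k₁ * T₁ := mul_le_mul hk₁ hTle hT0.le (by linarith)
  have ht1' : k₁ * T₁ < 1 := by nlinarith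
  have ht0' : 0 < k₀ * T₀ := by positivity
  have hDle : D ≤ 2 * k₁ * (1 - T₀) ^ 2 + (1 - k₀ * T₀) ^ 2 := by
    rw [hD]
    have a1 := pow_le_pow_left₀ (by linarith) (show 1 - T ≤ 1 - T₀ by linarith) 2
    have a2 := pow_le_pow_left₀ (by linarith) (show 1 - k * T ≤ 1 - k₀ * T₀ by linarith) 2
    have a3 := mul_le_mul hk₁ a1 (sq_nonneg _) (by linarith)
    linarith
  have hDge : 2 * k₀ * (1 - T₁) ^ 2 + (1 - k₁ * T₁) ^ 2 ≤ D := by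
    rw [hD]
    have a1 := pow_le_pow_left₀ (by linarith) (show 1 - T₁ ≤ 1 - T by linarith) 2
    have a2 := pow_le_pow_left₀ (by linarith) (show 1 - k₁ * T₁ ≤ 1 - k * T by linarith) 2
    have a3 := mul_le_mul hk₀ a1 (sq_nonneg _) (by linarith)
    linarith
  obtain ⟨S, hS⟩ : ∃ S, S = (1 - (k * T) ^ 2) / D := ⟨_, rfl⟩
  have hSD : S * D = 1 - (k * T) ^ 2 := by rw [hS]; field_simp
  have hsq0 : (k₀ * T₀) ^ 2 ≤ (k * T) ^ 2 := pow_le_pow_left₀ ht0'.le ht0 2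
  have hsq1 : (k * T) ^ 2 ≤ (k₁ * T₁) ^ 2 := pow_le_pow_left₀ (by linarith) ht1 2
  have hSge : S₀ ≤ S := by
    refine le_of_mul_le_mul_right ?_ hD0
    have := mul_le_mul_of_nonneg_left hDle hS₀.le
    linarith
  have hS0 : 0 < S := by linarith
  have hSle : S ≤ S₁ := by
    have hDpos : 0 < 2 * k₀ * (1 - T₁) ^ 2 + (1 - k₁ * T₁) ^ 2 := by
      have : 0 < 1 - k₁ * T₁ := by linarith
      positivity
    refine le_of_mul_le_mul_right ?_ hDpos
    have := mul_le_mul_of_nonneg_left hDge hS0.le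
    linarith
  have hl2 : √S ^ 2 = S := Real.sq_sqrt hS0.le
  have hlpos : 0 < √S := Real.sqrt_pos.2 hS0
  have hstable : StableGon c (√S) (-(k * T * √S ^ 2)) := by
    refine .of_gonQuartic_eq_zero hc hc8 hk hk0 hk1 hlpos hT0 hT1 rfl hroot ?_ ?_
    · rw [hl2, ← hD, hSD]
    · rw [hl2]
      refine hpd k _ T S hk₀ hk₁ ?_ hTge hTle hSge hSle
      rw [hk, Real.sin_sq]
  refine ⟨√S, -(k * T * √S ^ 2), ?_, ?_, hstable, ?_⟩
  · rw [abs_lt]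
    constructor
    · have := Real.lt_sqrt_of_sq_lt (hlS₀.trans_le hSge)
      linarith
    · have := (Real.sqrt_lt' (show 0 < l₀ + δ by linarith)).2 (hSle.trans_lt hlS₁)
      linarith
  · rw [hl2, abs_lt]
    have a1 := mul_le_mul ht0 hSge hS₀.le (by linarith)
    have a2 := mul_le_mul ht1 hSle hS0.le (by linarith)
    constructor <;> linarith
  · intro l' b' φ hl' hb' hlb' hcrit
    rw [← hk] at hlb'
    obtain ⟨T', hT'0, hT'1, hb'T, hroot', hS'⟩ :=
      gonQuartic_eq_zero_of_isCriticalPoint hc hc8 hk hk0 hk1 hl' hb' hlb' hcrit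
    have hTT : T' = T := le_antisymm
      (gonQuartic_root_le hk0 (by linarith) hT'1 hroot hroot')
      (gonQuartic_root_le hk0 (by linarith) hT1.le hroot' hroot)
    subst hTT
    have hSS : l' ^ 2 = S := by
      rw [← hD, ← hSD] at hS'
      exact mul_right_cancel₀ hD0.ne' hS'
    have hll : l' = √S := by rw [← hSS, Real.sqrt_sq hl'.le]
    exact ⟨hll, by rw [hb'T, ← hll]⟩

/-! ### Interval arithmetic for the second variation -/

/-- Interval arithmetic for the conditions of `EdgeFormPosDef`: the entries are enclosed in
positive intervals (`σ` encloses `s²`), `a` encloses the coefficient of the angle, and `M`, `B`,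
`N` bound the coefficients of the binary form that remains when the angle is eliminated. -/
theorem EdgeFormPosDef.of_bounds {k s α γ μ ρ P Q k₀ k₁ σ₀ σ₁ α₀ α₁ γ₀ γ₁ μ₀ μ₁ ρ₀ P₀ Q₀ Q₁
      a₀ a₁ M B N : ℝ}
    (hk₀ : k₀ ≤ k) (hk₁ : k ≤ k₁) (hσ₀ : σ₀ ≤ s ^ 2) (hσ₁ : s ^ 2 ≤ σ₁) (hα₀ : α₀ ≤ α)
    (hα₁ : α ≤ α₁) (hγ₀ : γ₀ ≤ γ) (hγ₁ : γ ≤ γ₁) (hμ₀ : μ₀ ≤ μ) (hμ₁ : μ ≤ μ₁) (hρ₀ : ρ₀ ≤ ρ)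
    (hP₀ : P₀ ≤ P) (hQ₀ : Q₀ ≤ Q) (hQ₁ : Q ≤ Q₁)
    (pk : 0 < k₀) (pσ : 0 < σ₀) (pα : 0 < α₀) (pγ : 0 < γ₀) (pμ : 0 < μ₀) (pρ : 0 < ρ₀)
    (pP : 0 < P₀) (pQ : 0 < Q₀) (pa : 0 < a₀) (pM : 0 < M) (pN : 0 < N)
    (ha₀ : a₀ ≤ 2 * α₀ * σ₀ - 2 * γ₁ * k₁) (ha₁ : 2 * α₁ * σ₁ - 2 * γ₀ * k₀ ≤ a₁)
    (hM : M ≤ a₀ * (2 * α₀ * k₀ ^ 2 + P₀) - 4 * σ₁ * (α₁ * k₁ + γ₁) ^ 2)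
    (hB₁ : a₁ * (2 * μ₁ * k₁ + Q₁) - 4 * σ₀ * (α₀ * k₀ + γ₀) * μ₀ ≤ B)
    (hB₀ : -B ≤ a₀ * (2 * μ₀ * k₀ + Q₀) - 4 * σ₁ * (α₁ * k₁ + γ₁) * μ₁)
    (hN : N ≤ a₀ * ρ₀ - σ₁ * μ₁ ^ 2) (hdet : B ^ 2 < 4 * M * N)
    (hodd : 0 < P₀ - 2 * k₁ * γ₁) (hoddDet : Q₁ ^ 2 < 4 * (P₀ - 2 * k₁ * γ₁) * ρ₀) :
    EdgeFormPosDef k s α γ μ ρ P Q := by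
  have qk : 0 < k := by linarith
  have qα : 0 < α := by linarith
  have qγ : 0 < γ := by linarith
  have qμ : 0 < μ := by linarith
  have qρ : 0 < ρ := by linarith
  have qQ : 0 < Q := by linarith
  generalize hσ : s ^ 2 = σ at *
  have qσ : 0 < σ := by linarith
  obtain ⟨a, ha⟩ : ∃ a, a = 2 * α * σ - 2 * γ * k := ⟨_, rfl⟩
  obtain ⟨β, hβ⟩ : ∃ β, β = α * k + γ := ⟨_, rfl⟩
  obtain ⟨β₀, hβ₀⟩ : ∃ β, β = α₀ * k₀ + γ₀ := ⟨_, rfl⟩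
  obtain ⟨β₁, hβ₁⟩ : ∃ β, β = α₁ * k₁ + γ₁ := ⟨_, rfl⟩
  rw [← hβ₀] at hB₁
  rw [← hβ₁] at hB₀ hM
  have b0 : β₀ ≤ β := by
    have := mul_le_mul hα₀ hk₀ pk.le qα.le
    linarith
  have b1 : β ≤ β₁ := by
    have := mul_le_mul hα₁ hk₁ qk.le (by linarith)
    linarith
  have pβ₀ : 0 < β₀ := by rw [hβ₀]; positivity
  have a0 : a₀ ≤ a := by
    have h1 := mul_le_mul hα₀ hσ₀ pσ.le qα.le
    have h2 := mul_le_mul hγ₁ hk₁ qk.le (by linarith)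
    linarith
  have a1 : a ≤ a₁ := by
    have h1 := mul_le_mul hα₁ hσ₁ qσ.le (by linarith)
    have h2 := mul_le_mul hγ₀ hk₀ pk.le qγ.le
    linarith
  have qa : 0 < a := by linarith
  have qa₁ : 0 < a₁ := by linarith
  have qβ : 0 < β := by linarith
  have qβ₁ : 0 < β₁ := by linarith
  have qσ₁ : 0 < σ₁ := by linarith
  have qk₁ : 0 < k₁ := by linarith
  have qμ₁ : 0 < μ₁ := by linarith
  have m11 : M ≤ a * (2 * α * k ^ 2 + P) - 4 * σ * β ^ 2 := by
    have h1 : 2 * α₀ * k₀ ^ 2 + P₀ ≤ 2 * α * k ^ 2 + P := by gcongr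
    have h2 : a₀ * (2 * α₀ * k₀ ^ 2 + P₀) ≤ a * (2 * α * k ^ 2 + P) := by gcongr
    have h3 : 4 * σ * β ^ 2 ≤ 4 * σ₁ * β₁ ^ 2 := by gcongr
    linarith
  have m12 : a * (2 * μ * k + Q) - 4 * σ * β * μ ≤ B := by
    have h2 : a * (2 * μ * k + Q) ≤ a₁ * (2 * μ₁ * k₁ + Q₁) := by gcongr
    have h3 : 4 * σ₀ * β₀ * μ₀ ≤ 4 * σ * β * μ := by gcongr
    linarith
  have m12' : -B ≤ a * (2 * μ * k + Q) - 4 * σ * β * μ := by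
    have h2 : a₀ * (2 * μ₀ * k₀ + Q₀) ≤ a * (2 * μ * k + Q) := by gcongr
    have h3 : 4 * σ * β * μ ≤ 4 * σ₁ * β₁ * μ₁ := by gcongr
    linarith
  have m22 : N ≤ a * ρ - σ * μ ^ 2 := by
    have h2 : a₀ * ρ₀ ≤ a * ρ := by gcongr
    have h3 : σ * μ ^ 2 ≤ σ₁ * μ₁ ^ 2 := by gcongr
    linarith
  have o1 : P₀ - 2 * k₁ * γ₁ ≤ P - 2 * k * γ := by
    have h3 : 2 * k * γ ≤ 2 * k₁ * γ₁ := by gcongr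
    linarith
  constructor
  · rw [hσ, ← ha]; linarith
  · rw [hσ, ← ha, ← hβ]; linarith
  · rw [hσ, ← ha, ← hβ]
    have h1 := sq_le_sq' m12' m12
    have q11 : 0 ≤ a * (2 * α * k ^ 2 + P) - 4 * σ * β ^ 2 := by linarith
    have h2 : 4 * M * N ≤ 4 * (a * (2 * α * k ^ 2 + P) - 4 * σ * β ^ 2) * (a * ρ - σ * μ ^ 2) := by
      gcongr
    linarith
  · linarith
  · have h1 : Q ^ 2 ≤ Q₁ ^ 2 := by gcongr
    have q1 : 0 ≤ P - 2 * k * γ := by linarith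
    have h2 : 4 * (P₀ - 2 * k₁ * γ₁) * ρ₀ ≤ 4 * (P - 2 * k * γ) * ρ := by gcongr
    linarith

/-- Enclosures of the entries of the second variation over a box of parameters `k`, `T`, `S⁻¹`,
in a form suitable for verification with decimal fractions. -/
theorem GonPosDef.of_bounds {k s S T k₀ k₁ T₀ T₁ t₀ t₁ S₀ S₁ w₀ w₁ σ₀ σ₁ α₀ α₁ γ₀ γ₁ μ₀ μ₁
      ρ₀ P₀ Q₀ Q₁ a₀ a₁ M B N : ℝ}
    (hs : s ^ 2 = 1 - k ^ 2) (hk₀ : k₀ ≤ k) (hk₁ : k ≤ k₁) (hT₀ : T₀ ≤ T) (hT₁ : T ≤ T₁)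
    (hS₀ : S₀ ≤ S) (hS₁ : S ≤ S₁)
    (pk : 0 < k₀) (pT : 0 < T₀) (qT : T₁ ≤ 1) (pS : 0 < S₀) (pt : 0 < t₀) (pw : 0 < w₀)
    (hw₀ : w₀ * S₁ ≤ 1) (hw₁ : 1 ≤ w₁ * S₀) (ht₀ : t₀ ≤ k₀ * T₀) (ht₁ : k₁ * T₁ ≤ t₁)
    (hσ₀ : σ₀ ≤ 1 - k₁ ^ 2) (hσ₁ : 1 - k₀ ^ 2 ≤ σ₁)
    (hα₀ : α₀ ≤ 2 - 2 * T₁ ^ 3) (hα₁ : 2 - 2 * T₀ ^ 3 ≤ α₁)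
    (hγ₀ : γ₀ ≤ k₀ * (1 - T₁) ^ 2 * (2 + T₀)) (hγ₁ : k₁ * (1 - T₀) ^ 2 * (2 + T₁) ≤ γ₁)
    (hμ₀ : μ₀ ≤ 3 - 3 * T₁ ^ 2) (hμ₁ : 3 - 3 * T₀ ^ 2 ≤ μ₁)
    (hρ₀ : ρ₀ ≤ (6 - 6 * T₁) / 2 + (6 - 6 * t₁ - 6 * t₁ * w₁) / 4)
    (hP₀ : P₀ ≤ 2 - 2 * t₁ ^ 3 - 6 * t₁ ^ 3 * w₁)
    (hQ₀ : Q₀ ≤ 3 - 3 * t₁ ^ 2 - 6 * t₁ ^ 2 * w₁) (hQ₁ : 3 - 3 * t₀ ^ 2 - 6 * t₀ ^ 2 * w₀ ≤ Q₁)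
    (pσ : 0 < σ₀) (pα : 0 < α₀) (pγ : 0 < γ₀) (pμ : 0 < μ₀) (pρ : 0 < ρ₀)
    (pP : 0 < P₀) (pQ : 0 < Q₀) (pa : 0 < a₀) (pM : 0 < M) (pN : 0 < N)
    (ha₀ : a₀ ≤ 2 * α₀ * σ₀ - 2 * γ₁ * k₁) (ha₁ : 2 * α₁ * σ₁ - 2 * γ₀ * k₀ ≤ a₁)
    (hM : M ≤ a₀ * (2 * α₀ * k₀ ^ 2 + P₀) - 4 * σ₁ * (α₁ * k₁ + γ₁) ^ 2)
    (hB₁ : a₁ * (2 * μ₁ * k₁ + Q₁) - 4 * σ₀ * (α₀ * k₀ + γ₀) * μ₀ ≤ B)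
    (hB₀ : -B ≤ a₀ * (2 * μ₀ * k₀ + Q₀) - 4 * σ₁ * (α₁ * k₁ + γ₁) * μ₁)
    (hN : N ≤ a₀ * ρ₀ - σ₁ * μ₁ ^ 2) (hdet : B ^ 2 < 4 * M * N)
    (hodd : 0 < P₀ - 2 * k₁ * γ₁) (hoddDet : Q₁ ^ 2 < 4 * (P₀ - 2 * k₁ * γ₁) * ρ₀) :
    GonPosDef k s S T := by
  have qk : 0 < k := by linarith
  have qT0 : 0 < T := by linarith
  have qk₁ : 0 < k₁ := by linarith
  have qT1 : 0 ≤ 1 - T₁ := by linarith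
  have qS : 0 < S := by linarith
  have w0 : w₀ ≤ S⁻¹ := by
    rw [le_inv_comm₀ pw qS, inv_eq_one_div, le_div_iff₀ pw]
    have := mul_le_mul_of_nonneg_left hS₁ pw.le
    linarith only [this, hw₀]
  have w1 : S⁻¹ ≤ w₁ := by
    have pw₁ : 0 < w₁ := pos_of_mul_pos_left (by linarith only [hw₁]) pS.le
    rw [inv_le_comm₀ qS pw₁, inv_eq_one_div, div_le_iff₀ pw₁]
    have := mul_le_mul_of_nonneg_left hS₀ pw₁.le
    linarith only [this, hw₁]
  have t0 : t₀ ≤ k * T := ht₀.trans (by gcongr)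
  have t1 : k * T ≤ t₁ := le_trans (by gcongr) ht₁
  have hk2₀ : k₀ ^ 2 ≤ k ^ 2 := by gcongr
  have hk2₁ : k ^ 2 ≤ k₁ ^ 2 := by gcongr
  have hT2₀ : T₀ ^ 2 ≤ T ^ 2 := by gcongr
  have hT2₁ : T ^ 2 ≤ T₁ ^ 2 := by gcongr
  have hT3₀ : T₀ ^ 3 ≤ T ^ 3 := by gcongr
  have hT3₁ : T ^ 3 ≤ T₁ ^ 3 := by gcongr
  rw [GonPosDef]
  generalize S⁻¹ = w at *
  have qw : 0 < w := by linarith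
  have g0 : k₀ * (1 - T₁) ^ 2 * (2 + T₀) ≤ k * (1 - T) ^ 2 * (2 + T) := by gcongr
  have g1 : k * (1 - T) ^ 2 * (2 + T) ≤ k₁ * (1 - T₀) ^ 2 * (2 + T₁) := by
    have : 0 ≤ 1 - T := by linarith
    gcongr
  generalize k * T = t at *
  have qt : 0 < t := by linarith
  have qt1 : 0 < t₁ := by linarith
  have u1 : t * w ≤ t₁ * w₁ := by gcongr
  have u2 : t ^ 2 * w ≤ t₁ ^ 2 * w₁ := by gcongr
  have u2' : t₀ ^ 2 * w₀ ≤ t ^ 2 * w := by gcongr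
  have u3 : t ^ 3 * w ≤ t₁ ^ 3 * w₁ := by gcongr
  have v2 : t ^ 2 ≤ t₁ ^ 2 := by gcongr
  have v2' : t₀ ^ 2 ≤ t ^ 2 := by gcongr
  have v3 : t ^ 3 ≤ t₁ ^ 3 := by gcongr
  refine EdgeFormPosDef.of_bounds hk₀ hk₁ ?_ ?_ ?_ ?_ (hγ₀.trans g0) (g1.trans hγ₁)
    ?_ ?_ ?_ ?_ ?_ ?_ pk pσ pα pγ pμ pρ pP pQ pa pM pN ha₀ ha₁ hM hB₁ hB₀ hN hdet
    hodd hoddDet <;> linarith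

/-! ### The four polygons -/

theorem gonQuartic_bounds {k k₀ k₁ T : ℝ} (pk : 0 ≤ k₀) (h₀ : k₀ ≤ k) (h₁ : k ≤ k₁)
    (h : 0 ≤ 2 * T ^ 3 - 5 * T ^ 2 + 10 * T - 4)
    (h' : 0 ≤ 4 * T - 10 * T ^ 2 + 11 * T ^ 3 - 2 * T ^ 4) :
    4 - 9 * T + 4 * T ^ 2 + (2 * T ^ 3 - 5 * T ^ 2 + 10 * T - 4) * k₀ -
        (4 * T - 10 * T ^ 2 + 11 * T ^ 3 - 2 * T ^ 4) * k₁ ^ 2 + T ^ 4 * k₀ ^ 3 ≤ gonQuartic k T ∧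
      gonQuartic k T ≤ 4 - 9 * T + 4 * T ^ 2 + (2 * T ^ 3 - 5 * T ^ 2 + 10 * T - 4) * k₁ -
        (4 * T - 10 * T ^ 2 + 11 * T ^ 3 - 2 * T ^ 4) * k₀ ^ 2 + T ^ 4 * k₁ ^ 3 := by
  have pk' : 0 ≤ k := pk.trans h₀
  have key : gonQuartic k T = 4 - 9 * T + 4 * T ^ 2 + (2 * T ^ 3 - 5 * T ^ 2 + 10 * T - 4) * k -
      (4 * T - 10 * T ^ 2 + 11 * T ^ 3 - 2 * T ^ 4) * k ^ 2 + T ^ 4 * k ^ 3 := by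
    rw [gonQuartic]; ring
  rw [key]
  constructor <;> gcongr

theorem cos_pentagon_bounds : 0.309016994374 ≤ Real.cos (2 * Real.pi / (5 : ℕ)) ∧
    Real.cos (2 * Real.pi / (5 : ℕ)) ≤ 0.309016994375 := by
  have h1 : Real.cos (2 * Real.pi / (5 : ℕ)) = (√5 - 1) / 4 := by
    have h2 : 2 * Real.pi / (5 : ℕ) = 2 * (Real.pi / 5) := by push_cast; ring
    rw [h2, Real.cos_two_mul, Real.cos_pi_div_five]
    have h3 := Real.sq_sqrt (show (0 : ℝ) ≤ 5 by norm_num)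
    linear_combination h3 / 8
  have h4 : (2.236067977496 : ℝ) ≤ √5 := Real.le_sqrt_of_sq_le (by norm_num)
  have h5 : √5 ≤ 2.2360679775 := Real.sqrt_le_iff.2 ⟨by norm_num, by norm_num⟩
  rw [h1]
  constructor <;> linarith

theorem cos_hexagon_bounds : 0.5 ≤ Real.cos (2 * Real.pi / (6 : ℕ)) ∧
    Real.cos (2 * Real.pi / (6 : ℕ)) ≤ 0.5 := by
  have h1 : Real.cos (2 * Real.pi / (6 : ℕ)) = 1 / 2 := by
    rw [← Real.cos_pi_div_three]; congr 1; push_cast; ring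
  rw [h1]
  norm_num

/-- `cos (2π / 7)` is the root above `1 / 2` of the cubic `8 x³ + 4 x² - 4 x - 1`, which follows
from `cos 4θ = cos 3θ` for `θ = 2π / 7`. -/
theorem cos_heptagon_bounds : 0.623489801858 ≤ Real.cos (2 * Real.pi / (7 : ℕ)) ∧
    Real.cos (2 * Real.pi / (7 : ℕ)) ≤ 0.623489801859 := by
  have hpi := Real.pi_pos
  obtain ⟨θ, hθ⟩ : ∃ θ, θ = 2 * Real.pi / (7 : ℕ) := ⟨_, rfl⟩
  have hθ' : 7 * θ = 2 * Real.pi := by rw [hθ]; push_cast; ring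
  rw [← hθ]
  have h0 : 1 / 2 ≤ Real.cos θ := by
    rw [← Real.cos_pi_div_three]
    exact Real.cos_le_cos_of_nonneg_of_le_pi (by linarith) (by linarith) (by linarith)
  have h1 : Real.cos θ < 1 := by
    rw [← Real.cos_zero]
    exact Real.cos_lt_cos_of_nonneg_of_le_pi le_rfl (by linarith) (by linarith)
  have h2 : Real.cos (2 * (2 * θ)) = Real.cos (3 * θ) := by
    rw [← Real.cos_two_pi_sub]; congr 1; linarith
  rw [Real.cos_two_mul, Real.cos_two_mul, Real.cos_three_mul] at h2
  generalize Real.cos θ = x at *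
  have h3 : (1 - x) * (8 * x ^ 3 + 4 * x ^ 2 - 4 * x - 1) = 0 := by linear_combination -h2
  have h4 := (mul_eq_zero.1 h3).resolve_left (by linarith)
  constructor <;> by_contra! h5
  · nlinarith [mul_pos (sub_pos.2 h5) (show (0 : ℝ) < x by linarith), sq_nonneg (x - 1 / 2)]
  · nlinarith [mul_pos (sub_pos.2 h5) (show (0 : ℝ) < x by linarith), sq_nonneg (x - 1 / 2)]

theorem cos_octagon_bounds : 0.707106781186 ≤ Real.cos (2 * Real.pi / (8 : ℕ)) ∧
    Real.cos (2 * Real.pi / (8 : ℕ)) ≤ 0.707106781187 := by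
  have h1 : Real.cos (2 * Real.pi / (8 : ℕ)) = √2 / 2 := by
    rw [← Real.cos_pi_div_four]; congr 1; push_cast; ring
  have h4 : (1.414213562373 : ℝ) ≤ √2 := Real.le_sqrt_of_sq_le (by norm_num)
  have h5 : √2 ≤ 1.414213562374 := Real.sqrt_le_iff.2 ⟨by norm_num, by norm_num⟩
  rw [h1]
  constructor <;> linarith

/-- The enclosures are rounded decimal values: `T₀`, `T₁` bracket the root of the quartic for
`k = cos (2π / 5)` closely enough to locate `l` and `b`, and the coarser bounds passed to
`GonPosDef.of_bounds` result from interval arithmetic. -/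
theorem exists_pentagon_minimum :
    ∃ l b : ℝ, |l - 1.17046| < 0.000005 ∧ |b - -0.28230| < 0.000005 ∧
    StableGon 5 l b ∧ ∀ l' b' φ : ℝ, 0 < l' → b' ≤ 0 →
      -l' ^ 2 * Real.cos (2 * Real.pi / (5 : ℕ)) ≤ b' →
      IsCriticalPoint potential (regularGon 5 l' b' φ) → l' = l ∧ b' = b := by
  obtain ⟨hk₀, hk₁⟩ := cos_pentagon_bounds
  refine exists_gon_minimum (k₀ := 0.309016994374) (k₁ := 0.309016994375)
    (T₀ := 0.666824348) (T₁ := 0.666824349) (S₀ := 1.369975765) (S₁ := 1.369975768)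
    (by norm_num) (by norm_num) hk₀ hk₁ (by norm_num) (by norm_num)
    (by norm_num) (by norm_num) (by norm_num)
    (fun k h h' => lt_of_lt_of_le (by norm_num) (gonQuartic_bounds (by norm_num) h h'
      (by norm_num) (by norm_num)).1)
    (fun k h h' => lt_of_le_of_lt (gonQuartic_bounds (by norm_num) h h'
      (by norm_num) (by norm_num)).2 (by norm_num))
    (by norm_num) (by norm_num) (by norm_num) (by norm_num)
    (by norm_num) (by norm_num) (by norm_num) (by norm_num) (by norm_num)
    fun k s T S h h' hs hT hT' hS hS' => ?_
  refine GonPosDef.of_bounds (k₀ := 0.30901) (k₁ := 0.30902) (T₀ := 0.66682) (T₁ := 0.66683)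
    (t₀ := 0.20605) (t₁ := 0.20607) (S₀ := 1.36997) (S₁ := 1.36998) (w₀ := 0.72993)
    (w₁ := 0.72995) (σ₀ := 0.90450) (σ₁ := 0.90452) (α₀ := 1.40697) (α₁ := 1.40700)
    (γ₀ := 0.09147) (γ₁ := 0.09149) (μ₀ := 1.66601) (μ₁ := 1.66606) (ρ₀ := 1.96477)
    (P₀ := 1.94417) (Q₀ := 2.68662) (Q₁ := 2.68669) (a₀ := 2.48866) (a₁ := 2.48879) (M := 4.50496)
    (B := 6.07733) (N := 2.37891)
    hs (le_trans (by norm_num) h) (h'.trans (by norm_num)) (le_trans (by norm_num) hT)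
    (hT'.trans (by norm_num)) (le_trans (by norm_num) hS) (hS'.trans (by norm_num))
    ?_ ?_ ?_ ?_ ?_ ?_ ?_ ?_ ?_ ?_ ?_ ?_ ?_ ?_ ?_ ?_ ?_ ?_ ?_ ?_ ?_ ?_ ?_ ?_ ?_ ?_ ?_ ?_ ?_ ?_ ?_
    ?_ ?_ ?_ ?_ ?_ ?_ ?_ ?_ ?_ ?_ <;> norm_num1

/-- For the hexagon both parameters are within `5 · 10⁻⁶` of the given decimals by a narrow margin,
about `1.3 · 10⁻⁷` for `b`, and the root is therefore bracketed more closely. -/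
theorem exists_hexagon_minimum :
    ∃ l b : ℝ, |l - 1.32053| < 0.000005 ∧ |b - -0.61814| < 0.000005 ∧
    StableGon 6 l b ∧ ∀ l' b' φ : ℝ, 0 < l' → b' ≤ 0 →
      -l' ^ 2 * Real.cos (2 * Real.pi / (6 : ℕ)) ≤ b' →
      IsCriticalPoint potential (regularGon 6 l' b' φ) → l' = l ∧ b' = b := by
  obtain ⟨hk₀, hk₁⟩ := cos_hexagon_bounds
  refine exists_gon_minimum (k₀ := 0.5) (k₁ := 0.5)
    (T₀ := 0.7089560167) (T₁ := 0.7089560168) (S₀ := 1.7437897900) (S₁ := 1.7437897906)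
    (by norm_num) (by norm_num) hk₀ hk₁ (by norm_num) (by norm_num)
    (by norm_num) (by norm_num) (by norm_num)
    (fun k h h' => lt_of_lt_of_le (by norm_num) (gonQuartic_bounds (by norm_num) h h'
      (by norm_num) (by norm_num)).1)
    (fun k h h' => lt_of_le_of_lt (gonQuartic_bounds (by norm_num) h h'
      (by norm_num) (by norm_num)).2 (by norm_num))
    (by norm_num) (by norm_num) (by norm_num) (by norm_num)
    (by norm_num) (by norm_num) (by norm_num) (by norm_num) (by norm_num)
    fun k s T S h h' hs hT hT' hS hS' => ?_
  refine GonPosDef.of_bounds (k₀ := 0.5) (k₁ := 0.5) (T₀ := 0.70895) (T₁ := 0.70896)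
    (t₀ := 0.35447) (t₁ := 0.35448) (S₀ := 1.74378) (S₁ := 1.74379) (w₀ := 0.57346)
    (w₁ := 0.57347) (σ₀ := 0.75000) (σ₁ := 0.75000) (α₀ := 1.28731) (α₁ := 1.28735)
    (γ₀ := 0.11472) (γ₁ := 0.11474) (μ₀ := 1.49212) (μ₁ := 1.49217) (ρ₀ := 1.53647)
    (P₀ := 1.75765) (Q₀ := 2.19067) (Q₁ := 2.19073) (a₀ := 1.81622) (a₁ := 1.81631) (M := 2.63571)
    (B := 3.29453) (N := 1.12063)
    hs (le_trans (by norm_num) h) (h'.trans (by norm_num)) (le_trans (by norm_num) hT)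
    (hT'.trans (by norm_num)) (le_trans (by norm_num) hS) (hS'.trans (by norm_num))
    ?_ ?_ ?_ ?_ ?_ ?_ ?_ ?_ ?_ ?_ ?_ ?_ ?_ ?_ ?_ ?_ ?_ ?_ ?_ ?_ ?_ ?_ ?_ ?_ ?_ ?_ ?_ ?_ ?_ ?_ ?_
    ?_ ?_ ?_ ?_ ?_ ?_ ?_ ?_ ?_ ?_ <;> norm_num1

theorem exists_heptagon_minimum :
    ∃ l b : ℝ, |l - 1.44839| < 0.000005 ∧ |b - -0.96691| < 0.000005 ∧
    StableGon 7 l b ∧ ∀ l' b' φ : ℝ, 0 < l' → b' ≤ 0 →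
      -l' ^ 2 * Real.cos (2 * Real.pi / (7 : ℕ)) ≤ b' →
      IsCriticalPoint potential (regularGon 7 l' b' φ) → l' = l ∧ b' = b := by
  obtain ⟨hk₀, hk₁⟩ := cos_heptagon_bounds
  refine exists_gon_minimum (k₀ := 0.623489801858) (k₁ := 0.623489801859)
    (T₀ := 0.739233719) (T₁ := 0.739233720) (S₀ := 2.097844449) (S₁ := 2.097844459)
    (by norm_num) (by norm_num) hk₀ hk₁ (by norm_num) (by norm_num)
    (by norm_num) (by norm_num) (by norm_num)
    (fun k h h' => lt_of_lt_of_le (by norm_num) (gonQuartic_bounds (by norm_num) h h'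
      (by norm_num) (by norm_num)).1)
    (fun k h h' => lt_of_le_of_lt (gonQuartic_bounds (by norm_num) h h'
      (by norm_num) (by norm_num)).2 (by norm_num))
    (by norm_num) (by norm_num) (by norm_num) (by norm_num)
    (by norm_num) (by norm_num) (by norm_num) (by norm_num) (by norm_num)
    fun k s T S h h' hs hT hT' hS hS' => ?_
  refine GonPosDef.of_bounds (k₀ := 0.62348) (k₁ := 0.62349) (T₀ := 0.73923) (T₁ := 0.73924)
    (t₀ := 0.46089) (t₁ := 0.46091) (S₀ := 2.09784) (S₁ := 2.09785) (w₀ := 0.47667)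
    (w₁ := 0.47669) (σ₀ := 0.61126) (σ₁ := 0.61128) (α₀ := 1.19204) (α₁ := 1.19208)
    (γ₀ := 0.11612) (γ₁ := 0.11614) (μ₀ := 1.36057) (μ₁ := 1.36062) (ρ₀ := 1.26134)
    (P₀ := 1.52412) (Q₀ := 1.75508) (Q₁ := 1.75522) (a₀ := 1.31246) (a₁ := 1.31260) (M := 1.41083)
    (B := 1.67225) (N := 0.52380)
    hs (le_trans (by norm_num) h) (h'.trans (by norm_num)) (le_trans (by norm_num) hT)
    (hT'.trans (by norm_num)) (le_trans (by norm_num) hS) (hS'.trans (by norm_num))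
    ?_ ?_ ?_ ?_ ?_ ?_ ?_ ?_ ?_ ?_ ?_ ?_ ?_ ?_ ?_ ?_ ?_ ?_ ?_ ?_ ?_ ?_ ?_ ?_ ?_ ?_ ?_ ?_ ?_ ?_ ?_
    ?_ ?_ ?_ ?_ ?_ ?_ ?_ ?_ ?_ ?_ <;> norm_num1

theorem exists_octagon_minimum :
    ∃ l b : ℝ, |l - 1.55045| < 0.000005 ∧ |b - -1.29119| < 0.000005 ∧
    StableGon 8 l b ∧ ∀ l' b' φ : ℝ, 0 < l' → b' ≤ 0 →
      -l' ^ 2 * Real.cos (2 * Real.pi / (8 : ℕ)) ≤ b' →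
      IsCriticalPoint potential (regularGon 8 l' b' φ) → l' = l ∧ b' = b := by
  obtain ⟨hk₀, hk₁⟩ := cos_octagon_bounds
  refine exists_gon_minimum (k₀ := 0.707106781186) (k₁ := 0.707106781187)
    (T₀ := 0.759610018) (T₁ := 0.759610019) (S₀ := 2.403894232) (S₁ := 2.403894247)
    (by norm_num) (by norm_num) hk₀ hk₁ (by norm_num) (by norm_num)
    (by norm_num) (by norm_num) (by norm_num)
    (fun k h h' => lt_of_lt_of_le (by norm_num) (gonQuartic_bounds (by norm_num) h h'
      (by norm_num) (by norm_num)).1)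
    (fun k h h' => lt_of_le_of_lt (gonQuartic_bounds (by norm_num) h h'
      (by norm_num) (by norm_num)).2 (by norm_num))
    (by norm_num) (by norm_num) (by norm_num) (by norm_num)
    (by norm_num) (by norm_num) (by norm_num) (by norm_num) (by norm_num)
    fun k s T S h h' hs hT hT' hS hS' => ?_
  refine GonPosDef.of_bounds (k₀ := 0.70710) (k₁ := 0.70711) (T₀ := 0.75961) (T₁ := 0.75962)
    (t₀ := 0.53712) (t₁ := 0.53714) (S₀ := 2.40389) (S₁ := 2.40390) (w₀ := 0.41599)
    (w₁ := 0.41600) (σ₀ := 0.49999) (σ₁ := 0.50001) (α₀ := 1.12336) (α₁ := 1.12340)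
    (γ₀ := 0.11275) (γ₁ := 0.11277) (μ₀ := 1.26893) (μ₁ := 1.26898) (ρ₀ := 1.08025)
    (P₀ := 1.30323) (Q₀ := 1.41429) (Q₁ := 1.41444) (a₀ := 0.96385) (a₁ := 0.96398) (M := 0.69301)
    (B := 0.79148) (N := 0.23602)
    hs (le_trans (by norm_num) h) (h'.trans (by norm_num)) (le_trans (by norm_num) hT)
    (hT'.trans (by norm_num)) (le_trans (by norm_num) hS) (hS'.trans (by norm_num))
    ?_ ?_ ?_ ?_ ?_ ?_ ?_ ?_ ?_ ?_ ?_ ?_ ?_ ?_ ?_ ?_ ?_ ?_ ?_ ?_ ?_ ?_ ?_ ?_ ?_ ?_ ?_ ?_ ?_ ?_ ?_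
    ?_ ?_ ?_ ?_ ?_ ?_ ?_ ?_ ?_ ?_ <;> norm_num1

end TMS

end

theorem mainTheorem3 (c : ℕ) (l₀ b₀ : ℝ)
    (hc : (c, l₀, b₀) ∈ ({(5, 1.17046, -0.28230), (6, 1.32053, -0.61814),
      (7, 1.44839, -0.96691), (8, 1.55045, -1.29119)} : Set (ℕ × ℝ × ℝ))) :
    ∃ l b : ℝ,
      |l - l₀| < 0.000005 ∧ |b - b₀| < 0.000005 ∧
      0 < l ∧ b < 0 ∧ -l ^ 2 * Real.cos (2 * Real.pi / c) < b ∧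
      (∀ φ : ℝ, TMS.IsCriticalPoint TMS.potential (TMS.regularGon c l b φ)) ∧
      (∀ l' b' φ : ℝ, 0 < l' → b' ≤ 0 → -l' ^ 2 * Real.cos (2 * Real.pi / c) ≤ b' →
        TMS.IsCriticalPoint TMS.potential (TMS.regularGon c l' b' φ) → l' = l ∧ b' = b) ∧
      TMS.IsNondegenerateCriticalPoint TMS.polarPotential (TMS.gonCoord c l b) ∧
      (∀ φ : ℝ, TMS.IsLocalLearningCoefficient TMS.potential (TMS.regularGon c l b φ)
        ((3 * (c : ℝ) - 1) / 2)) := by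
  have key : 0 < c ∧ ∃ l b : ℝ, |l - l₀| < 0.000005 ∧ |b - b₀| < 0.000005 ∧ TMS.StableGon c l b ∧
      ∀ l' b' φ : ℝ, 0 < l' → b' ≤ 0 → -l' ^ 2 * Real.cos (2 * Real.pi / c) ≤ b' →
        TMS.IsCriticalPoint TMS.potential (TMS.regularGon c l' b' φ) → l' = l ∧ b' = b := by
    simp only [Set.mem_insert_iff, Set.mem_singleton_iff, Prod.mk.injEq] at hc
    rcases hc with ⟨rfl, rfl, rfl⟩ | ⟨rfl, rfl, rfl⟩ | ⟨rfl, rfl, rfl⟩ | ⟨rfl, rfl, rfl⟩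
    · exact ⟨by norm_num, TMS.exists_pentagon_minimum⟩
    · exact ⟨by norm_num, TMS.exists_hexagon_minimum⟩
    · exact ⟨by norm_num, TMS.exists_heptagon_minimum⟩
    · exact ⟨by norm_num, TMS.exists_octagon_minimum⟩
  obtain ⟨hc0, l, b, hl, hb, hgon, huniq⟩ := key
  have : NeZero c := ⟨hc0.ne'⟩
  exact ⟨l, b, hl, hb, hgon.length_pos, hgon.bias_neg, hgon.lt_bias, hgon.isCriticalPoint, huniq,
    hgon.isNondegenerateCriticalPoint, hgon.isLocalLearningCoefficient⟩
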